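/- **Setting.** Let $N$ agents have costs $J_1,\dots,J_N:\mathbb{R}^M\to\mathbb{R}$ ($M\ge 1$), let $A=[a_{\ell k}]$ be a matrix with $a_{\ell k}\ge 0$ and $\sum_\ell a_{\ell k}=1$ whose graph of positive weights is strongly connected with at least one self-loop $a_{kk}>0$, let $p$ be its Perron vector ($Ap=p$, $\sum_k p_k=1$, $p_k>0$), and let $J=\sum_k p_kJ_k$. Each $J_k$ is twice differentiable, and for constants $\delta>0$, $G$, $\rho$ and all $x,y,k,\ell$: $\|\nabla J_k(x)-\nabla J_k(y)\|\le\delta\|x-y\|$, $\|\nabla J_k(x)-\nabla J_\ell(x)\|\le G$, $\|\nabla^2J_k(x)-\nabla^2J_k(y)\|\le\rho\|x-y\|$. $J$ is bounded from below and $J^o=\inf J$. From deterministic points $w_{k,0}$ the diffusion strategy with step-size $\mu>0$ is $w_{k,i}=\sum_\ell a_{\ell k}\big(w_{\ell,i-1}-\mu\widehat{\nabla J}_\ell(w_{\ell,i-1})\big)$, with centroid $w_{c,i}=\sum_kp_kw_{k,i}$. Let $\mathcal F_i$ be generated by all $w_{k,j}$, $j\le i$, and let $s_{k,i}=\widehat{\nabla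 J}_k(w_{k,i-1})-\nabla J_k(w_{k,i-1})$ be the gradient noise. Fix $0<\pi<1$, $\tau>0$ and constants $\sigma,\sigma_\ell>0$, $\beta_R$, $0<\gamma\le4$. Put $c_1=\tfrac12(1-2\mu\delta)$, $c_2=\delta\sigma^2/2$ and $$\mathcal G^C=\{w:\|\nabla J(w)\|^2<\mu\tfrac{c_2}{c_1}(1+\tfrac1\pi)\},\quad \mathcal H=\{w\in\mathcal G^C:\lambda_{\min}(\nabla^2J(w))\le-\tau\},\quad \mathcal M=\{w\in\mathcal G^C:\lambda_{\min}(\nabla^2J(w))>-\tau\}.$$ The noise satisfies, for all $i\ge1$: $\mathbb E\{s_{k,i}\mid\mathcal F_{i-1}\}=0$; $\mathbb E\{\|s_{k,i}\|^4\mid\mathcal F_{i-1}\}\le\sigma^4$; $\mathbb E\{s_{k,i}s_{\ell,i}^{\mathsf T}\mid\mathcal F_{i-1}\}=0$ for $k\ne\ell$; $\mathbb E\{s_{k,i}s_{k,i}^{\mathsf T}\mid\mathcal F_{i-1}\}=R_{s,k}(w_{k,i-1})$ for matrix functions with $\|R_{s,k}(x)-R_{s,k}(y)\|\le\beta_R\|x-y\|^\gamma$;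 and, for every $w\in\mathcal H$, $v^{\mathsf T}\big(\sum_kp_k^2R_{s,k}(w)\big)v\ge\sigma_\ell^2\|v\|^2$ for all $v$ in the span of the eigenvectors of $\nabla^2J(w)$ with negative eigenvalue. **Theorem.** For all sufficiently small step-sizes $\mu$ (depending on $A$, the $J_k$, the initial points and the constants above, but not on the realization of the noise process), with probability at least $1-\pi$ there is an index $i^o$ with $$i^o\le\frac{J(w_{c,0})-J^o}{\mu^2c_2\pi}\,i^s,\qquad i^s=\frac{\log\!\big(2M\frac{\sigma^2}{\sigma_\ell^2}+1\big)}{\log(1+2\mu\tau)}\le O\!\Big(\frac1{\mu\tau}\Big),$$ such that $w_{c,i^o}\in\mathcal M$; in particular $\|\nabla J(w_{c,i^o})\|^2\le O(\mu)$ and $\lambda_{\min}(\nabla^2J(w_{c,i^o}))\ge-\tau$. -/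

import Mathlib

open MeasureTheory
open scoped InnerProductSpace

noncomputable section

namespace Diffusion

/-- The parameter space `ℝ^M` with its Euclidean norm. -/
abbrev E (M : ℕ) : Type := EuclideanSpace ℝ (Fin M)

/-! ### Network -/

/-- Combination weights `A = [a_{ℓk}]`: nonnegative, every column sums to one, the graph of the
positive weights is strongly connected, and at least one agent has a self-loop. -/
structure IsCombinationMatrix {N : ℕ} (A : Matrix (Fin N) (Fin N) ℝ) : Prop where
  nonneg : ∀ l k, 0 ≤ A l k
  sum_col : ∀ k, ∑ l, A l k = 1
  path : ∀ l k, Relation.ReflTransGen (fun i j => 0 < A i j) l k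
  self_loop : ∃ k, 0 < A k k

/-- The Perron vector of `A`, normalized: `A p = p`, `∑ p_k = 1`, `p_k > 0`. -/
structure IsPerronVector {N : ℕ} (A : Matrix (Fin N) (Fin N) ℝ) (p : Fin N → ℝ) : Prop where
  fixed : A.mulVec p = p
  sum_one : ∑ k, p k = 1
  pos : ∀ k, 0 < p k

/-! ### Costs -/

/-- The aggregate cost `J(w) = ∑ p_k J_k(w)`. -/
def aggCost {N M : ℕ} (p : Fin N → ℝ) (J : Fin N → E M → ℝ) (x : E M) : ℝ :=
  ∑ k, p k * J k x

/-- The Hessian `∇²f(x)`, as the operator `v ↦ ∇²f(x) v`. -/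
def hessian {M : ℕ} (f : E M → ℝ) (x : E M) : E M →L[ℝ] E M :=
  fderiv ℝ (gradient f) x

/-- The smallest (real) eigenvalue. -/
def lambdaMin {M : ℕ} (T : E M →L[ℝ] E M) : ℝ :=
  sInf {a : ℝ | Module.End.HasEigenvalue (T : E M →ₗ[ℝ] E M) a}

/-- The span of all eigenvectors with negative eigenvalue: for a symmetric `T = V Λ Vᵀ` this is
the column space of `V^{<0}`. -/
def negEigenspace {M : ℕ} (T : E M →L[ℝ] E M) : Submodule ℝ (E M) :=
  ⨆ (a : ℝ) (_ : a < 0), Module.End.eigenspace (T : E M →ₗ[ℝ] E M) a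

/-- Conditions on the local costs: `J_k` is twice differentiable, `∇J_k` is `δ`-Lipschitz,
`‖∇J_k - ∇J_ℓ‖ ≤ G`, and `∇²J_k` is `ρ`-Lipschitz (spectral norm). -/
structure CostConditions {N M : ℕ} (J : Fin N → E M → ℝ) (δ G ρ : ℝ) : Prop where
  differentiable : ∀ k, Differentiable ℝ (J k)
  differentiable_gradient : ∀ k, Differentiable ℝ (gradient (J k))
  lipschitz_gradient : ∀ k x y, ‖gradient (J k) x - gradient (J k) y‖ ≤ δ * ‖x - y‖
  bounded_disagreement : ∀ k l x, ‖gradient (J k) x - gradient (J l) x‖ ≤ G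
  lipschitz_hessian : ∀ k x y, ‖hessian (J k) x - hessian (J k) y‖ ≤ ρ * ‖x - y‖

/-! ### Approximately stationary points -/

/-- `c₁ = (1 - 2μδ)/2`. -/
def c1 (δ μ : ℝ) : ℝ := (1 / 2) * (1 - 2 * μ * δ)

/-- `c₂ = δσ²/2`. -/
def c2 (δ σ : ℝ) : ℝ := δ * σ ^ 2 / 2

/-- `𝒢ᶜ`: points with `‖∇J(w)‖² < μ (c₂/c₁) (1 + 1/π)`. -/
def smallGradient {M : ℕ} (f : E M → ℝ) (δ σ π μ : ℝ) : Set (E M) :=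
  {x | ‖gradient f x‖ ^ 2 < μ * (c2 δ σ / c1 δ μ) * (1 + 1 / π)}

/-- `ℋ`: approximate strict saddle points. -/
def strictSaddle {M : ℕ} (f : E M → ℝ) (δ σ τ π μ : ℝ) : Set (E M) :=
  {x | x ∈ smallGradient f δ σ π μ ∧ lambdaMin (hessian f x) ≤ -τ}

/-- `ℳ`: approximately second-order stationary points. -/
def secondOrder {M : ℕ} (f : E M → ℝ) (δ σ τ π μ : ℝ) : Set (E M) :=
  {x | x ∈ smallGradient f δ σ π μ ∧ -τ < lambdaMin (hessian f x)}

/-- The escape time `i^s = log(2Mσ²/σ_ℓ² + 1) / log(1 + 2μτ)`, a real number. -/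
def escapeTime (M : ℕ) (σ σl τ μ : ℝ) : ℝ :=
  Real.log (2 * (M : ℝ) * (σ ^ 2 / σl ^ 2) + 1) / Real.log (1 + 2 * μ * τ)

/-! ### The diffusion strategy -/

section Iterates

variable {N M : ℕ} {Ω : Type*}

/-- The iterates `w_{k,i}`. Here `g i k x ω` is the realization at iteration `i` of the stochastic
gradient `∇Ĵ_k` at the point `x`, and
`w_{k,i+1} = ∑_ℓ a_{ℓk} (w_{ℓ,i} - μ ∇Ĵ_ℓ(w_{ℓ,i}))`, with deterministic initial points `w0`. -/
def iterate (A : Matrix (Fin N) (Fin N) ℝ) (μ : ℝ) (w0 : Fin N → E M)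
    (g : ℕ → Fin N → E M → Ω → E M) : ℕ → Fin N → Ω → E M
  | 0 => fun k _ => w0 k
  | i + 1 => fun k ω =>
      ∑ l, A l k • (iterate A μ w0 g i l ω - μ • g (i + 1) l (iterate A μ w0 g i l ω) ω)

/-- The weighted centroid `∑ p_k x_k`. -/
def centroid (p : Fin N → ℝ) (x : Fin N → E M) : E M := ∑ k, p k • x k

/-- The gradient noise `s_{k,i+1}(w_{k,i}) = ∇Ĵ_k(w_{k,i}) - ∇J_k(w_{k,i})` at iteration `i + 1`,
along the iterates `w`. -/
def noise (J : Fin N → E M → ℝ) (g : ℕ → Fin N → E M → Ω → E M) (w : ℕ → Fin N → Ω → E M)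
    (i : ℕ) (k : Fin N) (ω : Ω) : E M :=
  g (i + 1) k (w i k ω) ω - gradient (J k) (w i k ω)

/-- `F_i`: the σ-algebra generated by all `w_{k,j}` with `j ≤ i`. -/
@[reducible] def past (w : ℕ → Fin N → Ω → E M) (i : ℕ) : MeasurableSpace Ω :=
  ⨆ (j : ℕ) (_ : j ≤ i) (k : Fin N), MeasurableSpace.comap (w j k) inferInstance

/-- Conditions on the gradient noise along the iterates `w`: conditionally zero mean, conditional
fourth moment at most `σ⁴`, and conditionally uncorrelated across agents. -/
structure NoiseConditions [MeasurableSpace Ω] (P : Measure Ω) (J : Fin N → E M → ℝ)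
    (g : ℕ → Fin N → E M → Ω → E M) (w : ℕ → Fin N → Ω → E M) (σ : ℝ) : Prop where
  measurable : ∀ i k, Measurable (fun ω => g (i + 1) k (w i k ω) ω)
  integrable : ∀ i k, Integrable (fun ω => ‖noise J g w i k ω‖ ^ 4) P
  zero_mean : ∀ i k, P[noise J g w i k | past w i] =ᵐ[P] 0
  fourth_moment : ∀ i k,
    P[fun ω => ‖noise J g w i k ω‖ ^ 4 | past w i] ≤ᵐ[P] fun _ => σ ^ 4
  uncorrelated : ∀ i k l, k ≠ l → ∀ u v : E M,
    P[fun ω => ⟪noise J g w i k ω, u⟫_ℝ * ⟪noise J g w i l ω, v⟫_ℝ | past w i] =ᵐ[P] 0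

/-- `R k` is the covariance of the gradient noise of agent `k` as a function of the iterate:
`E{s_{k,i+1} s_{k,i+1}ᵀ | F_i} = R_k(w_{k,i})`, tested against all pairs of vectors. -/
def IsNoiseCovariance [MeasurableSpace Ω] (P : Measure Ω) (J : Fin N → E M → ℝ)
    (g : ℕ → Fin N → E M → Ω → E M) (w : ℕ → Fin N → Ω → E M)
    (R : Fin N → E M → E M →L[ℝ] E M) : Prop :=
  ∀ i k, ∀ u v : E M,
    P[fun ω => ⟪noise J g w i k ω, u⟫_ℝ * ⟪noise J g w i k ω, v⟫_ℝ | past w i]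
      =ᵐ[P] fun ω => ⟪R k (w i k ω) u, v⟫_ℝ

end Iterates

/-- Lipschitz covariances: `‖R_k(x) - R_k(y)‖ ≤ β ‖x - y‖^γ` (spectral norm). -/
def LipschitzCovariance {N M : ℕ} (R : Fin N → E M → E M →L[ℝ] E M) (β γ : ℝ) : Prop :=
  ∀ k x y, ‖R k x - R k y‖ ≤ β * ‖x - y‖ ^ γ

/-- The covariance `∑ p_k² R_k(w)` of the aggregate noise `∑ p_k s_k` when all agents are at `w`. -/
def aggCovariance {N M : ℕ} (p : Fin N → ℝ) (R : Fin N → E M → E M →L[ℝ] E M) (x : E M) :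
    E M →L[ℝ] E M :=
  ∑ k, p k ^ 2 • R k x

/-- Gradient noise in strict saddle points: at every point of `S` the aggregate covariance,
compressed to the span of the eigenvectors of the Hessian with negative eigenvalue, is at least
`σ_ℓ² I`, i.e. `λ_min((V^{<0})ᵀ R V^{<0}) ≥ σ_ℓ²`. -/
def NoiseInSaddles {N M : ℕ} (p : Fin N → ℝ) (R : Fin N → E M → E M →L[ℝ] E M)
    (f : E M → ℝ) (S : Set (E M)) (σl : ℝ) : Prop :=
  ∀ x ∈ S, ∀ v ∈ negEigenspace (hessian f x),
    σl ^ 2 * ‖v‖ ^ 2 ≤ ⟪aggCovariance p R x v, v⟫_ℝ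

end Diffusion

end

/-!
Write `c_i` for the centroid of the network at time `i` and `J` for the aggregate cost. Averaging the
recursion with the Perron vector gives `c_{i+1} = c_i - μ (∇J(c_i) + d_i + s_i)`, where `s_i` is the
aggregate noise and the bias `d_i` is at most `δ` times the disagreement between the agents.

*Disagreement.* A power of `A` dominates a multiple of the rank-one averaging matrix, so it contracts
the spread around the centroid (Doeblin). Summing the spreads of the first few mixed states with
geometric weights gives a seminorm that contracts in one step (`nonempty_disagreementGauge`); hence
the disagreement is of order `μ` in root mean square, once its initial value is forgotten. All later
arguments only see the resulting abstract recursion, the structure `NoisyDescent`.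

*Descent.* The potential `V_i = J(c_i) + a ℓ_i²`, with `ℓ_i` the disagreement and `a` a small constant,
decreases in the mean by `(5/8) μ ‖∇J(c_i)‖²` plus a multiple of `ℓ_i²`, up to `(5/4) c₂ μ²`
(`NoisyDescent.potential_step`). So it loses at least `c₂ μ²` in one step unless the gradient is small
and `ℓ_i² = O(μ²)`.

*Escape.* Let the gradient be small at `x`, let `v` be a unit eigenvector of `∇²J(x)` with eigenvalue
`-λ ≤ -τ`, and let `c_i` be within `μ` of `x`. During `O(1/μ)` steps the centroid stays within `O(√μ)`
of `x` in the fourth mean, so the gradient differs from its linearization at `x` by `O(μ)` in root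
mean square. The component of the linearized gradient along `v` satisfies
`y_{j+1} = (1 + μ λ) y_j + μ λ ⟨v, s_j⟩ + O(μ²)`, so already the random-walk effect of the noise makes
`E y_j²` grow by at least `μ² τ² σ_ℓ² / 4` per step. After `K ≈ κ/μ` steps, `κ` a large constant, the
mean of `‖∇J‖²` over the block is a large multiple of `μ`, and the descent it causes outweighs the
noise: the potential loses at least `c₂ μ² K` (`NoisyDescent.potential_block`). Only small
neighbourhoods of fixed points `x` are considered, so that `v` does not depend on the realization; a
countable cover yields the general case.

*Time bound.* An induction over the events of the past, instead of stopping times, turns these two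
decreases into a bound `O(1/(μ² n))` for the probability of having met no second-order stationary
point up to time `n` (`avoid_prob_le`). The bound claimed for `i^o` is of order `μ⁻³`, because
`i^s` is of order `μ⁻¹`; this leaves room for all constants. The only case without room is that of an
initial centroid which minimizes `J`, and this point is second-order stationary itself.
-/

noncomputable section

namespace Diffusion

/-! ### Contraction of the network disagreement -/

section Network

variable {N M : ℕ} {A : Matrix (Fin N) (Fin N) ℝ} {p : Fin N → ℝ}

/-- One combination step of the network: agent `k` averages the vectors of its neighbours. -/
def mix (A : Matrix (Fin N) (Fin N) ℝ) (x : Fin N → E M) : Fin N → E M :=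
  fun k => ∑ l, A l k • x l

lemma mix_add (x y : Fin N → E M) : mix A (x + y) = mix A x + mix A y := by
  funext k; simp [mix, Finset.sum_add_distrib]

lemma iterate_mix_add (n : ℕ) (x y : Fin N → E M) :
    (mix A)^[n] (x + y) = (mix A)^[n] x + (mix A)^[n] y := by
  induction n generalizing x y with
  | zero => rfl
  | succ n ih => simp [Function.iterate_succ_apply, mix_add, ih]

lemma continuous_mix : Continuous (mix (M := M) A) := by
  unfold mix; fun_prop

lemma continuous_centroid : Continuous (centroid (M := M) p) := by
  unfold centroid; fun_prop

lemma IsPerronVector.le_one (hp : IsPerronVector A p) (k : Fin N) : p k ≤ 1 := by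
  rw [← hp.sum_one]
  exact Finset.single_le_sum (fun i _ => (hp.pos i).le) (Finset.mem_univ k)

lemma IsPerronVector.sum_row (hp : IsPerronVector A p) (l : Fin N) :
    ∑ k, A l k * p k = p l := by
  simpa [Matrix.mulVec, dotProduct] using congrFun hp.fixed l

lemma IsPerronVector.nonempty (hp : IsPerronVector A p) : Nonempty (Fin N) := by
  by_contra h
  rw [not_nonempty_iff] at h
  simpa using hp.sum_one

lemma centroid_mix (hp : IsPerronVector A p) (x : Fin N → E M) :
    centroid p (mix A x) = centroid p x := by
  simp only [centroid, mix, Finset.smul_sum, smul_smul]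
  rw [Finset.sum_comm]
  refine Finset.sum_congr rfl fun l _ => ?_
  rw [← Finset.sum_smul]
  congr 1
  rw [← hp.sum_row l]
  exact Finset.sum_congr rfl fun k _ => mul_comm _ _

lemma centroid_sub_const (hp : IsPerronVector A p) (x : Fin N → E M) (c : E M) :
    centroid p x - c = ∑ k, p k • (x k - c) := by
  simp [centroid, smul_sub, Finset.sum_sub_distrib, ← Finset.sum_smul, hp.sum_one]

lemma iterate_mix_apply (n : ℕ) (x : Fin N → E M) (k : Fin N) :
    (mix A)^[n] x k = ∑ l, (A ^ n) l k • x l := by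
  induction n generalizing k with
  | zero => simp [Matrix.one_apply]
  | succ n ih =>
    rw [Function.iterate_succ_apply', pow_succ]
    simp only [mix, ih, Finset.smul_sum, smul_smul, Matrix.mul_apply, Finset.sum_smul]
    rw [Finset.sum_comm]
    exact Finset.sum_congr rfl fun l _ => Finset.sum_congr rfl fun m _ => by rw [mul_comm]

lemma IsCombinationMatrix.pow_nonneg (hA : IsCombinationMatrix A) (n : ℕ) (l k : Fin N) :
    0 ≤ (A ^ n) l k := by
  induction n generalizing l k with
  | zero => simp only [pow_zero, Matrix.one_apply]; split_ifs <;> norm_num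
  | succ n ih =>
    rw [pow_succ, Matrix.mul_apply]
    exact Finset.sum_nonneg fun m _ => mul_nonneg (ih l m) (hA.nonneg m k)

lemma IsCombinationMatrix.pow_sum_col (hA : IsCombinationMatrix A) (n : ℕ) (k : Fin N) :
    ∑ l, (A ^ n) l k = 1 := by
  induction n generalizing k with
  | zero => simp [Matrix.one_apply]
  | succ n ih =>
    simp only [pow_succ, Matrix.mul_apply]
    rw [Finset.sum_comm]
    simp [← Finset.sum_mul, ih, hA.sum_col]

lemma IsPerronVector.pow_sum_row (hp : IsPerronVector A p) (n : ℕ) (l : Fin N) :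
    ∑ k, (A ^ n) l k * p k = p l := by
  induction n generalizing l with
  | zero => simp [Matrix.one_apply]
  | succ n ih =>
    simp only [pow_succ, Matrix.mul_apply, Finset.sum_mul]
    rw [Finset.sum_comm]
    simp only [mul_assoc, ← Finset.mul_sum, hp.sum_row, ih]

lemma IsCombinationMatrix.pow_mul_pow_le (hA : IsCombinationMatrix A) (m n : ℕ)
    (i j k : Fin N) : (A ^ m) i j * (A ^ n) j k ≤ (A ^ (m + n)) i k := by
  rw [pow_add, Matrix.mul_apply]
  exact Finset.single_le_sum
    (f := fun j => (A ^ m) i j * (A ^ n) j k)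
    (fun l _ => mul_nonneg (hA.pow_nonneg m i l) (hA.pow_nonneg n l k)) (Finset.mem_univ j)

lemma IsCombinationMatrix.exists_pow_pos (hA : IsCombinationMatrix A) (l k : Fin N) :
    ∃ n, 0 < (A ^ n) l k := by
  induction hA.path l k with
  | refl => exact ⟨0, by simp⟩
  | tail _ h ih =>
    obtain ⟨n, hn⟩ := ih
    refine ⟨n + 1, lt_of_lt_of_le (mul_pos hn ?_) (hA.pow_mul_pow_le n 1 _ _ _)⟩
    simpa using h

/-- Strong connectivity and one self-loop make `A` primitive: a path is padded to a prescribed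
length by going round the loop. -/
lemma IsCombinationMatrix.exists_pow_all_pos (hA : IsCombinationMatrix A) :
    ∃ n, ∀ l k, 0 < (A ^ n) l k := by
  obtain ⟨o, ho⟩ := hA.self_loop
  choose a ha using fun l => hA.exists_pow_pos l o
  choose b hb using fun k => hA.exists_pow_pos o k
  have hloop : ∀ m, 0 < (A ^ m) o o := by
    intro m
    induction m with
    | zero => simp
    | succ m ih =>
      exact lt_of_lt_of_le (mul_pos ih (by simpa using ho)) (hA.pow_mul_pow_le m 1 o o o)
  refine ⟨(∑ l, a l) + ∑ k, b k, fun l k => ?_⟩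
  have h1 : a l ≤ ∑ l, a l := Finset.single_le_sum (fun i _ => Nat.zero_le _) (Finset.mem_univ l)
  have h2 : b k ≤ ∑ l, b l := Finset.single_le_sum (fun i _ => Nat.zero_le _) (Finset.mem_univ k)
  have h3 : (∑ l, a l) + ∑ k, b k = (a l + ((∑ l, a l) + (∑ k, b k) - a l - b k)) + b k := by
    omega
  rw [h3]
  refine lt_of_lt_of_le (mul_pos ?_ (hb k)) (hA.pow_mul_pow_le _ _ l o k)
  exact lt_of_lt_of_le (mul_pos (ha l) (hloop _)) (hA.pow_mul_pow_le _ _ l o o)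

/-- The weighted mean distance of the agents' vectors from their centroid. -/
def spread (p : Fin N → ℝ) (x : Fin N → E M) : ℝ := ∑ k, p k * ‖x k - centroid p x‖

lemma continuous_spread : Continuous (spread (M := M) p) := by
  have := continuous_centroid (M := M) (p := p)
  unfold spread; fun_prop

lemma spread_nonneg (hp : IsPerronVector A p) (x : Fin N → E M) : 0 ≤ spread p x :=
  Finset.sum_nonneg fun k _ => mul_nonneg (hp.pos k).le (norm_nonneg _)

lemma spread_add_le (hp : IsPerronVector A p) (x y : Fin N → E M) :
    spread p (x + y) ≤ spread p x + spread p y := by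
  rw [spread, spread, spread, ← Finset.sum_add_distrib]
  refine Finset.sum_le_sum fun k _ => ?_
  rw [← mul_add]
  refine mul_le_mul_of_nonneg_left ?_ (hp.pos k).le
  have : (x + y) k - centroid p (x + y)
      = (x k - centroid p x) + (y k - centroid p y) := by
    simp only [centroid, Pi.add_apply, smul_add, Finset.sum_add_distrib]; abel
  rw [this]
  exact norm_add_le _ _

lemma spread_le_sum (hp : IsPerronVector A p) (x : Fin N → E M) (c : E M) :
    spread p x ≤ 2 * ∑ k, ‖x k - c‖ := by
  have h1 : ‖centroid p x - c‖ ≤ ∑ k, ‖x k - c‖ := by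
    rw [centroid_sub_const hp]
    refine (norm_sum_le _ _).trans (Finset.sum_le_sum fun k _ => ?_)
    rw [norm_smul, Real.norm_of_nonneg (hp.pos k).le]
    exact mul_le_of_le_one_left (norm_nonneg _) (hp.le_one k)
  have h2 : ∀ k, p k * ‖x k - centroid p x‖ ≤ ‖x k - c‖ + p k * ‖centroid p x - c‖ := by
    intro k
    have h3 : ‖x k - centroid p x‖ ≤ ‖x k - c‖ + ‖centroid p x - c‖ := by
      rw [← sub_sub_sub_cancel_right (x k) (centroid p x) c]; exact norm_sub_le _ _
    nlinarith [hp.pos k, hp.le_one k, norm_nonneg (x k - c)]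
  refine (Finset.sum_le_sum fun k _ => h2 k).trans ?_
  rw [Finset.sum_add_distrib, ← Finset.sum_mul, hp.sum_one]
  linarith

/-- Doeblin's argument: a common lower bound `ε p` for the rows of `A ^ n` can be subtracted from
the averaging weights, since it annihilates the deviations from the centroid. -/
lemma spread_iterate_mix_le (hp : IsPerronVector A p) {n : ℕ} {ε : ℝ}
    (hε : ∀ l k, ε * p l ≤ (A ^ n) l k) (hA : IsCombinationMatrix A) (x : Fin N → E M) :
    spread p ((mix A)^[n] x) ≤ (1 - ε) * spread p x := by
  have hc : centroid p ((mix A)^[n] x) = centroid p x := by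
    clear hε
    induction n with
    | zero => rfl
    | succ n ih => rw [Function.iterate_succ_apply', centroid_mix hp, ih]
  set c := centroid p x with hcdef
  have h0 : ∑ l, p l • (x l - c) = 0 := by
    rw [← centroid_sub_const hp, hcdef, sub_self]
  have h1 : ∀ k, (mix A)^[n] x k - c = ∑ l, ((A ^ n) l k - ε * p l) • (x l - c) := by
    intro k
    simp only [sub_smul, Finset.sum_sub_distrib, mul_smul, ← Finset.smul_sum, h0, smul_zero,
      sub_zero]
    rw [iterate_mix_apply]
    simp [smul_sub, Finset.sum_sub_distrib, ← Finset.sum_smul, hA.pow_sum_col]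
  have h2 : ∀ k, ‖(mix A)^[n] x k - c‖ ≤ ∑ l, ((A ^ n) l k - ε * p l) * ‖x l - c‖ := by
    intro k
    rw [h1]
    refine (norm_sum_le _ _).trans (Finset.sum_le_sum fun l _ => ?_)
    rw [norm_smul, Real.norm_of_nonneg (sub_nonneg.2 (hε l k))]
  calc spread p ((mix A)^[n] x)
      = ∑ k, p k * ‖(mix A)^[n] x k - c‖ := by rw [spread, hc]
    _ ≤ ∑ k, p k * ∑ l, ((A ^ n) l k - ε * p l) * ‖x l - c‖ :=
        Finset.sum_le_sum fun k _ => mul_le_mul_of_nonneg_left (h2 k) (hp.pos k).le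
    _ = ∑ l, (∑ k, ((A ^ n) l k * p k) - ε * p l * ∑ k, p k) * ‖x l - c‖ := by
        simp only [Finset.mul_sum, ← Finset.sum_sub_distrib, Finset.sum_mul]
        rw [Finset.sum_comm]
        exact Finset.sum_congr rfl fun l _ => Finset.sum_congr rfl fun k _ => by ring
    _ = (1 - ε) * spread p x := by
        simp only [hp.pow_sum_row, hp.sum_one, spread, Finset.mul_sum]
        exact Finset.sum_congr rfl fun l _ => by ring

/-- A measure of the disagreement between the agents that contracts in every single combination
step: a seminorm on the network states which vanishes on consensus states, dominates the distance
of each agent from the centroid, and shrinks by the factor `rate < 1` under `mix A`. -/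
structure DisagreementGauge (A : Matrix (Fin N) (Fin N) ℝ) (p : Fin N → ℝ) (M : ℕ) where
  /-- the seminorm -/
  gauge : (Fin N → E M) → ℝ
  /-- the contraction factor -/
  rate : ℝ
  /-- the constant in the comparison with `∑ ‖x_k - c‖` -/
  bound : ℝ
  continuous : Continuous gauge
  rate_pos : 0 < rate
  rate_lt_one : rate < 1
  bound_pos : 0 < bound
  norm_sub_centroid_le : ∀ x k, ‖x k - centroid p x‖ ≤ gauge x
  mix_le : ∀ x, gauge (mix A x) ≤ rate * gauge x
  add_le : ∀ x y, gauge (x + y) ≤ gauge x + gauge y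
  le_sum : ∀ x c, gauge x ≤ bound * ∑ k, ‖x k - c‖

/-- Some power `A ^ n` contracts the spread; summing the spreads of the first `n` mixed states with
geometric weights gives a seminorm that already contracts in one step. -/
theorem nonempty_disagreementGauge (hA : IsCombinationMatrix A) (hp : IsPerronVector A p) :
    Nonempty (DisagreementGauge A p M) := by
  have := hp.nonempty
  obtain ⟨n₀, hn₀⟩ := hA.exists_pow_all_pos
  -- a positive power, so that the sum below is not empty
  obtain ⟨n, hn0, hn⟩ : ∃ n, 0 < n ∧ ∀ l k, 0 < (A ^ n) l k := by
    refine ⟨n₀ + n₀ + 1, by omega, fun l k => ?_⟩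
    obtain ⟨o, ho⟩ := hA.self_loop
    have h1 : 0 < (A ^ (n₀ + 1)) l o :=
      lt_of_lt_of_le (mul_pos (hn₀ l o) (by simpa using ho)) (hA.pow_mul_pow_le n₀ 1 l o o)
    have := lt_of_lt_of_le (mul_pos h1 (hn₀ o k)) (hA.pow_mul_pow_le (n₀ + 1) n₀ l o k)
    rwa [show n₀ + n₀ + 1 = n₀ + 1 + n₀ by omega]
  obtain ⟨ε, hε0, hε1, hε⟩ : ∃ ε : ℝ, 0 < ε ∧ ε < 1 ∧ ∀ l k, ε * p l ≤ (A ^ n) l k := by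
    obtain ⟨z, hz⟩ := Finite.exists_min fun z : Fin N × Fin N => (A ^ n) z.1 z.2
    refine ⟨min ((A ^ n) z.1 z.2) (1 / 2), lt_min (hn _ _) (by norm_num),
      (min_le_right _ _).trans_lt (by norm_num), fun l k => ?_⟩
    have h1 : min ((A ^ n) z.1 z.2) (1 / 2) ≤ (A ^ n) l k := (min_le_left _ _).trans (hz (l, k))
    have h2 : (0 : ℝ) ≤ min ((A ^ n) z.1 z.2) (1 / 2) := le_min (hn _ _).le (by norm_num)
    exact (mul_le_of_le_one_right h2 (hp.le_one l)).trans h1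
  obtain ⟨k₀, hk₀⟩ := Finite.exists_min p
  set θ : ℝ := 1 - ε / n with hθ
  have hn1 : (1 : ℝ) ≤ n := by exact_mod_cast hn0
  have hεn : ε / n ≤ ε := div_le_self hε0.le hn1
  have hθ0 : 0 < θ := by rw [hθ]; linarith
  have hθ1 : θ < 1 := by rw [hθ]; linarith [div_pos hε0 (by linarith : (0 : ℝ) < n)]
  have hθn : 1 - ε ≤ θ ^ n := by
    have h := one_add_mul_le_pow (a := -(ε / n)) (by linarith) n
    have h2 : (n : ℝ) * -(ε / n) = -ε := by field_simp
    rw [h2] at h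
    simpa [hθ, sub_eq_add_neg] using h
  set q : ℝ := θ⁻¹ with hq
  have hq0 : 0 < q := inv_pos.2 hθ0
  have hθq : θ * q = 1 := mul_inv_cancel₀ hθ0.ne'
  set S : ℕ → (Fin N → E M) → ℝ := fun j x => spread p ((mix A)^[j] x) with hS
  set c₀ : ℝ := (p k₀)⁻¹ with hc₀
  have hc₀pos : 0 < c₀ := inv_pos.2 (hp.pos k₀)
  have hSnn : ∀ j x, 0 ≤ S j x := fun j x => spread_nonneg hp _
  have hS0 : ∀ x, S 0 x ≤ ∑ j ∈ Finset.range n, q ^ j * S j x := by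
    intro x
    have := Finset.single_le_sum (f := fun j => q ^ j * S j x)
      (fun j _ => mul_nonneg (pow_nonneg hq0.le j) (hSnn j x)) (Finset.mem_range.2 hn0)
    simpa using this
  refine ⟨{
    gauge := fun x => c₀ * ∑ j ∈ Finset.range n, q ^ j * S j x
    rate := θ
    bound := c₀ * ∑ j ∈ Finset.range n, q ^ j * 2
    continuous := ?_
    rate_pos := hθ0
    rate_lt_one := hθ1
    bound_pos := ?_
    norm_sub_centroid_le := ?_
    mix_le := ?_
    add_le := ?_
    le_sum := ?_ }⟩
  · refine continuous_const.mul (continuous_finsetSum _ fun j _ => continuous_const.mul ?_)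
    exact continuous_spread.comp (continuous_mix.iterate j)
  · refine mul_pos hc₀pos (Finset.sum_pos (fun j _ => by positivity) ?_)
    simpa using hn0.ne'
  · intro x k
    refine le_trans ?_ (mul_le_mul_of_nonneg_left (hS0 x) hc₀pos.le)
    have h1 : p k * ‖x k - centroid p x‖ ≤ S 0 x :=
      Finset.single_le_sum (f := fun k => p k * ‖x k - centroid p x‖)
        (fun k _ => mul_nonneg (hp.pos k).le (norm_nonneg _)) (Finset.mem_univ k)
    have h2 : 1 ≤ c₀ * p k := by
      rw [hc₀, ← inv_mul_cancel₀ (hp.pos k₀).ne']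
      exact mul_le_mul_of_nonneg_left (hk₀ k) (inv_pos.2 (hp.pos k₀)).le
    calc ‖x k - centroid p x‖ ≤ c₀ * p k * ‖x k - centroid p x‖ :=
          le_mul_of_one_le_left (norm_nonneg _) h2
      _ ≤ c₀ * S 0 x := by rw [mul_assoc]; exact mul_le_mul_of_nonneg_left h1 hc₀pos.le
  · intro x
    have hshift : ∀ j, S j (mix A x) = S (j + 1) x := fun j => by
      simp [hS, Function.iterate_succ_apply]
    have h1 := Finset.sum_range_succ' (fun j => q ^ j * S j x) n
    rw [Finset.sum_range_succ] at h1
    have h2 : ∑ j ∈ Finset.range n, q ^ j * S j (mix A x)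
        = θ * ∑ j ∈ Finset.range n, q ^ (j + 1) * S (j + 1) x := by
      rw [Finset.mul_sum]
      refine Finset.sum_congr rfl fun j _ => ?_
      rw [hshift, pow_succ]
      linear_combination (-(q ^ j * S (j + 1) x)) * hθq
    have h3 : q ^ n * S n x ≤ S 0 x := by
      have h4 : S n x ≤ (1 - ε) * S 0 x := spread_iterate_mix_le hp hε hA x
      have h5 : S n x ≤ θ ^ n * S 0 x := h4.trans (mul_le_mul_of_nonneg_right hθn (hSnn 0 x))
      calc q ^ n * S n x ≤ q ^ n * (θ ^ n * S 0 x) :=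
            mul_le_mul_of_nonneg_left h5 (pow_nonneg hq0.le n)
        _ = S 0 x := by rw [← mul_assoc, ← mul_pow, mul_comm q, hθq, one_pow, one_mul]
    simp only [pow_zero, one_mul] at h1
    rw [h2]
    have h6 : ∑ j ∈ Finset.range n, q ^ (j + 1) * S (j + 1) x
        ≤ ∑ j ∈ Finset.range n, q ^ j * S j x := by linarith
    calc c₀ * (θ * ∑ j ∈ Finset.range n, q ^ (j + 1) * S (j + 1) x)
        = θ * (c₀ * ∑ j ∈ Finset.range n, q ^ (j + 1) * S (j + 1) x) := by ring
      _ ≤ θ * (c₀ * ∑ j ∈ Finset.range n, q ^ j * S j x) := by gcongr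
  · intro x y
    rw [← mul_add, ← Finset.sum_add_distrib]
    refine mul_le_mul_of_nonneg_left (Finset.sum_le_sum fun j _ => ?_) hc₀pos.le
    rw [← mul_add]
    refine mul_le_mul_of_nonneg_left ?_ (pow_nonneg hq0.le j)
    simp only [hS, iterate_mix_add]
    exact spread_add_le hp _ _
  · intro x c
    rw [mul_assoc, Finset.sum_mul]
    refine mul_le_mul_of_nonneg_left (Finset.sum_le_sum fun j _ => ?_) hc₀pos.le
    rw [mul_assoc]
    refine mul_le_mul_of_nonneg_left ?_ (pow_nonneg hq0.le j)
    have h1 : S j x ≤ (1 - 0) * spread p x :=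
      spread_iterate_mix_le hp (fun l k => by simpa using hA.pow_nonneg j l k) hA x
    rw [sub_zero, one_mul] at h1
    exact h1.trans (spread_le_sum hp x c)

lemma DisagreementGauge.nonneg [Nonempty (Fin N)] (L : DisagreementGauge A p M)
    (x : Fin N → E M) : 0 ≤ L.gauge x :=
  (norm_nonneg _).trans (L.norm_sub_centroid_le x (Classical.arbitrary _))

end Network

/-! ### The aggregate cost -/

section Cost

variable {N M : ℕ} {f : E M → ℝ} {δ ρ : ℝ}

/-- A cost with `δ`-Lipschitz gradient and `ρ`-Lipschitz Hessian. -/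
structure RegularCost (f : E M → ℝ) (δ ρ : ℝ) : Prop where
  differentiable : Differentiable ℝ f
  differentiable_gradient : Differentiable ℝ (gradient f)
  lipschitz_gradient : ∀ x y, ‖gradient f x - gradient f y‖ ≤ δ * ‖x - y‖
  lipschitz_hessian : ∀ x y, ‖hessian f x - hessian f y‖ ≤ ρ * ‖x - y‖

lemma gradient_aggCost {J : Fin N → E M → ℝ} (p : Fin N → ℝ)
    (hJ : ∀ k, Differentiable ℝ (J k)) (x : E M) :
    gradient (aggCost p J) x = ∑ k, p k • gradient (J k) x := by
  apply HasGradientAt.gradient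
  rw [hasGradientAt_iff_hasFDerivAt]
  have h : HasFDerivAt (fun x => ∑ k, p k * J k x) (∑ k, p k • fderiv ℝ (J k) x) x :=
    HasFDerivAt.fun_sum fun k _ => ((hJ k x).hasFDerivAt).const_mul (p k)
  have h2 : (InnerProductSpace.toDual ℝ (E M)) (∑ k, p k • gradient (J k) x)
      = ∑ k, p k • fderiv ℝ (J k) x := by
    simp [gradient]
  rw [h2]
  exact h

lemma hessian_aggCost {J : Fin N → E M → ℝ} (p : Fin N → ℝ)
    (hJ : ∀ k, Differentiable ℝ (J k)) (hJ' : ∀ k, Differentiable ℝ (gradient (J k))) (x : E M) :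
    hessian (aggCost p J) x = ∑ k, p k • hessian (J k) x := by
  have h : gradient (aggCost p J) = fun x => ∑ k, p k • gradient (J k) x :=
    funext (gradient_aggCost p hJ)
  rw [hessian, h]
  exact (HasFDerivAt.fun_sum fun k _ => ((hJ' k x).hasFDerivAt).const_smul (p k)).fderiv

lemma norm_sum_smul_le {F : Type*} [NormedAddCommGroup F] [NormedSpace ℝ F] {p : Fin N → ℝ}
    (hp0 : ∀ k, 0 ≤ p k) (hp1 : ∑ k, p k = 1) (u : Fin N → F) {b : ℝ} (hu : ∀ k, ‖u k‖ ≤ b) :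
    ‖∑ k, p k • u k‖ ≤ b := by
  refine (norm_sum_le _ _).trans ?_
  calc ∑ k, ‖p k • u k‖ ≤ ∑ k, p k * b := by
        refine Finset.sum_le_sum fun k _ => ?_
        rw [norm_smul, Real.norm_of_nonneg (hp0 k)]
        exact mul_le_mul_of_nonneg_left (hu k) (hp0 k)
    _ = b := by rw [← Finset.sum_mul, hp1, one_mul]

lemma CostConditions.regularCost {J : Fin N → E M → ℝ} {G : ℝ} (hJ : CostConditions J δ G ρ)
    {p : Fin N → ℝ} (hp0 : ∀ k, 0 ≤ p k) (hp1 : ∑ k, p k = 1) :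
    RegularCost (aggCost p J) δ ρ := by
  have hg := gradient_aggCost p hJ.differentiable
  have hh := hessian_aggCost p hJ.differentiable hJ.differentiable_gradient
  refine ⟨?_, ?_, fun x y => ?_, fun x y => ?_⟩
  · exact Differentiable.fun_sum fun k _ => (hJ.differentiable k).const_mul (p k)
  · rw [funext hg]
    exact Differentiable.fun_sum fun k _ => (hJ.differentiable_gradient k).const_smul (p k)
  · rw [hg, hg, ← Finset.sum_sub_distrib]
    simp only [← smul_sub]
    exact norm_sum_smul_le hp0 hp1 _ fun k => hJ.lipschitz_gradient k x y
  · rw [hh, hh, ← Finset.sum_sub_distrib,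
      Finset.sum_congr rfl fun k _ => (smul_sub (p k) (hessian (J k) x) (hessian (J k) y)).symm]
    exact norm_sum_smul_le hp0 hp1 _ fun k => hJ.lipschitz_hessian k x y

/-- The real inner product as a continuous bilinear map. -/
def innerBilin (M : ℕ) : E M →L[ℝ] E M →L[ℝ] ℝ :=
  (innerₗ (E M)).mkContinuous₂ 1 fun x y => by
    simpa using abs_real_inner_le_norm x y

lemma innerBilin_apply (x y : E M) : innerBilin M x y = ⟪x, y⟫_ℝ := rfl

lemma hasDerivAt_line (hf : Differentiable ℝ f) (x v : E M) (t : ℝ) :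
    HasDerivAt (fun t : ℝ => f (x + t • v)) ⟪gradient f (x + t • v), v⟫_ℝ t := by
  have h1 : HasFDerivAt f (fderiv ℝ f (x + t • v)) (x + t • v) := (hf _).hasFDerivAt
  have h2 : HasDerivAt (fun t : ℝ => x + t • v) v t := by
    simpa using ((hasDerivAt_id t).smul_const v).const_add x
  have h3 := h1.comp_hasDerivAt t h2
  rwa [inner_gradient_left]

namespace RegularCost

lemma continuous_gradient (hf : RegularCost f δ ρ) : Continuous (gradient f) :=
  hf.differentiable_gradient.continuous

/-- The descent lemma for a function with Lipschitz gradient. -/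
lemma descent (hf : RegularCost f δ ρ) (x v : E M) :
    f (x + v) ≤ f x + ⟪gradient f x, v⟫_ℝ + δ / 2 * ‖v‖ ^ 2 := by
  have h : ∀ t ∈ Set.Icc (0 : ℝ) 1,
      f (x + t • v) ≤ f x + t * ⟪gradient f x, v⟫_ℝ + δ / 2 * ‖v‖ ^ 2 * t ^ 2 := by
    refine fun t ht => image_le_of_deriv_right_le_deriv_boundary
      (f := fun t : ℝ => f (x + t • v))
      (f' := fun t : ℝ => ⟪gradient f (x + t • v), v⟫_ℝ)
      (B := fun t : ℝ => f x + t * ⟪gradient f x, v⟫_ℝ + δ / 2 * ‖v‖ ^ 2 * t ^ 2)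
      (B' := fun t : ℝ => ⟪gradient f x, v⟫_ℝ + δ * ‖v‖ ^ 2 * t)
      ?_ ?_ ?_ ?_ ?_ ?_ ht
    · exact fun t _ => (hasDerivAt_line hf.differentiable x v t).continuousAt.continuousWithinAt
    · exact fun t _ => (hasDerivAt_line hf.differentiable x v t).hasDerivWithinAt
    · simp
    · fun_prop
    · intro t _
      have h1 := ((hasDerivAt_id t).mul_const ⟪gradient f x, v⟫_ℝ).const_add (f x)
      have h2 := (hasDerivAt_pow 2 t).const_mul (δ / 2 * ‖v‖ ^ 2)
      refine ((h1.add h2).congr_deriv ?_).hasDerivWithinAt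
      simp; ring
    · intro t ht
      have h1 : ⟪gradient f (x + t • v) - gradient f x, v⟫_ℝ ≤ δ * ‖v‖ ^ 2 * t := by
        refine (real_inner_le_norm _ _).trans ?_
        have h2 := hf.lipschitz_gradient (x + t • v) x
        rw [add_sub_cancel_left, norm_smul, Real.norm_of_nonneg ht.1] at h2
        calc _ ≤ δ * (t * ‖v‖) * ‖v‖ := mul_le_mul_of_nonneg_right h2 (norm_nonneg _)
          _ = _ := by ring
      rw [inner_sub_left] at h1
      linarith
  simpa using h 1 (by simp)

lemma norm_gradient_le (hf : RegularCost f δ ρ) (x y : E M) :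
    ‖gradient f y‖ ≤ ‖gradient f x‖ + δ * ‖y - x‖ := by
  have := hf.lipschitz_gradient y x
  have h2 := norm_sub_norm_le (gradient f y) (gradient f x)
  linarith

/-- First-order expansion of the gradient, with quadratic remainder. -/
lemma norm_gradient_sub_le (hf : RegularCost f δ ρ) (hρ : 0 ≤ ρ) (x y : E M) :
    ‖gradient f y - gradient f x - hessian f x (y - x)‖ ≤ ρ * ‖y - x‖ ^ 2 := by
  have h := (convex_closedBall x ‖y - x‖).norm_image_sub_le_of_norm_fderiv_le' (𝕜 := ℝ)
    (f := gradient f) (φ := hessian f x) (C := ρ * ‖y - x‖) (x := x) (y := y)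
    (fun z _ => hf.differentiable_gradient z)
    (fun z hz => by
      refine (hf.lipschitz_hessian z x).trans (mul_le_mul_of_nonneg_left ?_ hρ)
      simpa [dist_eq_norm] using hz)
    (by simp) (by simp [dist_eq_norm])
  calc _ ≤ _ := h
    _ = _ := by ring

lemma isSymmetric_hessian (hf : RegularCost f δ ρ) (x : E M) :
    (hessian f x : E M →ₗ[ℝ] E M).IsSymmetric := by
  intro v w
  have h1 : ∀ y, HasFDerivAt f (fderiv ℝ f y) y := fun y => (hf.differentiable y).hasFDerivAt
  have h2 : HasFDerivAt (fderiv ℝ f) ((innerBilin M).comp (hessian f x)) x := by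
    have h4 : fderiv ℝ f = fun y => innerBilin M (gradient f y) := by
      funext y
      ext z
      rw [innerBilin_apply, inner_gradient_left]
    rw [h4]
    exact (innerBilin M).hasFDerivAt.comp x (hf.differentiable_gradient x).hasFDerivAt
  have h5 : ⟪hessian f x v, w⟫_ℝ = ⟪hessian f x w, v⟫_ℝ :=
    second_derivative_symmetric h1 h2 v w
  change ⟪hessian f x v, w⟫_ℝ = ⟪v, hessian f x w⟫_ℝ
  rw [h5, real_inner_comm]

lemma continuous_hessian (hf : RegularCost f δ ρ) (hρ : 0 ≤ ρ) : Continuous (hessian f) := by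
  refine (LipschitzWith.of_dist_le_mul (K := ρ.toNNReal) fun x y => ?_).continuous
  simpa [dist_eq_norm, hρ] using hf.lipschitz_hessian x y

/-- The smallest eigenvalue of the Hessian is attained. -/
lemma lambdaMin_le_iff (hf : RegularCost f δ ρ) (hM : 0 < M) (x : E M) (b : ℝ) :
    lambdaMin (hessian f x) ≤ b ↔
      ∃ v : E M, ‖v‖ = 1 ∧ ∃ a ≤ b, hessian f x v = a • v := by
  have : Nonempty (Fin M) := ⟨⟨0, hM⟩⟩
  have hfin : {a : ℝ | Module.End.HasEigenvalue (hessian f x : E M →ₗ[ℝ] E M) a}.Finite :=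
    Module.End.finite_hasEigenvalue _
  have hne : {a : ℝ | Module.End.HasEigenvalue (hessian f x : E M →ₗ[ℝ] E M) a}.Nonempty :=
    ⟨_, (hf.isSymmetric_hessian x).hasEigenvalue_iInf_of_finiteDimensional⟩
  constructor
  · intro h
    have h1 := hne.csInf_mem hfin
    obtain ⟨v, hv⟩ := Module.End.HasEigenvalue.exists_hasEigenvector h1
    have hv0 : ‖v‖ ≠ 0 := norm_ne_zero_iff.2 hv.2
    refine ⟨‖v‖⁻¹ • v, ?_, _, h, ?_⟩
    · rw [norm_smul, norm_inv, norm_norm, inv_mul_cancel₀ hv0]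
    · have h2 : hessian f x v = lambdaMin (hessian f x) • v := hv.apply_eq_smul
      rw [map_smul, h2, smul_comm]
  · rintro ⟨v, hv, a, hab, hva⟩
    refine (csInf_le hfin.bddBelow ?_).trans hab
    refine Module.End.hasEigenvalue_of_hasEigenvector (x := v) ⟨?_, ?_⟩
    · exact Module.End.mem_eigenspace_iff.2 hva
    · intro h0; simp [h0] at hv

lemma isClosed_lambdaMin_le (hf : RegularCost f δ ρ) (hM : 0 < M) (hρ : 0 ≤ ρ) (b : ℝ) :
    IsClosed {x | lambdaMin (hessian f x) ≤ b} := by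
  let K : Set (E M × Metric.sphere (0 : E M) 1) :=
    {z | hessian f z.1 z.2 = ⟪hessian f z.1 z.2, (z.2 : E M)⟫_ℝ • (z.2 : E M)} ∩
      {z | ⟪hessian f z.1 z.2, (z.2 : E M)⟫_ℝ ≤ b}
  have hc : Continuous fun z : E M × Metric.sphere (0 : E M) 1 => hessian f z.1 z.2 :=
    ((hf.continuous_hessian hρ).comp continuous_fst).clm_apply
      (continuous_subtype_val.comp continuous_snd)
  have hv : Continuous fun z : E M × Metric.sphere (0 : E M) 1 => (z.2 : E M) :=
    continuous_subtype_val.comp continuous_snd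
  have hK : IsClosed K :=
    (isClosed_eq hc (Continuous.smul (f := fun z : E M × Metric.sphere (0 : E M) 1 =>
      ⟪hessian f z.1 z.2, (z.2 : E M)⟫_ℝ) (hc.inner hv) hv)).inter
      (isClosed_le (hc.inner hv) continuous_const)
  have h := isClosedMap_fst_of_compactSpace K hK
  convert h using 1
  ext x
  rw [Set.mem_ofPred_eq, hf.lambdaMin_le_iff hM]
  constructor
  · rintro ⟨v, hv, a, hab, hva⟩
    have hvv : ⟪hessian f x v, v⟫_ℝ = a := by
      rw [hva, real_inner_smul_left, real_inner_self_eq_norm_sq, hv]; ring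
    refine ⟨(x, ⟨v, by simpa using hv⟩), ⟨?_, ?_⟩, rfl⟩
    · change hessian f x v = ⟪hessian f x v, v⟫_ℝ • v
      rw [hvv]; exact hva
    · change ⟪hessian f x v, v⟫_ℝ ≤ b
      rw [hvv]; exact hab
  · rintro ⟨⟨y, v⟩, ⟨h1, h2⟩, rfl⟩
    exact ⟨v, by simp, _, h2, h1⟩

/-- At a global minimum every eigenvalue of the Hessian is nonnegative: otherwise the gradient
would point downhill along an eigenvector. -/
lemma lambdaMin_nonneg_of_isMin (hf : RegularCost f δ ρ) (hM : 0 < M) (hρ : 0 ≤ ρ) {x : E M}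
    (hx : ∀ y, f x ≤ f y) {b : ℝ} (hb : b < 0) : b < lambdaMin (hessian f x) := by
  by_contra! h
  obtain ⟨v, hv, a, hab, hva⟩ := (hf.lambdaMin_le_iff hM x b).1 h
  have ha : a < 0 := hab.trans_lt hb
  have hg : gradient f x = 0 := by
    have h1 : IsLocalMin f x := Filter.Eventually.of_forall hx
    simp [gradient, h1.fderiv_eq_zero]
  -- on a short segment from `x` along `v` the slope of `f` is at most `t a + ρ t² < 0`
  obtain ⟨t, ht0, ht⟩ : ∃ t : ℝ, 0 < t ∧ ρ * t < -a := by
    refine ⟨-a / (ρ + 1), div_pos (by linarith) (by linarith), ?_⟩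
    rw [← mul_div_assoc, div_lt_iff₀ (by linarith)]
    nlinarith
  have hcont : ContinuousOn (fun t : ℝ => f (x + t • v)) (Set.Icc 0 t) := fun s _ =>
    (hasDerivAt_line hf.differentiable x v s).continuousAt.continuousWithinAt
  obtain ⟨s, hs, hs'⟩ := exists_hasDerivAt_eq_slope (fun t : ℝ => f (x + t • v)) _ ht0 hcont
    fun s _ => hasDerivAt_line hf.differentiable x v s
  have h1 : 0 ≤ ⟪gradient f (x + s • v), v⟫_ℝ := by
    rw [hs']
    refine div_nonneg ?_ (by linarith)
    simpa using hx (x + t • v)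
  have h2 := hf.norm_gradient_sub_le hρ x (x + s • v)
  rw [hg, add_sub_cancel_left, sub_zero, map_smul, hva, norm_smul, hv,
    Real.norm_of_nonneg hs.1.le, mul_one] at h2
  have h3 : ⟪gradient f (x + s • v) - s • a • v, v⟫_ℝ ≤ ρ * s ^ 2 := by
    refine (real_inner_le_norm _ _).trans ?_
    rw [hv, mul_one]; exact h2
  rw [inner_sub_left, real_inner_smul_left, real_inner_smul_left, real_inner_self_eq_norm_sq, hv]
    at h3
  have h4 : ρ * s ≤ ρ * t := mul_le_mul_of_nonneg_left hs.2.le hρ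
  nlinarith [hs.1]

lemma abs_le_quadratic (hf : RegularCost f δ ρ) (hδ : 0 ≤ δ) (x : E M) :
    |f x| ≤ |f 0| + (‖gradient f 0‖ ^ 2 + (1 + 2 * δ) * ‖x‖ ^ 2) := by
  have h1 := hf.descent 0 x
  have h2 := hf.descent x (-x)
  rw [zero_add] at h1
  rw [add_neg_cancel, norm_neg, inner_neg_right] at h2
  have h3 := abs_le.1 (abs_real_inner_le_norm (gradient f 0) x)
  have h4 := abs_le.1 (abs_real_inner_le_norm (gradient f x) x)
  have h5 := mul_le_mul_of_nonneg_right (hf.norm_gradient_le 0 x) (norm_nonneg x)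
  rw [sub_zero] at h5
  have h6 := abs_le.1 (le_refl |f 0|)
  have h7 : 0 ≤ δ * ‖x‖ ^ 2 := by positivity
  have h8 : 0 ≤ (‖gradient f 0‖ - ‖x‖) ^ 2 := sq_nonneg _
  rw [abs_le]
  constructor <;> nlinarith [sq_nonneg ‖x‖, sq_nonneg ‖gradient f 0‖]

end RegularCost

lemma CostConditions.hessian_const_nonneg {J : Fin N → E M → ℝ} {G : ℝ}
    (hJ : CostConditions J δ G ρ) (hM : 0 < M) (k : Fin N) : 0 ≤ ρ := by
  have : Nonempty (Fin M) := ⟨⟨0, hM⟩⟩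
  obtain ⟨x, hx⟩ := exists_ne (0 : E M)
  have h := (norm_nonneg _).trans (hJ.lipschitz_hessian k x 0)
  rw [sub_zero] at h
  exact nonneg_of_mul_nonneg_left h (norm_pos_iff.2 hx)

end Cost

/-! ### Perturbed stochastic gradient recursions -/

section Integrals

variable {M : ℕ} {Ω : Type*} {mΩ : MeasurableSpace Ω} {P : Measure Ω}

lemma _root_.MeasureTheory.MemLp.integrable_norm_pow_four {F : Type*} [NormedAddCommGroup F]
    {u : Ω → F} (hu : MemLp u 4 P) : Integrable (fun ω => ‖u ω‖ ^ 4) P := by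
  have h : MemLp u ((4 : ℕ) : ENNReal) P := by exact_mod_cast hu
  exact h.integrable_norm_pow (by norm_num)

lemma _root_.MeasureTheory.MemLp.integrable_norm_sq_of_four [IsFiniteMeasure P] {F : Type*}
    [NormedAddCommGroup F] {u : Ω → F} (hu : MemLp u 4 P) :
    Integrable (fun ω => ‖u ω‖ ^ 2) P := by
  have h : MemLp u ((2 : ℕ) : ENNReal) P :=
    (hu.mono_exponent (by norm_num) : MemLp u 2 P)
  exact h.integrable_norm_pow (by norm_num)

lemma integrable_inner_of_memLp_four [IsFiniteMeasure P] {u v : Ω → E M} (hu : MemLp u 4 P)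
    (hv : MemLp v 4 P) : Integrable (fun ω => ⟪u ω, v ω⟫_ℝ) P := by
  refine (hu.integrable_norm_sq_of_four.add hv.integrable_norm_sq_of_four).mono'
    (hu.1.inner hv.1) (Filter.Eventually.of_forall fun ω => ?_)
  have h1 := abs_real_inner_le_norm (u ω) (v ω)
  simp only [Real.norm_eq_abs, Pi.add_apply]
  nlinarith [sq_nonneg (‖u ω‖ - ‖v ω‖), sq_nonneg ‖u ω‖, sq_nonneg ‖v ω‖]

lemma integrable_norm_sq_smul_inner {u v : Ω → E M} (hu : MemLp u 4 P) (hv : MemLp v 4 P) :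
    Integrable (fun ω => ⟪‖u ω‖ ^ 2 • u ω, v ω⟫_ℝ) P := by
  refine (hu.integrable_norm_pow_four.add hv.integrable_norm_pow_four).mono'
    (((hu.1.norm.pow 2).smul hu.1).inner hv.1) (Filter.Eventually.of_forall fun ω => ?_)
  have h1 := abs_real_inner_le_norm (u ω) (v ω)
  rw [real_inner_smul_left, norm_mul, norm_pow, norm_norm, Real.norm_eq_abs, Pi.add_apply]
  have h2 : ‖u ω‖ ^ 2 * |⟪u ω, v ω⟫_ℝ| ≤ ‖u ω‖ ^ 2 * (‖u ω‖ * ‖v ω‖) := by gcongr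
  nlinarith [sq_nonneg (‖u ω‖ - ‖v ω‖), sq_nonneg (‖u ω‖ ^ 2 - ‖u ω‖ * ‖v ω‖),
    sq_nonneg (‖u ω‖ ^ 2 - ‖v ω‖ ^ 2)]

lemma setIntegral_inner_eq_zero {m : MeasurableSpace Ω} (hm : m ≤ mΩ) [IsFiniteMeasure P]
    {u s : Ω → E M} (hu : StronglyMeasurable[m] u) (hs : Integrable s P) (hs0 : P[s | m] =ᵐ[P] 0)
    (hus : Integrable (fun ω => ⟪u ω, s ω⟫_ℝ) P) {B : Set Ω} (hB : MeasurableSet[m] B) :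
    ∫ ω in B, ⟪u ω, s ω⟫_ℝ ∂P = 0 := by
  rw [← setIntegral_condExp hm hus hB]
  have h1 := condExp_bilin_of_stronglyMeasurable_left (innerBilin M) hu hus hs
  have h2 : P[fun ω => ⟪u ω, s ω⟫_ℝ | m] =ᵐ[P] 0 := by
    filter_upwards [h1, hs0] with ω h3 h4
    have h5 : (P[fun ω => ⟪u ω, s ω⟫_ℝ | m]) ω = innerBilin M (u ω) ((P[s | m]) ω) := h3
    rw [h5, h4]; simp
  rw [integral_congr_ae (ae_restrict_of_ae h2)]
  simp

lemma setIntegral_const_real (B : Set Ω) (b : ℝ) : ∫ _ in B, b ∂P = b * P.real B := by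
  rw [setIntegral_const, smul_eq_mul, mul_comm]

/-- Jensen's inequality for the fourth power. -/
lemma weighted_add_pow_four_le {a b x y : ℝ} (ha : 0 ≤ a) (hb : 0 ≤ b) :
    (a * x + b * y) ^ 4 ≤ (a + b) ^ 3 * (a * x ^ 4 + b * y ^ 4) := by
  have key : ∀ x y : ℝ, (a * x + b * y) ^ 2 ≤ (a + b) * (a * x ^ 2 + b * y ^ 2) := by
    intro x y
    nlinarith [mul_nonneg (mul_nonneg ha hb) (sq_nonneg (x - y))]
  have h1 := key x y
  have h2 := key (x ^ 2) (y ^ 2)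
  calc (a * x + b * y) ^ 4 = ((a * x + b * y) ^ 2) ^ 2 := by ring
    _ ≤ ((a + b) * (a * x ^ 2 + b * y ^ 2)) ^ 2 := pow_le_pow_left₀ (sq_nonneg _) h1 2
    _ = (a + b) ^ 2 * (a * x ^ 2 + b * y ^ 2) ^ 2 := by ring
    _ ≤ (a + b) ^ 2 * ((a + b) * (a * (x ^ 2) ^ 2 + b * (y ^ 2) ^ 2)) := by gcongr
    _ = _ := by ring

end Integrals

/-- A stochastic gradient recursion `c_{i+1} = c_i - μ (∇f(c_i) + d_i + s_i)` adapted to a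
filtration, with zero-mean noise `s` and a bias `d`. The bias is dominated by a disagreement `ℓ`,
whose second and fourth moments contract at the rate `θ < 1` up to terms of order `μ²` and `μ⁴`.
Conditional moment bounds are expressed by integrals over the events of `ℱ i`. -/
structure NoisyDescent {M : ℕ} {Ω : Type*} [MeasurableSpace Ω] (P : Measure Ω) (f : E M → ℝ)
    (μ δ σ θ D : ℝ) where
  /-- the information available at time `i` -/
  ℱ : Filtration ℕ (inferInstance : MeasurableSpace Ω)
  /-- the centroid -/
  c : ℕ → Ω → E M
  /-- the bias of the gradient -/
  d : ℕ → Ω → E M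
  /-- the noise -/
  s : ℕ → Ω → E M
  /-- the disagreement -/
  dis : ℕ → Ω → ℝ
  meas_c : ∀ i, StronglyMeasurable[ℱ i] (c i)
  meas_d : ∀ i, StronglyMeasurable[ℱ i] (d i)
  meas_dis : ∀ i, StronglyMeasurable[ℱ i] (dis i)
  memLp_c : ∀ i, MemLp (c i) 4 P
  memLp_d : ∀ i, MemLp (d i) 4 P
  memLp_s : ∀ i, MemLp (s i) 4 P
  memLp_dis : ∀ i, MemLp (dis i) 4 P
  step : ∀ i ω, c (i + 1) ω = c i ω - μ • (gradient f (c i ω) + d i ω + s i ω)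
  norm_d_le : ∀ i ω, ‖d i ω‖ ≤ δ * dis i ω
  dis_nonneg : ∀ i ω, 0 ≤ dis i ω
  dis_sq_le : ∀ i B, MeasurableSet[ℱ i] B →
    ∫ ω in B, dis (i + 1) ω ^ 2 ∂P ≤ θ * ∫ ω in B, dis i ω ^ 2 ∂P + D * μ ^ 2 * P.real B
  dis_four_le : ∀ i B, MeasurableSet[ℱ i] B →
    ∫ ω in B, dis (i + 1) ω ^ 4 ∂P ≤ θ * ∫ ω in B, dis i ω ^ 4 ∂P + D * μ ^ 4 * P.real B
  noise_mean : ∀ i, P[s i | ℱ i] =ᵐ[P] 0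
  noise_four_le : ∀ i B, MeasurableSet[ℱ i] B →
    ∫ ω in B, ‖s i ω‖ ^ 4 ∂P ≤ σ ^ 4 * P.real B

namespace NoisyDescent

variable {M : ℕ} {Ω : Type*} [MeasurableSpace Ω] {P : Measure Ω}
  {f : E M → ℝ} {μ δ ρ σ θ D : ℝ} (X : NoisyDescent P f μ δ σ θ D)

lemma integrable_dis_four (i : ℕ) : Integrable (fun ω => X.dis i ω ^ 4) P := by
  have h := (X.memLp_dis i).integrable_norm_pow_four
  refine h.congr (Filter.Eventually.of_forall fun ω => ?_)
  simp only [Real.norm_of_nonneg (X.dis_nonneg i ω)]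

lemma stronglyMeasurable_gradient (hf : RegularCost f δ ρ) (i : ℕ) :
    StronglyMeasurable[X.ℱ i] fun ω => gradient f (X.c i ω) :=
  hf.continuous_gradient.comp_stronglyMeasurable (X.meas_c i)

lemma dis_four_block (hθ0 : 0 ≤ θ) {C₄ : ℝ} (hC : D ≤ (1 - θ) * C₄) {i : ℕ} {B : Set Ω}
    (hB : MeasurableSet[X.ℱ i] B) (h0 : ∫ ω in B, X.dis i ω ^ 4 ∂P ≤ C₄ * μ ^ 4 * P.real B)
    (j : ℕ) : ∫ ω in B, X.dis (i + j) ω ^ 4 ∂P ≤ C₄ * μ ^ 4 * P.real B := by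
  induction j with
  | zero => exact h0
  | succ j ih =>
    refine (X.dis_four_le (i + j) B (X.ℱ.mono (Nat.le_add_right i j) B hB)).trans ?_
    have h1 := mul_le_mul_of_nonneg_left ih hθ0
    have h2 := mul_le_mul_of_nonneg_right hC
      (mul_nonneg (by positivity) measureReal_nonneg : 0 ≤ μ ^ 4 * P.real B)
    linarith

variable [IsProbabilityMeasure P]

lemma integrable_cost (hf : RegularCost f δ ρ) (hδ : 0 ≤ δ) (i : ℕ) :
    Integrable (fun ω => f (X.c i ω)) P := by
  have h1 : Integrable (fun ω => |f 0| + (‖gradient f 0‖ ^ 2 + (1 + 2 * δ) * ‖X.c i ω‖ ^ 2)) P :=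
    (integrable_const _).add ((integrable_const _).add
      ((X.memLp_c i).integrable_norm_sq_of_four.const_mul _))
  refine h1.mono' (hf.differentiable.continuous.comp_aestronglyMeasurable (X.memLp_c i).1)
    (Filter.Eventually.of_forall fun ω => ?_)
  exact hf.abs_le_quadratic hδ _

lemma memLp_gradient (hf : RegularCost f δ ρ) (i : ℕ) :
    MemLp (fun ω => gradient f (X.c i ω)) 4 P := by
  have h0 : MemLp (fun ω => δ * ‖X.c i ω‖) 4 P := (X.memLp_c i).norm.const_mul δ
  have h1 : MemLp ((fun _ => ‖gradient f 0‖) + fun ω => δ * ‖X.c i ω‖) 4 P :=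
    (memLp_const ‖gradient f 0‖).add h0
  refine h1.mono' (hf.continuous_gradient.comp_aestronglyMeasurable (X.memLp_c i).1)
    (Filter.Eventually.of_forall fun ω => ?_)
  simpa using hf.norm_gradient_le 0 (X.c i ω)

lemma integrable_dis_sq (i : ℕ) : Integrable (fun ω => X.dis i ω ^ 2) P := by
  simpa using (X.memLp_dis i).integrable_norm_sq_of_four

lemma noise_sq_le (hσ : 0 < σ) (i : ℕ) {B : Set Ω} (hB : MeasurableSet[X.ℱ i] B) :
    ∫ ω in B, ‖X.s i ω‖ ^ 2 ∂P ≤ σ ^ 2 * P.real B := by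
  have hs4 := (X.memLp_s i).integrable_norm_pow_four.integrableOn (s := B)
  have hs2 := (X.memLp_s i).integrable_norm_sq_of_four.integrableOn (s := B)
  have h1 : ∫ ω in B, ‖X.s i ω‖ ^ 2 ∂P
      ≤ ∫ ω in B, ((2 * σ ^ 2)⁻¹ * ‖X.s i ω‖ ^ 4 + σ ^ 2 / 2) ∂P := by
    refine integral_mono hs2 ((hs4.const_mul _).add (integrable_const _)) fun ω => ?_
    have h2 : (2 * σ ^ 2)⁻¹ * ‖X.s i ω‖ ^ 4 + σ ^ 2 / 2 - ‖X.s i ω‖ ^ 2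
        = (2 * σ ^ 2)⁻¹ * (‖X.s i ω‖ ^ 2 - σ ^ 2) ^ 2 := by
      field_simp; ring
    have h3 : 0 ≤ (2 * σ ^ 2)⁻¹ * (‖X.s i ω‖ ^ 2 - σ ^ 2) ^ 2 := by positivity
    show ‖X.s i ω‖ ^ 2 ≤ (2 * σ ^ 2)⁻¹ * ‖X.s i ω‖ ^ 4 + σ ^ 2 / 2
    linarith
  rw [integral_add (hs4.const_mul _) (integrable_const _), integral_const_mul,
    setIntegral_const_real] at h1
  have h4 := mul_le_mul_of_nonneg_left (X.noise_four_le i B hB)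
    (by positivity : 0 ≤ (2 * σ ^ 2)⁻¹)
  have h5 : (2 * σ ^ 2)⁻¹ * (σ ^ 4 * P.real B) = σ ^ 2 / 2 * P.real B := by field_simp
  linarith

lemma setIntegral_inner_noise (i : ℕ) {u : Ω → E M} (hu : StronglyMeasurable[X.ℱ i] u)
    (hus : Integrable (fun ω => ⟪u ω, X.s i ω⟫_ℝ) P) {B : Set Ω}
    (hB : MeasurableSet[X.ℱ i] B) : ∫ ω in B, ⟪u ω, X.s i ω⟫_ℝ ∂P = 0 :=
  setIntegral_inner_eq_zero (X.ℱ.le i) hu ((X.memLp_s i).integrable (by norm_num))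
    (X.noise_mean i) hus hB

/-- The cost at the centroid plus a multiple of the squared disagreement: a Lyapunov function. -/
def potential (a : ℝ) (i : ℕ) (ω : Ω) : ℝ := f (X.c i ω) + a * X.dis i ω ^ 2

lemma integrable_potential (hf : RegularCost f δ ρ) (hδ : 0 ≤ δ) (a : ℝ) (i : ℕ) :
    Integrable (X.potential a i) P :=
  (X.integrable_cost hf hδ i).add ((X.integrable_dis_sq i).const_mul a)

/-- One step decreases the potential by the squared gradient and the squared disagreement, up to
the contribution of order `μ²` of the noise. -/
lemma potential_step (hf : RegularCost f δ ρ) (hδ : 0 < δ) (hσ : 0 < σ) (hμ : 0 < μ)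
    (hμδ : μ * δ ≤ 1 / 8) {a : ℝ} (ha : 0 ≤ a) (haμ : 2 * μ * δ ^ 2 ≤ a * (1 - θ) / 2)
    (haD : a * D ≤ c2 δ σ / 4) (i : ℕ) {B : Set Ω} (hB : MeasurableSet[X.ℱ i] B) :
    ∫ ω in B, X.potential a (i + 1) ω ∂P
      ≤ ∫ ω in B, X.potential a i ω ∂P - 5 / 8 * μ * ∫ ω in B, ‖gradient f (X.c i ω)‖ ^ 2 ∂P
        - a * (1 - θ) / 2 * ∫ ω in B, X.dis i ω ^ 2 ∂P + 5 / 4 * c2 δ σ * μ ^ 2 * P.real B := by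
  set u : Ω → E M := fun ω =>
    (-μ) • gradient f (X.c i ω) + (δ * μ ^ 2) • (gradient f (X.c i ω) + X.d i ω) with hu
  have hum : StronglyMeasurable[X.ℱ i] u :=
    ((X.stronglyMeasurable_gradient hf i).const_smul (-μ)).add
      (((X.stronglyMeasurable_gradient hf i).add (X.meas_d i)).const_smul (δ * μ ^ 2))
  have hu4 : MemLp u 4 P :=
    ((X.memLp_gradient hf i).const_smul (-μ)).add
      (((X.memLp_gradient hf i).add (X.memLp_d i)).const_smul (δ * μ ^ 2))
  have hus := integrable_inner_of_memLp_four hu4 (X.memLp_s i)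
  have hpt : ∀ ω, f (X.c (i + 1) ω) ≤ f (X.c i ω) - 5 / 8 * μ * ‖gradient f (X.c i ω)‖ ^ 2
      + 2 * μ * δ ^ 2 * X.dis i ω ^ 2 + δ / 2 * μ ^ 2 * ‖X.s i ω‖ ^ 2 + ⟪u ω, X.s i ω⟫_ℝ := by
    intro ω
    set gr := gradient f (X.c i ω) with hgr
    set d := X.d i ω
    set s := X.s i ω
    have h1 := hf.descent (X.c i ω) (-(μ • (gr + d + s)))
    rw [← sub_eq_add_neg, ← X.step i ω, norm_neg, norm_smul, mul_pow, Real.norm_of_nonneg hμ.le,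
      inner_neg_right, real_inner_smul_right, norm_add_sq_real (gr + d) s, norm_add_sq_real gr d,
      inner_add_right, inner_add_right, real_inner_self_eq_norm_sq, ← hgr] at h1
    have h2 : ⟪u ω, s⟫_ℝ = -μ * ⟪gr, s⟫_ℝ + δ * μ ^ 2 * ⟪gr + d, s⟫_ℝ := by
      simp only [hu, inner_add_left, real_inner_smul_left]; rfl
    have h3 := abs_le.1 (abs_real_inner_le_norm gr d)
    have hd : ‖d‖ ^ 2 ≤ δ ^ 2 * X.dis i ω ^ 2 := by
      rw [← mul_pow]; exact pow_le_pow_left₀ (norm_nonneg _) (X.norm_d_le i ω) 2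
    rw [h2]
    have h4 : ‖gr‖ * ‖d‖ ≤ ‖gr‖ ^ 2 / 4 + ‖d‖ ^ 2 := by nlinarith [sq_nonneg (‖gr‖ / 2 - ‖d‖)]
    have h5 : ‖gr‖ * ‖d‖ ≤ ‖gr‖ ^ 2 / 2 + ‖d‖ ^ 2 / 2 := by nlinarith [sq_nonneg (‖gr‖ - ‖d‖)]
    have h6 : -μ * ⟪gr, d⟫_ℝ ≤ μ * (‖gr‖ ^ 2 / 4 + ‖d‖ ^ 2) := by nlinarith
    have h7 : δ / 2 * μ ^ 2 * (2 * ⟪gr, d⟫_ℝ) ≤ δ / 2 * μ ^ 2 * (‖gr‖ ^ 2 + ‖d‖ ^ 2) := by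
      gcongr; linarith
    have h8 : μ * δ * (μ * (‖gr‖ ^ 2 + ‖d‖ ^ 2)) ≤ 1 / 8 * (μ * (‖gr‖ ^ 2 + ‖d‖ ^ 2)) := by
      gcongr
    have h9 : 2 * μ * ‖d‖ ^ 2 ≤ 2 * μ * (δ ^ 2 * X.dis i ω ^ 2) := by gcongr
    have h10 : 0 ≤ μ * ‖d‖ ^ 2 := by positivity
    nlinarith
  have i1 := (X.integrable_cost hf hδ.le i).integrableOn (s := B)
  have i1' := (X.integrable_cost hf hδ.le (i + 1)).integrableOn (s := B)
  have i2 := (X.memLp_gradient hf i).integrable_norm_sq_of_four.integrableOn (s := B)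
  have i3 := (X.integrable_dis_sq i).integrableOn (s := B)
  have i3' := (X.integrable_dis_sq (i + 1)).integrableOn (s := B)
  have i4 := (X.memLp_s i).integrable_norm_sq_of_four.integrableOn (s := B)
  have i5 := hus.integrableOn (s := B)
  have h1 : ∫ ω in B, f (X.c (i + 1) ω) ∂P ≤ ∫ ω in B, f (X.c i ω) ∂P
      - 5 / 8 * μ * ∫ ω in B, ‖gradient f (X.c i ω)‖ ^ 2 ∂P
      + 2 * μ * δ ^ 2 * ∫ ω in B, X.dis i ω ^ 2 ∂P
      + δ / 2 * μ ^ 2 * ∫ ω in B, ‖X.s i ω‖ ^ 2 ∂P := by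
    refine (integral_mono i1' ((((i1.sub (i2.const_mul (5 / 8 * μ))).add
      (i3.const_mul (2 * μ * δ ^ 2))).add (i4.const_mul (δ / 2 * μ ^ 2))).add i5) hpt).trans ?_
    rw [integral_add' (((i1.sub (i2.const_mul _)).add (i3.const_mul _)).add (i4.const_mul _)) i5,
      integral_add' ((i1.sub (i2.const_mul _)).add (i3.const_mul _)) (i4.const_mul _),
      integral_add' (i1.sub (i2.const_mul _)) (i3.const_mul _),
      integral_sub' i1 (i2.const_mul _), integral_const_mul, integral_const_mul,
      integral_const_mul, X.setIntegral_inner_noise i hum hus hB, add_zero]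
  have h2 := X.noise_sq_le hσ i hB
  have h3 := X.dis_sq_le i B hB
  have h4 : ∀ j, ∫ ω in B, X.potential a j ω ∂P
      = ∫ ω in B, f (X.c j ω) ∂P + a * ∫ ω in B, X.dis j ω ^ 2 ∂P := by
    intro j
    rw [← integral_const_mul]
    exact integral_add (X.integrable_cost hf hδ.le j).integrableOn
      ((X.integrable_dis_sq j).integrableOn.const_mul a)
  rw [h4, h4]
  have h5 : 0 ≤ ∫ ω in B, X.dis i ω ^ 2 ∂P := integral_nonneg fun ω => sq_nonneg _
  have h6 := mul_le_mul_of_nonneg_left h3 ha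
  have h7 := mul_le_mul_of_nonneg_right haμ h5
  have h8 := mul_le_mul_of_nonneg_left h2 (by positivity : 0 ≤ δ / 2 * μ ^ 2)
  have h9 := mul_le_mul_of_nonneg_right haD
    (mul_nonneg (sq_nonneg μ) measureReal_nonneg : 0 ≤ μ ^ 2 * P.real B)
  have h10 : δ / 2 * μ ^ 2 * (σ ^ 2 * P.real B) = c2 δ σ * (μ ^ 2 * P.real B) := by
    rw [c2]; ring
  nlinarith

end NoisyDescent

/-! ### Escape from strict saddle points -/

/-- Expansion of the fourth power of a norm; the linear term in `s` is kept, since it has zero mean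
in the application. -/
lemma norm_sub_smul_pow_four_le {M : ℕ} {μ : ℝ} (hμ : 0 < μ) (hμ1 : μ ≤ 1) (b s : E M) :
    ‖b - μ • s‖ ^ 4 ≤ (1 + μ) * ‖b‖ ^ 4 + 19 * μ ^ 3 * ‖s‖ ^ 4
      + (-4 * μ) * ⟪‖b‖ ^ 2 • b, s⟫_ℝ := by
  have h1 : ‖b - μ • s‖ ^ 2 = ‖b‖ ^ 2 - 2 * μ * ⟪b, s⟫_ℝ + μ ^ 2 * ‖s‖ ^ 2 := by
    rw [norm_sub_sq_real, real_inner_smul_right, norm_smul, mul_pow,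
      Real.norm_of_nonneg hμ.le]; ring
  have h2 : ‖b - μ • s‖ ^ 4 = (‖b - μ • s‖ ^ 2) ^ 2 := by ring
  rw [h2, h1, real_inner_smul_left]
  have h3 : ⟪b, s⟫_ℝ ^ 2 ≤ ‖b‖ ^ 2 * ‖s‖ ^ 2 := by
    rw [← mul_pow, ← sq_abs]
    exact pow_le_pow_left₀ (abs_nonneg _) (abs_real_inner_le_norm _ _) 2
  set q := ⟪b, s⟫_ℝ
  set S := ‖s‖ ^ 2 with hS
  set T := ‖b‖ ^ 2 with hT
  have hS4 : ‖s‖ ^ 4 = S ^ 2 := by rw [hS]; ring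
  have hT4 : ‖b‖ ^ 4 = T ^ 2 := by rw [hT]; ring
  rw [hS4, hT4]
  have h4 : 0 ≤ μ ^ 2 * (T * S - q ^ 2) := by
    have := sub_nonneg.2 h3; positivity
  have h5 : 0 ≤ μ ^ 2 * (q + μ * S) ^ 2 := by positivity
  have h6 : 0 ≤ μ * (T - 4 * μ * S) ^ 2 := by positivity
  have h7 : μ ^ 4 * S ^ 2 ≤ μ ^ 3 * S ^ 2 := by
    have : μ ^ 4 ≤ μ ^ 3 := pow_le_pow_of_le_one hμ.le hμ1 (by norm_num)
    gcongr
  nlinarith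

namespace NoisyDescent

variable {M : ℕ} {Ω : Type*} [MeasurableSpace Ω] {P : Measure Ω} [IsProbabilityMeasure P]
  {f : E M → ℝ} {μ δ ρ σ θ D : ℝ} (X : NoisyDescent P f μ δ σ θ D)

lemma memLp_sub_const (i : ℕ) (x : E M) : MemLp (fun ω => X.c i ω - x) 4 P :=
  (X.memLp_c i).sub (memLp_const x)

lemma integrable_disp_four (i : ℕ) (x : E M) : Integrable (fun ω => ‖X.c i ω - x‖ ^ 4) P :=
  (X.memLp_sub_const i x).integrable_norm_pow_four

/-- One step of the fourth moment of the distance from a fixed point `x`. -/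
lemma displacement_step (hf : RegularCost f δ ρ) (hδ : 0 < δ) (hμ : 0 < μ)
    (hμδ : μ * (δ + 1) ≤ 1) (x : E M) (i : ℕ) {B : Set Ω} (hB : MeasurableSet[X.ℱ i] B) :
    ∫ ω in B, ‖X.c (i + 1) ω - x‖ ^ 4 ∂P
      ≤ Real.exp (μ * (4 * δ + 4)) * ∫ ω in B, ‖X.c i ω - x‖ ^ 4 ∂P
        + 128 * μ * (‖gradient f x‖ ^ 4 * P.real B + δ ^ 4 * ∫ ω in B, X.dis i ω ^ 4 ∂P)
        + 19 * μ ^ 3 * σ ^ 4 * P.real B := by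
  set b : Ω → E M := fun ω => (X.c i ω - x) - μ • (gradient f (X.c i ω) + X.d i ω) with hb
  have hbm : StronglyMeasurable[X.ℱ i] b :=
    ((X.meas_c i).sub stronglyMeasurable_const).sub
      (((X.stronglyMeasurable_gradient hf i).add (X.meas_d i)).const_smul μ)
  have hb4 : MemLp b 4 P :=
    (X.memLp_sub_const i x).sub (((X.memLp_gradient hf i).add (X.memLp_d i)).const_smul μ)
  have hus := integrable_norm_sq_smul_inner hb4 (X.memLp_s i)
  have hμ1 : μ ≤ 1 := by nlinarith
  have hstep : ∀ ω, X.c (i + 1) ω - x = b ω - μ • X.s i ω := by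
    intro ω
    rw [X.step]; simp only [hb, smul_add]; abel
  have hpt : ∀ ω, ‖X.c (i + 1) ω - x‖ ^ 4
      ≤ Real.exp (μ * (4 * δ + 4)) * ‖X.c i ω - x‖ ^ 4
        + 128 * μ * (‖gradient f x‖ ^ 4 + δ ^ 4 * X.dis i ω ^ 4)
        + 19 * μ ^ 3 * ‖X.s i ω‖ ^ 4 + (-4 * μ) * ⟪‖b ω‖ ^ 2 • b ω, X.s i ω⟫_ℝ := by
    intro ω
    set s := X.s i ω
    set z := ‖X.c i ω - x‖ with hz
    set y := ‖gradient f x‖ + δ * X.dis i ω with hy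
    have hz0 : 0 ≤ z := norm_nonneg _
    have hy0 : 0 ≤ y := add_nonneg (norm_nonneg _) (mul_nonneg hδ.le (X.dis_nonneg i ω))
    have hbz : ‖b ω‖ ≤ (1 + μ * δ) * z + μ * y := by
      have h1 : ‖b ω‖ ≤ z + μ * (‖gradient f (X.c i ω)‖ + ‖X.d i ω‖) := by
        refine (norm_sub_le _ _).trans ?_
        rw [norm_smul, Real.norm_of_nonneg hμ.le]
        gcongr
        exact norm_add_le _ _
      have h2 := hf.norm_gradient_le x (X.c i ω)
      have h3 := X.norm_d_le i ω
      have h4 : ‖gradient f (X.c i ω)‖ + ‖X.d i ω‖ ≤ δ * z + y := by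
        rw [hy, hz]; linarith
      have h5 := mul_le_mul_of_nonneg_left h4 hμ.le
      linarith
    have hb4' : ‖b ω‖ ^ 4 ≤ (1 + μ * (δ + 1)) ^ 3 * ((1 + μ * δ) * z ^ 4 + μ * y ^ 4) := by
      refine (pow_le_pow_left₀ (norm_nonneg _) hbz 4).trans ?_
      refine (weighted_add_pow_four_le (by positivity) hμ.le).trans (le_of_eq ?_)
      ring
    have hy4 : y ^ 4 ≤ 8 * (‖gradient f x‖ ^ 4 + δ ^ 4 * X.dis i ω ^ 4) := by
      have h := weighted_add_pow_four_le (a := 1) (b := 1) (x := ‖gradient f x‖)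
        (y := δ * X.dis i ω) (by norm_num) (by norm_num)
      rw [one_mul, one_mul, one_mul, one_mul, mul_pow] at h
      linarith
    have hexp : (1 + μ) * (1 + μ * (δ + 1)) ^ 3 * (1 + μ * δ) ≤ Real.exp (μ * (4 * δ + 4)) := by
      have e1 : 1 + μ ≤ Real.exp μ := by linarith [Real.add_one_le_exp μ]
      have e2 : 1 + μ * (δ + 1) ≤ Real.exp (μ * (δ + 1)) := by
        linarith [Real.add_one_le_exp (μ * (δ + 1))]
      have e3 : 1 + μ * δ ≤ Real.exp (μ * δ) := by linarith [Real.add_one_le_exp (μ * δ)]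
      calc (1 + μ) * (1 + μ * (δ + 1)) ^ 3 * (1 + μ * δ)
          ≤ Real.exp μ * Real.exp (μ * (δ + 1)) ^ 3 * Real.exp (μ * δ) := by gcongr
        _ = Real.exp (μ * (4 * δ + 4)) := by
          rw [← Real.exp_nat_mul, ← Real.exp_add, ← Real.exp_add]
          congr 1; push_cast; ring
    have h16 : (1 + μ) * (1 + μ * (δ + 1)) ^ 3 ≤ 16 := by
      calc (1 + μ) * (1 + μ * (δ + 1)) ^ 3 ≤ (1 + 1) * (1 + 1) ^ 3 := by gcongr
        _ = 16 := by norm_num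
    have hmain := norm_sub_smul_pow_four_le hμ hμ1 (b ω) s
    rw [hstep]
    refine hmain.trans ?_
    have h9 := mul_le_mul_of_nonneg_right hexp (by positivity : 0 ≤ z ^ 4)
    have h10 := mul_le_mul_of_nonneg_right h16 (by positivity : 0 ≤ μ * y ^ 4)
    have h11 := mul_le_mul_of_nonneg_left hy4 (by positivity : 0 ≤ 16 * μ)
    have h8 : (1 + μ) * ‖b ω‖ ^ 4 ≤ Real.exp (μ * (4 * δ + 4)) * z ^ 4
        + 16 * (μ * y ^ 4) := by
      calc (1 + μ) * ‖b ω‖ ^ 4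
          ≤ (1 + μ) * ((1 + μ * (δ + 1)) ^ 3 * ((1 + μ * δ) * z ^ 4 + μ * y ^ 4)) := by gcongr
        _ = (1 + μ) * (1 + μ * (δ + 1)) ^ 3 * (1 + μ * δ) * z ^ 4
            + (1 + μ) * (1 + μ * (δ + 1)) ^ 3 * (μ * y ^ 4) := by ring
        _ ≤ _ := add_le_add h9 h10
    linarith
  have i1 := (X.integrable_disp_four (i + 1) x).integrableOn (s := B)
  have i2 := ((X.integrable_disp_four i x).integrableOn (s := B)).const_mul
    (Real.exp (μ * (4 * δ + 4)))
  have i3' := ((X.integrable_dis_four i).integrableOn (s := B)).const_mul (δ ^ 4)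
  have i3'' : Integrable (fun _ => ‖gradient f x‖ ^ 4) (P.restrict B) := integrable_const _
  have i3 := (i3''.add i3').const_mul (128 * μ)
  have i4 := ((X.memLp_s i).integrable_norm_pow_four.integrableOn (s := B)).const_mul
    (19 * μ ^ 3)
  have i5 := (hus.integrableOn (s := B)).const_mul (-4 * μ)
  refine (integral_mono i1 (((i2.add i3).add i4).add i5) hpt).trans ?_
  rw [integral_add' ((i2.add i3).add i4) i5, integral_add' (i2.add i3) i4, integral_add' i2 i3,
    integral_const_mul, integral_const_mul, integral_const_mul, integral_const_mul,
    integral_add' i3'' i3', integral_const_mul, setIntegral_const_real,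
    X.setIntegral_inner_noise i (u := fun ω => ‖b ω‖ ^ 2 • b ω) ((hbm.norm.pow 2).smul hbm) hus hB]
  have h1 := mul_le_mul_of_nonneg_left (X.noise_four_le i B hB)
    (by positivity : 0 ≤ 19 * μ ^ 3)
  linarith

/-- The component of the linearized gradient along an eigenvector `v` of the Hessian at `x`, with
eigenvalue `a`. -/
def slope (f : E M → ℝ) (x v : E M) (a : ℝ) (y : E M) : ℝ :=
  ⟪v, gradient f x⟫_ℝ + a * ⟪v, y - x⟫_ℝ

lemma inner_gradient_eq (hf : RegularCost f δ ρ) {x v : E M} {a : ℝ}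
    (hv : hessian f x v = a • v) (y : E M) :
    ⟪v, gradient f y⟫_ℝ
      = slope f x v a y + ⟪v, gradient f y - gradient f x - hessian f x (y - x)⟫_ℝ := by
  have h1 : ⟪v, hessian f x (y - x)⟫_ℝ = a * ⟪v, y - x⟫_ℝ := by
    rw [← real_inner_smul_left, ← hv]
    exact ((hf.isSymmetric_hessian x) v (y - x)).symm
  rw [inner_sub_right, inner_sub_right, h1, slope]
  ring

lemma memLp_slope (i : ℕ) (x v : E M) (a : ℝ) :
    MemLp (fun ω => slope f x v a (X.c i ω)) 4 P := by
  have h1 : MemLp (fun ω => ⟪v, X.c i ω - x⟫_ℝ) 4 P :=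
    (X.memLp_sub_const i x).const_inner v
  have h2 : MemLp (fun ω => a * ⟪v, X.c i ω - x⟫_ℝ) 4 P := h1.const_mul a
  have h3 : MemLp ((fun _ => ⟪v, gradient f x⟫_ℝ) + fun ω => a * ⟪v, X.c i ω - x⟫_ℝ) 4 P :=
    (memLp_const ⟪v, gradient f x⟫_ℝ).add h2
  exact h3

/-- Along an eigenvector with negative eigenvalue the noise makes the mean square of the slope
grow, whatever the sign of the deterministic part. -/
lemma slope_step (hf : RegularCost f δ ρ) (hρ : 0 ≤ ρ) (hμ : 0 < μ) {x v : E M} {lam : ℝ}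
    (hlam : 0 ≤ lam) (hv1 : ‖v‖ = 1) (hv : hessian f x v = (-lam) • v)
    (i : ℕ) {B : Set Ω} (hB : MeasurableSet[X.ℱ i] B) :
    ∫ ω in B, slope f x v (-lam) (X.c i ω) ^ 2 ∂P
        - 8 * μ * lam * (δ ^ 2 * ∫ ω in B, X.dis i ω ^ 2 ∂P
          + ρ ^ 2 * ∫ ω in B, ‖X.c i ω - x‖ ^ 4 ∂P)
        + μ ^ 2 * lam ^ 2 * ∫ ω in B, ⟪X.s i ω, v⟫_ℝ ^ 2 ∂P
      ≤ ∫ ω in B, slope f x v (-lam) (X.c (i + 1) ω) ^ 2 ∂P := by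
  set r : Ω → E M := fun ω =>
    gradient f (X.c i ω) - gradient f x - hessian f x (X.c i ω - x) with hr
  set e : Ω → ℝ := fun ω => slope f x v (-lam) (X.c i ω)
    + μ * lam * (slope f x v (-lam) (X.c i ω) + ⟪v, r ω + X.d i ω⟫_ℝ) with he
  have hsm : StronglyMeasurable[X.ℱ i] fun ω => slope f x v (-lam) (X.c i ω) := by
    have : Continuous (slope f x v (-lam)) := by unfold slope; fun_prop
    exact this.comp_stronglyMeasurable (X.meas_c i)
  have hrm : StronglyMeasurable[X.ℱ i] r :=
    ((X.stronglyMeasurable_gradient hf i).sub stronglyMeasurable_const).sub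
      ((hessian f x).continuous.comp_stronglyMeasurable
        ((X.meas_c i).sub stronglyMeasurable_const))
  have hr4 : MemLp r 4 P :=
    ((X.memLp_gradient hf i).sub (memLp_const (gradient f x))).sub
      ((hessian f x).comp_memLp' (X.memLp_sub_const i x))
  have hem : StronglyMeasurable[X.ℱ i] e :=
    hsm.add ((hsm.add (stronglyMeasurable_const.inner (hrm.add (X.meas_d i)))).const_mul _)
  have hs4 := X.memLp_slope i x v (-lam)
  have hε4 : MemLp (fun ω => ⟪v, r ω + X.d i ω⟫_ℝ) 4 P := (hr4.add (X.memLp_d i)).const_inner v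
  have he4 : MemLp e 4 P := hs4.add ((hs4.add hε4).const_mul (μ * lam))
  have hev4 : MemLp (fun ω => e ω • v) 4 P := by
    refine (he4.norm.mul_const ‖v‖).mono' (he4.1.smul_const v)
      (Filter.Eventually.of_forall fun ω => ?_)
    rw [norm_smul]
  have hus := integrable_inner_of_memLp_four hev4 (X.memLp_s i)
  have hrec : ∀ ω, slope f x v (-lam) (X.c (i + 1) ω)
      = e ω + μ * lam * ⟪X.s i ω, v⟫_ℝ := by
    intro ω
    have h1 := inner_gradient_eq hf hv (X.c i ω)
    have h2 : X.c (i + 1) ω - x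
        = (X.c i ω - x) - μ • (gradient f (X.c i ω) + X.d i ω + X.s i ω) := by
      rw [X.step]; abel
    have h3 : slope f x v (-lam) (X.c (i + 1) ω) = slope f x v (-lam) (X.c i ω)
        + μ * lam * (⟪v, gradient f (X.c i ω)⟫_ℝ + ⟪v, X.d i ω⟫_ℝ + ⟪v, X.s i ω⟫_ℝ) := by
      simp only [slope]
      rw [h2, inner_sub_right, real_inner_smul_right, inner_add_right, inner_add_right]
      ring
    rw [h3, h1, he, real_inner_comm v (X.s i ω)]
    simp only [hr, inner_add_right]
    ring
  have hpt : ∀ ω, slope f x v (-lam) (X.c i ω) ^ 2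
      - 8 * μ * lam * (δ ^ 2 * X.dis i ω ^ 2 + ρ ^ 2 * ‖X.c i ω - x‖ ^ 4)
      + μ ^ 2 * lam ^ 2 * ⟪X.s i ω, v⟫_ℝ ^ 2 + 2 * μ * lam * ⟪e ω • v, X.s i ω⟫_ℝ
      ≤ slope f x v (-lam) (X.c (i + 1) ω) ^ 2 := by
    intro ω
    rw [hrec, real_inner_smul_left, real_inner_comm (X.s i ω) v]
    set y := slope f x v (-lam) (X.c i ω) with hy
    set ε := ⟪v, r ω + X.d i ω⟫_ℝ with hε
    have h1 : ε ^ 2 ≤ 2 * (δ ^ 2 * X.dis i ω ^ 2 + ρ ^ 2 * ‖X.c i ω - x‖ ^ 4) := by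
      have h2 : |ε| ≤ ρ * ‖X.c i ω - x‖ ^ 2 + δ * X.dis i ω := by
        refine (abs_real_inner_le_norm _ _).trans ?_
        rw [hv1, one_mul]
        exact (norm_add_le _ _).trans
          (add_le_add (hf.norm_gradient_sub_le hρ x (X.c i ω)) (X.norm_d_le i ω))
      rw [← sq_abs]
      refine (pow_le_pow_left₀ (abs_nonneg _) h2 2).trans ?_
      nlinarith [sq_nonneg (ρ * ‖X.c i ω - x‖ ^ 2 - δ * X.dis i ω)]
    have hee : e ω = y + μ * lam * (y + ε) := rfl
    have h3 : y ^ 2 - 4 * (μ * lam) * ε ^ 2 ≤ e ω ^ 2 := by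
      rw [hee]
      have h0 : 0 ≤ μ * lam := by positivity
      set m := μ * lam
      have : (y + m * (y + ε)) ^ 2 - y ^ 2 + 4 * m * ε ^ 2
          = m * ((y + ε) ^ 2 + y ^ 2 + 3 * ε ^ 2) + m ^ 2 * (y + ε) ^ 2 := by ring
      have h4 : 0 ≤ m * ((y + ε) ^ 2 + y ^ 2 + 3 * ε ^ 2) + m ^ 2 * (y + ε) ^ 2 := by positivity
      linarith
    have h5 := mul_le_mul_of_nonneg_left h1 (by positivity : 0 ≤ 4 * (μ * lam))
    nlinarith
  have i1 := hs4.integrable_norm_sq_of_four.integrableOn (s := B)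
  have i1' := (X.memLp_slope (i + 1) x v (-lam)).integrable_norm_sq_of_four.integrableOn (s := B)
  simp only [Real.norm_eq_abs, sq_abs] at i1 i1'
  have i2 := ((X.integrable_dis_sq i).integrableOn (s := B)).const_mul (δ ^ 2)
  have i3 := ((X.integrable_disp_four i x).integrableOn (s := B)).const_mul (ρ ^ 2)
  have i23 := (i2.add i3).const_mul (8 * μ * lam)
  have i4' : IntegrableOn (fun ω => ⟪X.s i ω, v⟫_ℝ ^ 2) B P := by
    have h : MemLp (fun ω => ⟪X.s i ω, v⟫_ℝ) 4 P := (X.memLp_s i).inner_const v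
    have := h.integrable_norm_sq_of_four.integrableOn (s := B)
    simpa only [Real.norm_eq_abs, sq_abs] using this
  have i4 := i4'.const_mul (μ ^ 2 * lam ^ 2)
  have i5 := (hus.integrableOn (s := B)).const_mul (2 * μ * lam)
  have h1 := integral_mono (((i1.sub i23).add i4).add i5) i1' hpt
  rw [integral_add' ((i1.sub i23).add i4) i5, integral_add' (i1.sub i23) i4,
    integral_sub' i1 i23, integral_const_mul, integral_const_mul, integral_const_mul,
    integral_add' i2 i3, integral_const_mul, integral_const_mul,
    X.setIntegral_inner_noise i (hem.smul_const v) hus hB] at h1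
  linarith

lemma dis_sq_le_of_four (hμ : 0 < μ) {C₄ : ℝ} {i : ℕ} {B : Set Ω}
    (h : ∫ ω in B, X.dis i ω ^ 4 ∂P ≤ C₄ * μ ^ 4 * P.real B) :
    ∫ ω in B, X.dis i ω ^ 2 ∂P ≤ (C₄ + 1) / 2 * μ ^ 2 * P.real B := by
  have i4 := (X.integrable_dis_four i).integrableOn (s := B)
  have i2 := (X.integrable_dis_sq i).integrableOn (s := B)
  have h1 : ∫ ω in B, X.dis i ω ^ 2 ∂P
      ≤ ∫ ω in B, ((2 * μ ^ 2)⁻¹ * X.dis i ω ^ 4 + μ ^ 2 / 2) ∂P := by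
    refine integral_mono i2 ((i4.const_mul _).add (integrable_const _)) fun ω => ?_
    have h2 : (2 * μ ^ 2)⁻¹ * X.dis i ω ^ 4 + μ ^ 2 / 2 - X.dis i ω ^ 2
        = (2 * μ ^ 2)⁻¹ * (X.dis i ω ^ 2 - μ ^ 2) ^ 2 := by
      field_simp; ring
    have h3 : 0 ≤ (2 * μ ^ 2)⁻¹ * (X.dis i ω ^ 2 - μ ^ 2) ^ 2 := by positivity
    show X.dis i ω ^ 2 ≤ (2 * μ ^ 2)⁻¹ * X.dis i ω ^ 4 + μ ^ 2 / 2
    linarith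
  rw [integral_add (i4.const_mul _) (integrable_const _), integral_const_mul,
    setIntegral_const_real] at h1
  have h4 := mul_le_mul_of_nonneg_left h (by positivity : 0 ≤ (2 * μ ^ 2)⁻¹)
  have h5 : (2 * μ ^ 2)⁻¹ * (C₄ * μ ^ 4 * P.real B) = C₄ / 2 * μ ^ 2 * P.real B := by field_simp
  linarith

/-- Over `O(1/μ)` steps the fourth moment of the distance from the starting point stays of
order `μ²`. -/
lemma displacement_block (hf : RegularCost f δ ρ) (hδ : 0 < δ) (hμ : 0 < μ)
    (hμδ : μ * (δ + 1) ≤ 1) {x : E M} {Cg C₄ κ : ℝ} (hC₄ : 0 ≤ C₄)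
    (hx : ‖gradient f x‖ ^ 4 ≤ Cg * μ ^ 2)
    {i : ℕ} {B : Set Ω} (hB : MeasurableSet[X.ℱ i] B)
    (hc : ∀ ω ∈ B, ‖X.c i ω - x‖ ≤ μ)
    (hdis : ∀ j, ∫ ω in B, X.dis (i + j) ω ^ 4 ∂P ≤ C₄ * μ ^ 4 * P.real B)
    {j : ℕ} (hj : μ * j ≤ κ) :
    ∫ ω in B, ‖X.c (i + j) ω - x‖ ^ 4 ∂P
      ≤ Real.exp (κ * (4 * δ + 4)) * (1 + (128 * (Cg + δ ^ 4 * C₄) + 19 * σ ^ 4) * κ)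
        * μ ^ 2 * P.real B := by
  set b : ℝ := 128 * (Cg + δ ^ 4 * C₄) + 19 * σ ^ 4 with hb
  have hμ1 : μ ≤ 1 := by nlinarith
  have hCg : 0 ≤ Cg := by
    by_contra! h
    have h1 : 0 ≤ ‖gradient f x‖ ^ 4 := by positivity
    nlinarith [pow_pos hμ 2]
  have hb0 : 0 ≤ b := by positivity
  have hP : 0 ≤ P.real B := measureReal_nonneg
  have key : ∀ j : ℕ, ∫ ω in B, ‖X.c (i + j) ω - x‖ ^ 4 ∂P
      ≤ Real.exp (μ * j * (4 * δ + 4)) * (1 + b * (μ * j)) * μ ^ 2 * P.real B := by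
    intro j
    induction j with
    | zero =>
      have h1 : ∫ ω in B, ‖X.c i ω - x‖ ^ 4 ∂P ≤ ∫ _ in B, μ ^ 2 ∂P := by
        refine setIntegral_mono_on (X.integrable_disp_four i x).integrableOn
          (integrable_const _) (X.ℱ.le i B hB) fun ω hω => ?_
        refine (pow_le_pow_left₀ (norm_nonneg _) (hc ω hω) 4).trans ?_
        exact pow_le_pow_of_le_one hμ.le hμ1 (by norm_num)
      rw [setIntegral_const_real] at h1
      simpa using h1
    | succ j ih =>
      refine (X.displacement_step hf hδ hμ hμδ x (i + j)
        (X.ℱ.mono (Nat.le_add_right i j) B hB)).trans ?_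
      have e1 : Real.exp (μ * (j + 1 : ℕ) * (4 * δ + 4))
          = Real.exp (μ * (4 * δ + 4)) * Real.exp (μ * j * (4 * δ + 4)) := by
        rw [← Real.exp_add]; congr 1; push_cast; ring
      have e2 : 1 ≤ Real.exp (μ * (j + 1 : ℕ) * (4 * δ + 4)) := Real.one_le_exp (by positivity)
      have h1 := mul_le_mul_of_nonneg_left ih (Real.exp_pos (μ * (4 * δ + 4))).le
      have h2 : δ ^ 4 * ∫ ω in B, X.dis (i + j) ω ^ 4 ∂P
          ≤ δ ^ 4 * (C₄ * μ ^ 2 * P.real B) := by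
        refine mul_le_mul_of_nonneg_left ((hdis j).trans ?_) (by positivity)
        have : μ ^ 4 ≤ μ ^ 2 := pow_le_pow_of_le_one hμ.le hμ1 (by norm_num)
        gcongr
      have h3 : ‖gradient f x‖ ^ 4 * P.real B ≤ Cg * μ ^ 2 * P.real B := by gcongr
      have h4 := mul_le_mul_of_nonneg_left (add_le_add h3 h2) (by positivity : 0 ≤ 128 * μ)
      have h5 : b * μ * μ ^ 2 * P.real B
          ≤ Real.exp (μ * (j + 1 : ℕ) * (4 * δ + 4)) * (b * μ * μ ^ 2 * P.real B) :=
        le_mul_of_one_le_left (by positivity) e2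
      have h6 : b * μ * μ ^ 2 * P.real B
          = 128 * μ * (Cg * μ ^ 2 * P.real B + δ ^ 4 * (C₄ * μ ^ 2 * P.real B))
            + 19 * μ ^ 3 * σ ^ 4 * P.real B := by rw [hb]; ring
      calc _ ≤ Real.exp (μ * (4 * δ + 4)) * (Real.exp (μ * j * (4 * δ + 4))
              * (1 + b * (μ * j)) * μ ^ 2 * P.real B) + b * μ * μ ^ 2 * P.real B := by
            rw [h6]; linarith
        _ ≤ Real.exp (μ * (j + 1 : ℕ) * (4 * δ + 4)) * (1 + b * (μ * j)) * μ ^ 2 * P.real B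
            + Real.exp (μ * (j + 1 : ℕ) * (4 * δ + 4)) * (b * μ * μ ^ 2 * P.real B) := by
            refine add_le_add (le_of_eq ?_) h5
            rw [e1]; ring
        _ = _ := by push_cast; ring
  refine (key j).trans ?_
  have hκ : 0 ≤ μ * j := by positivity
  gcongr

/-- The mean square of the slope grows at least linearly over a block. -/
lemma slope_block (hf : RegularCost f δ ρ) (hρ : 0 ≤ ρ) (hμ : 0 < μ)
    {x v : E M} {lam τ σl Q C₄ C₅ : ℝ} (hτ : 0 < τ) (hlam : τ ≤ lam) (hv1 : ‖v‖ = 1)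
    (hv : hessian f x v = (-lam) • v) (hQ : 0 ≤ Q)
    (hexc : ∀ j B, MeasurableSet[X.ℱ j] B →
      3 / 4 * σl ^ 2 * P.real B
          - Q * (∫ ω in B, X.dis j ω ^ 4 ∂P + ∫ ω in B, ‖X.c j ω - x‖ ^ 4 ∂P)
        ≤ ∫ ω in B, ⟪X.s j ω, v⟫_ℝ ^ 2 ∂P)
    (hs1 : Q * (C₄ * μ ^ 4 + C₅ * μ ^ 2) ≤ σl ^ 2 / 4)
    (hs2 : 8 * (δ ^ 2 * ((C₄ + 1) / 2) + ρ ^ 2 * C₅) * μ ≤ τ * σl ^ 2 / 4)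
    {i K : ℕ} {B : Set Ω} (hB : MeasurableSet[X.ℱ i] B)
    (hdis : ∀ j, ∫ ω in B, X.dis (i + j) ω ^ 4 ∂P ≤ C₄ * μ ^ 4 * P.real B)
    (hdisp : ∀ j ≤ K, ∫ ω in B, ‖X.c (i + j) ω - x‖ ^ 4 ∂P ≤ C₅ * μ ^ 2 * P.real B)
    {j : ℕ} (hj : j ≤ K) :
    j * (μ ^ 2 * τ ^ 2 * σl ^ 2 / 4) * P.real B
      ≤ ∫ ω in B, slope f x v (-lam) (X.c (i + j) ω) ^ 2 ∂P := by
  have hP : 0 ≤ P.real B := measureReal_nonneg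
  have hlam0 : 0 < lam := hτ.trans_le hlam
  induction j with
  | zero =>
    simpa using integral_nonneg fun ω => sq_nonneg _
  | succ j ih =>
    have ih := ih (by omega)
    have hBj := X.ℱ.mono (Nat.le_add_right i j) B hB
    refine le_trans ?_ (X.slope_step hf hρ hμ hlam0.le hv1 hv (i + j) hBj)
    have h1 := X.dis_sq_le_of_four hμ (hdis j)
    have h2 := hdisp j (by omega)
    have h3 := hexc (i + j) B hBj
    have h4 := mul_le_mul_of_nonneg_left (add_le_add (hdis j) h2) hQ
    have h5 := mul_le_mul_of_nonneg_right hs1 hP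
    have h6 : σl ^ 2 / 2 * P.real B ≤ ∫ ω in B, ⟪X.s (i + j) ω, v⟫_ℝ ^ 2 ∂P := by linarith
    have h7 := mul_le_mul_of_nonneg_left h6 (by positivity : 0 ≤ μ ^ 2 * lam ^ 2)
    have h8 := mul_le_mul_of_nonneg_left
      (add_le_add (mul_le_mul_of_nonneg_left h1 (sq_nonneg δ))
        (mul_le_mul_of_nonneg_left h2 (sq_nonneg ρ))) (by positivity : 0 ≤ 8 * μ * lam)
    have h9 := mul_le_mul_of_nonneg_right hs2
      (by positivity : 0 ≤ μ ^ 2 * lam * P.real B)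
    have h10 : τ * σl ^ 2 / 4 * (μ ^ 2 * lam * P.real B)
        ≤ lam * σl ^ 2 / 4 * (μ ^ 2 * lam * P.real B) := by gcongr
    have h11 : μ ^ 2 * τ ^ 2 * σl ^ 2 / 4 * P.real B ≤ μ ^ 2 * lam ^ 2 * σl ^ 2 / 4 * P.real B := by
      gcongr
    push_cast
    linarith

lemma gradient_sq_ge (hf : RegularCost f δ ρ) (hρ : 0 ≤ ρ) {x v : E M} {a : ℝ}
    (hv1 : ‖v‖ = 1) (hv : hessian f x v = a • v) (i : ℕ) (B : Set Ω) :
    1 / 2 * ∫ ω in B, slope f x v a (X.c i ω) ^ 2 ∂P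
        - ρ ^ 2 * ∫ ω in B, ‖X.c i ω - x‖ ^ 4 ∂P
      ≤ ∫ ω in B, ‖gradient f (X.c i ω)‖ ^ 2 ∂P := by
  have i1 := (X.memLp_slope i x v a).integrable_norm_sq_of_four.integrableOn (s := B)
  simp only [Real.norm_eq_abs, sq_abs] at i1
  have i2 := ((X.integrable_disp_four i x).integrableOn (s := B)).const_mul (ρ ^ 2)
  have i3 := (X.memLp_gradient hf i).integrable_norm_sq_of_four.integrableOn (s := B)
  have i1' := i1.const_mul (1 / 2)
  have h := integral_mono (i1'.sub i2) i3 fun ω => ?_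
  · rwa [integral_sub' i1' i2, integral_const_mul, integral_const_mul] at h
  · show 1 / 2 * slope f x v a (X.c i ω) ^ 2 - ρ ^ 2 * ‖X.c i ω - x‖ ^ 4
      ≤ ‖gradient f (X.c i ω)‖ ^ 2
    have h1 := inner_gradient_eq hf hv (X.c i ω)
    set ε := ⟪v, gradient f (X.c i ω) - gradient f x - hessian f x (X.c i ω - x)⟫_ℝ
    have h2 : |ε| ≤ ρ * ‖X.c i ω - x‖ ^ 2 := by
      refine (abs_real_inner_le_norm _ _).trans ?_
      rw [hv1, one_mul]
      exact hf.norm_gradient_sub_le hρ x _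
    have h3 : ε ^ 2 ≤ ρ ^ 2 * ‖X.c i ω - x‖ ^ 4 := by
      rw [← sq_abs]
      refine (pow_le_pow_left₀ (abs_nonneg _) h2 2).trans (le_of_eq (by ring))
    have h4 : ⟪v, gradient f (X.c i ω)⟫_ℝ ^ 2 ≤ ‖gradient f (X.c i ω)‖ ^ 2 := by
      rw [← sq_abs]
      refine pow_le_pow_left₀ (abs_nonneg _) ((abs_real_inner_le_norm _ _).trans ?_) 2
      rw [hv1, one_mul]
    rw [h1] at h4
    nlinarith [sq_nonneg (slope f x v a (X.c i ω) + 2 * ε)]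

/-- Escape from a strict saddle point `x`: the noise along a direction of negative curvature drives
the gradient up, and the descent caused by this larger gradient outweighs the noise over a block of
`K ≈ κ / μ` steps. -/
lemma potential_block (hf : RegularCost f δ ρ) (hρ : 0 ≤ ρ) (hδ : 0 < δ) (hσ : 0 < σ)
    (hμ : 0 < μ) (hμδ : μ * (δ + 1) ≤ 1 / 8) (hθ0 : 0 ≤ θ) (hθ1 : θ ≤ 1) {a : ℝ} (ha : 0 ≤ a)
    (haμ : 2 * μ * δ ^ 2 ≤ a * (1 - θ) / 2) (haD : a * D ≤ c2 δ σ / 4)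
    {x v : E M} {lam τ σl Q Cg C₃ C₄ C₅ κ κ' : ℝ} (hτ : 0 < τ) (hlam : τ ≤ lam) (hv1 : ‖v‖ = 1)
    (hv : hessian f x v = (-lam) • v) (hQ : 0 ≤ Q)
    (hexc : ∀ j B, MeasurableSet[X.ℱ j] B →
      3 / 4 * σl ^ 2 * P.real B
          - Q * (∫ ω in B, X.dis j ω ^ 4 ∂P + ∫ ω in B, ‖X.c j ω - x‖ ^ 4 ∂P)
        ≤ ∫ ω in B, ⟪X.s j ω, v⟫_ℝ ^ 2 ∂P)
    (hx : ‖gradient f x‖ ^ 4 ≤ Cg * μ ^ 2)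
    (hC₄ : D ≤ (1 - θ) * C₄) (hC₃₄ : C₃ ^ 2 ≤ C₄)
    (hC₅ : Real.exp (κ' * (4 * δ + 4)) * (1 + (128 * (Cg + δ ^ 4 * C₄) + 19 * σ ^ 4) * κ') = C₅)
    (hs1 : Q * (C₄ * μ ^ 4 + C₅ * μ ^ 2) ≤ σl ^ 2 / 4)
    (hs2 : 8 * (δ ^ 2 * ((C₄ + 1) / 2) + ρ ^ 2 * C₅) * μ ≤ τ * σl ^ 2 / 4)
    (hs3 : ρ ^ 2 * C₅ * μ ≤ c2 δ σ)
    (hκ : 80 * c2 δ σ ≤ κ * (τ ^ 2 * σl ^ 2))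
    {i K : ℕ} (hK : μ * K ≤ κ') (hK' : κ ≤ μ * (K - 1)) {B : Set Ω}
    (hB : MeasurableSet[X.ℱ i] B) (hc : ∀ ω ∈ B, ‖X.c i ω - x‖ ≤ μ)
    (hd : ∀ ω ∈ B, X.dis i ω ^ 2 ≤ C₃ * μ ^ 2) :
    ∫ ω in B, X.potential a (i + K) ω ∂P
      ≤ ∫ ω in B, X.potential a i ω ∂P - c2 δ σ * μ ^ 2 * K * P.real B := by
  have hP : 0 ≤ P.real B := measureReal_nonneg
  have hμδ' : μ * δ ≤ 1 / 8 := by nlinarith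
  have hdis : ∀ j, ∫ ω in B, X.dis (i + j) ω ^ 4 ∂P ≤ C₄ * μ ^ 4 * P.real B := by
    refine X.dis_four_block hθ0 hC₄ hB ?_
    rw [← setIntegral_const_real]
    refine setIntegral_mono_on (X.integrable_dis_four i).integrableOn
      (integrable_const _) (X.ℱ.le i B hB) fun ω hω => ?_
    calc X.dis i ω ^ 4 = (X.dis i ω ^ 2) ^ 2 := by ring
      _ ≤ (C₃ * μ ^ 2) ^ 2 := pow_le_pow_left₀ (sq_nonneg _) (hd ω hω) 2
      _ = C₃ ^ 2 * μ ^ 4 := by ring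
      _ ≤ C₄ * μ ^ 4 := by gcongr
  have hdisp : ∀ j ≤ K, ∫ ω in B, ‖X.c (i + j) ω - x‖ ^ 4 ∂P ≤ C₅ * μ ^ 2 * P.real B := by
    intro j hj
    rw [← hC₅]
    refine X.displacement_block hf hδ hμ (by linarith) ((sq_nonneg _).trans hC₃₄) hx hB hc hdis ?_
    refine le_trans ?_ hK
    gcongr
  have hsum : ∀ j ≤ K, ∫ ω in B, X.potential a (i + j) ω ∂P ≤ ∫ ω in B, X.potential a i ω ∂P
      - 5 / 8 * μ * ((j * (j - 1) / 2 : ℝ) * (μ ^ 2 * τ ^ 2 * σl ^ 2 / 8)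
          - j * (ρ ^ 2 * C₅ * μ ^ 2)) * P.real B
      + 5 / 4 * c2 δ σ * μ ^ 2 * j * P.real B := by
    intro j
    induction j with
    | zero => simp
    | succ j ih =>
      intro hj
      have ih := ih (by omega)
      have hBj := X.ℱ.mono (Nat.le_add_right i j) B hB
      have h1 := X.potential_step hf hδ hσ hμ hμδ' ha haμ haD (i + j) hBj
      have h2 := X.gradient_sq_ge hf hρ hv1 hv (i + j) B
      have h3 := X.slope_block hf hρ hμ hτ hlam hv1 hv hQ hexc hs1 hs2 hB hdis hdisp
        (j := j) (by omega)
      have h4 := mul_le_mul_of_nonneg_left (hdisp j (by omega)) (sq_nonneg ρ)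
      have h5 : 0 ≤ a * (1 - θ) / 2 * ∫ ω in B, X.dis (i + j) ω ^ 2 ∂P := by
        refine mul_nonneg ?_ (integral_nonneg fun ω => sq_nonneg _)
        have := sub_nonneg.2 hθ1
        positivity
      have h6 : (j : ℝ) * (μ ^ 2 * τ ^ 2 * σl ^ 2 / 8) * P.real B - ρ ^ 2 * C₅ * μ ^ 2 * P.real B
          ≤ ∫ ω in B, ‖gradient f (X.c (i + j) ω)‖ ^ 2 ∂P := by linarith
      have h7 := mul_le_mul_of_nonneg_left h6 (by positivity : 0 ≤ 5 / 8 * μ)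
      rw [← add_assoc]
      push_cast
      linarith
  refine (hsum K le_rfl).trans ?_
  have hKP : 0 ≤ μ ^ 2 * K * P.real B := by positivity
  have h1 := mul_le_mul_of_nonneg_right hs3 hKP
  have h2 := mul_le_mul_of_nonneg_right hK'
    (by positivity : 0 ≤ τ ^ 2 * σl ^ 2 * (μ ^ 2 * K * P.real B))
  have h3 := mul_le_mul_of_nonneg_right hκ hKP
  have hc2 : 0 ≤ c2 δ σ := by rw [c2]; positivity
  have h4 := mul_nonneg hc2 hKP
  nlinarith

end NoisyDescent

/-! ### Hitting times of adapted decreasing processes -/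

section Hitting

variable {Ω : Type*} {mΩ : MeasurableSpace Ω} {P : Measure Ω}

/-- To bound an integral over `B` it suffices to bound it over all small events of a countable
cover. -/
lemma setIntegral_nonpos_of_cover {m : MeasurableSpace Ω} (hm : m ≤ mΩ) {g : Ω → ℝ}
    (hg : Integrable g P) {B : Set Ω} (hB : MeasurableSet[m] B) {A : ℕ → Set Ω}
    (hA : ∀ n, MeasurableSet[m] (A n)) (hBA : B ⊆ ⋃ n, A n)
    (h : ∀ n B', MeasurableSet[m] B' → B' ⊆ B ∩ A n → ∫ ω in B', g ω ∂P ≤ 0) :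
    ∫ ω in B, g ω ∂P ≤ 0 := by
  have hD : ∀ n, MeasurableSet[m] (B ∩ disjointed A n) := fun n =>
    hB.inter (MeasurableSet.disjointed (mα := m) hA n)
  have hU : B = ⋃ n, B ∩ disjointed A n := by
    rw [← Set.inter_iUnion, iUnion_disjointed, Set.inter_eq_left.2 hBA]
  have hsum := hasSum_integral_iUnion (μ := P) (f := g) (s := fun n => B ∩ disjointed A n)
    (fun n => hm _ (hD n))
    (fun i j hij => ((disjoint_disjointed A) hij).mono Set.inter_subset_right
      Set.inter_subset_right) hg.integrableOn
  rw [← hU] at hsum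
  exact hsum.nonpos fun n => h n _ (hD n)
    (Set.inter_subset_inter_right B (disjointed_subset A n))

/-- Suppose that a nonnegative process loses in the mean at least `q` per unit of time, over one
step from the events `G i` and over `K` steps from the events `H i`. Then up to the time `n` the
remaining events `S i` are avoided with probability `O(1 / (q n))`. The events `B` of the past
replace stopping times and conditioning. -/
lemma avoid_prob_le [IsProbabilityMeasure P] {ℱ : Filtration ℕ mΩ} {V : ℕ → Ω → ℝ}
    (hVi : ∀ i, Integrable (V i) P) (hV0 : ∀ i ω, 0 ≤ V i ω) {G H S : ℕ → Set Ω}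
    (hG : ∀ i, MeasurableSet[ℱ i] (G i)) (hH : ∀ i, MeasurableSet[ℱ i] (H i))
    (hS : ∀ i, MeasurableSet[ℱ i] (S i)) (hcover : ∀ i ω, ω ∈ G i ∨ ω ∈ H i ∨ ω ∈ S i)
    {q : ℝ} (hq : 0 ≤ q) {K : ℕ} (hK : 0 < K)
    (hone : ∀ i B, MeasurableSet[ℱ i] B → B ⊆ G i →
      ∫ ω in B, V (i + 1) ω ∂P ≤ ∫ ω in B, V i ω ∂P - q * P.real B)
    (hblock : ∀ i B, MeasurableSet[ℱ i] B → B ⊆ H i →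
      ∫ ω in B, V (i + K) ω ∂P ≤ ∫ ω in B, V i ω ∂P - q * K * P.real B)
    (n i : ℕ) {B : Set Ω} (hB : MeasurableSet[ℱ i] B) :
    q * ((n : ℝ) - K) * P.real (B ∩ {ω | ∀ j ≤ n, ω ∉ S (i + j)}) ≤ ∫ ω in B, V i ω ∂P := by
  induction n using Nat.strong_induction_on generalizing i B with
  | _ n ih =>
    have hVB : ∀ j (C : Set Ω), 0 ≤ ∫ ω in C, V j ω ∂P := fun j C =>
      integral_nonneg fun ω => hV0 j ω
    rcases le_or_gt n K with hnK | hnK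
    · refine le_trans (mul_nonpos_of_nonpos_of_nonneg ?_ measureReal_nonneg) (hVB i B)
      have : (n : ℝ) ≤ K := by exact_mod_cast hnK
      exact mul_nonpos_of_nonneg_of_nonpos hq (by linarith)
    set A : ℕ → ℕ → Set Ω := fun n i => {ω | ∀ j ≤ n, ω ∉ S (i + j)} with hA
    have hAmeas : ∀ n i, MeasurableSet (A n i) := by
      intro n i
      have : A n i = ⋂ j, ⋂ (_ : j ≤ n), (S (i + j))ᶜ := by ext ω; simp [hA]
      rw [this]
      exact MeasurableSet.iInter fun j => MeasurableSet.iInter fun _ =>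
        (ℱ.le _ _ (hS (i + j))).compl
    have hAmono : ∀ k ≤ n, A n i ⊆ A (n - k) (i + k) := by
      intro k hk ω hω j hj
      rw [add_assoc]
      exact hω (k + j) (by omega)
    -- the three cases: one-step decrease, block decrease, target reached
    set BG := B ∩ G i with hBG
    set BH := (B \ G i) ∩ H i with hBH
    have hBGm : MeasurableSet[ℱ i] BG := hB.inter (hG i)
    have hBHm : MeasurableSet[ℱ i] BH := (hB.diff (hG i)).inter (hH i)
    have hnK' : (K : ℝ) < n := by exact_mod_cast hnK
    have h1 : q * ((n : ℝ) - K) * P.real (BG ∩ A n i) ≤ ∫ ω in BG, V i ω ∂P := by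
      have h2 := hone i BG hBGm Set.inter_subset_right
      have h3 := ih (n - 1) (by omega) (i + 1) (ℱ.mono (Nat.le_succ i) _ hBGm)
      have h4 : P.real (BG ∩ A n i) ≤ P.real (BG ∩ A (n - 1) (i + 1)) :=
        measureReal_mono (Set.inter_subset_inter_right _ (hAmono 1 (by omega)))
      have h5 : P.real (BG ∩ A n i) ≤ P.real BG := measureReal_mono Set.inter_subset_left
      rw [Nat.cast_sub (by omega), Nat.cast_one] at h3
      have h6 : (0 : ℝ) ≤ n - 1 - K := by
        have : (K : ℝ) + 1 ≤ n := by exact_mod_cast hnK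
        linarith
      have h7 := mul_le_mul_of_nonneg_left h4 (mul_nonneg hq h6)
      have h8 := mul_le_mul_of_nonneg_left h5 hq
      linarith
    have h2 : q * ((n : ℝ) - K) * P.real (BH ∩ A n i) ≤ ∫ ω in BH, V i ω ∂P := by
      have h2 := hblock i BH hBHm Set.inter_subset_right
      have h5 : P.real (BH ∩ A n i) ≤ P.real BH := measureReal_mono Set.inter_subset_left
      have h8 := mul_le_mul_of_nonneg_left h5 hq
      rcases le_or_gt (n : ℝ) (2 * K) with h6 | h6
      · have h9 := hVB (i + K) BH
        have h10 : q * ((n : ℝ) - K) * P.real (BH ∩ A n i) ≤ q * K * P.real BH := by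
          have h11 : (n : ℝ) - K ≤ K := by linarith
          have h12 : (0 : ℝ) ≤ n - K := by linarith
          gcongr
        linarith
      · have h3 := ih (n - K) (by omega) (i + K) (ℱ.mono (Nat.le_add_right i K) _ hBHm)
        have h4 : P.real (BH ∩ A n i) ≤ P.real (BH ∩ A (n - K) (i + K)) :=
          measureReal_mono (Set.inter_subset_inter_right _ (hAmono K hnK.le))
        rw [Nat.cast_sub hnK.le] at h3
        have h7 := mul_le_mul_of_nonneg_left h4
          (mul_nonneg hq (by linarith : (0 : ℝ) ≤ n - K - K))
        have h9 := mul_le_mul_of_nonneg_left h8 (Nat.cast_nonneg K)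
        linarith
    have h3 : B ∩ A n i ⊆ (BG ∩ A n i) ∪ (BH ∩ A n i) := by
      rintro ω ⟨hωB, hωA⟩
      by_cases hωG : ω ∈ G i
      · exact Or.inl ⟨⟨hωB, hωG⟩, hωA⟩
      · rcases hcover i ω with h | h | h
        · exact absurd h hωG
        · exact Or.inr ⟨⟨⟨hωB, hωG⟩, h⟩, hωA⟩
        · exact absurd h (hωA 0 (Nat.zero_le n))
    have h4 : P.real (B ∩ A n i) ≤ P.real (BG ∩ A n i) + P.real (BH ∩ A n i) :=
      (measureReal_mono h3).trans (measureReal_union_le _ _)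
    have hdisj : Disjoint BG BH := by
      rw [Set.disjoint_left]
      rintro ω ⟨_, hωG⟩ ⟨⟨_, hω⟩, _⟩
      exact hω hωG
    have h5 : ∫ ω in BG, V i ω ∂P + ∫ ω in BH, V i ω ∂P ≤ ∫ ω in B, V i ω ∂P := by
      rw [← setIntegral_union hdisj (ℱ.le i _ hBHm) (hVi i).integrableOn (hVi i).integrableOn]
      refine setIntegral_mono_set (hVi i).integrableOn
        (Filter.Eventually.of_forall fun ω => hV0 i ω) (LE.le.eventuallyLE ?_)
      exact Set.union_subset Set.inter_subset_left fun ω hω => hω.1.1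
    have h6 := mul_le_mul_of_nonneg_left h4
      (mul_nonneg hq (by linarith : (0 : ℝ) ≤ n - K))
    linarith

end Hitting

namespace NoisyDescent

variable {M : ℕ} {Ω : Type*} [MeasurableSpace Ω] {P : Measure Ω} [IsProbabilityMeasure P]
  {f : E M → ℝ} {μ δ ρ σ θ D : ℝ} (X : NoisyDescent P f μ δ σ θ D)

/-- A decrease over `K` steps from every small neighbourhood of each point of `S` is a decrease
from all of `S`. -/
lemma block_of_local (hf : RegularCost f δ ρ) (hδ : 0 < δ) (hμ : 0 < μ) {a b b' : ℝ}
    {S : Set (E M)} {i K : ℕ}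
    (h : ∀ x ∈ S, ∀ B, MeasurableSet[X.ℱ i] B → (∀ ω ∈ B, ‖X.c i ω - x‖ ≤ μ) →
      (∀ ω ∈ B, X.dis i ω ^ 2 ≤ b') →
      ∫ ω in B, X.potential a (i + K) ω ∂P ≤ ∫ ω in B, X.potential a i ω ∂P - b * P.real B)
    {B : Set Ω} (hB : MeasurableSet[X.ℱ i] B) (hBS : ∀ ω ∈ B, X.c i ω ∈ S)
    (hBd : ∀ ω ∈ B, X.dis i ω ^ 2 ≤ b') :
    ∫ ω in B, X.potential a (i + K) ω ∂P ≤ ∫ ω in B, X.potential a i ω ∂P - b * P.real B := by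
  rcases S.eq_empty_or_nonempty with rfl | hS
  · have : B = ∅ := Set.eq_empty_of_forall_notMem fun ω hω => hBS ω hω
    simp [this]
  have : Nonempty S := hS.to_subtype
  have i1 := X.integrable_potential hf hδ.le a i
  have i2 := X.integrable_potential hf hδ.le a (i + K)
  have hsplit : ∀ C : Set Ω, ∫ ω in C, (X.potential a (i + K) ω - X.potential a i ω + b) ∂P
      = ∫ ω in C, X.potential a (i + K) ω ∂P - ∫ ω in C, X.potential a i ω ∂P
        + b * P.real C := by
    intro C
    have i3 : IntegrableOn (fun ω => X.potential a (i + K) ω - X.potential a i ω) C P :=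
      i2.integrableOn.sub i1.integrableOn
    rw [integral_add i3 (integrable_const _),
      integral_sub i2.integrableOn i1.integrableOn, setIntegral_const_real]
  have hmain := setIntegral_nonpos_of_cover (X.ℱ.le i) (P := P)
    (g := fun ω => X.potential a (i + K) ω - X.potential a i ω + b)
    ((i2.sub i1).add (integrable_const b)) hB
    (A := fun n => {ω | ‖X.c i ω - (TopologicalSpace.denseSeq S n : E M)‖ ≤ μ})
    (fun n => ?_) (fun ω hω => ?_) (fun n B' hB' hsub => ?_)
  · rw [hsplit] at hmain
    linarith
  · exact ((X.meas_c i).sub stronglyMeasurable_const).norm.measurable measurableSet_Iic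
  · obtain ⟨n, hn⟩ := (TopologicalSpace.denseRange_denseSeq S).exists_dist_lt
      ⟨X.c i ω, hBS ω hω⟩ hμ
    refine Set.mem_iUnion.2 ⟨n, ?_⟩
    rw [Subtype.dist_eq, dist_eq_norm] at hn
    exact hn.le
  · rw [hsplit]
    have := h _ (TopologicalSpace.denseSeq S n).2 B' hB' (fun ω hω => (hsub hω).2)
      (fun ω hω => hBd ω (hsub hω).1)
    linarith

/-- One-step decrease of the potential away from the points with small gradient, and at times of
large disagreement. -/
lemma potential_step_of_large (hf : RegularCost f δ ρ) (hδ : 0 < δ) (hσ : 0 < σ) (hμ : 0 < μ)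
    (hμδ : μ * (δ + 1) ≤ 1 / 8) (hθ1 : θ ≤ 1) {a : ℝ} (ha : 0 ≤ a)
    (haμ : 2 * μ * δ ^ 2 ≤ a * (1 - θ) / 2)
    (haD : a * D ≤ c2 δ σ / 4) {C₃ π : ℝ} (hπ : 0 < π) (hπ1 : π < 1)
    (hC₃ : 9 / 4 * c2 δ σ ≤ a * (1 - θ) / 2 * C₃) (i : ℕ) {B : Set Ω}
    (hB : MeasurableSet[X.ℱ i] B)
    (hBl : ∀ ω ∈ B, X.c i ω ∉ smallGradient f δ σ π μ ∨ C₃ * μ ^ 2 ≤ X.dis i ω ^ 2) :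
    ∫ ω in B, X.potential a (i + 1) ω ∂P
      ≤ ∫ ω in B, X.potential a i ω ∂P - c2 δ σ * μ ^ 2 * P.real B := by
  have h1 := X.potential_step hf hδ hσ hμ (by nlinarith) ha haμ haD i hB
  have i2 := ((X.memLp_gradient hf i).integrable_norm_sq_of_four.integrableOn
    (s := B)).const_mul (5 / 8 * μ)
  have i3 := ((X.integrable_dis_sq i).integrableOn (s := B)).const_mul (a * (1 - θ) / 2)
  have hc2 : 0 < c2 δ σ := by rw [c2]; positivity
  have haθ : 0 ≤ a * (1 - θ) / 2 := by
    have := sub_nonneg.2 hθ1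
    positivity
  have h2 : ∫ _ in B, 9 / 4 * c2 δ σ * μ ^ 2 ∂P
      ≤ ∫ ω in B, (5 / 8 * μ * ‖gradient f (X.c i ω)‖ ^ 2
        + a * (1 - θ) / 2 * X.dis i ω ^ 2) ∂P := by
    refine setIntegral_mono_on (integrable_const _) (i2.add i3) (X.ℱ.le i B hB) fun ω hω => ?_
    have h3 : 0 ≤ 5 / 8 * μ * ‖gradient f (X.c i ω)‖ ^ 2 := by positivity
    have h4 : 0 ≤ a * (1 - θ) / 2 * X.dis i ω ^ 2 := mul_nonneg haθ (sq_nonneg _)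
    rcases hBl ω hω with h | h
    · have h5 : μ * (c2 δ σ / c1 δ μ) * (1 + 1 / π) ≤ ‖gradient f (X.c i ω)‖ ^ 2 := not_lt.1 h
      have hc1 : 0 < c1 δ μ := by rw [c1]; nlinarith
      have hc1' : c1 δ μ ≤ 1 / 2 := by rw [c1]; nlinarith
      have h6 : 2 * c2 δ σ ≤ c2 δ σ / c1 δ μ := by
        rw [le_div_iff₀ hc1]; nlinarith
      have h7 : 1 ≤ 1 / π := by rw [le_div_iff₀ hπ]; linarith
      have h8 : μ * (2 * c2 δ σ) * (1 + 1) ≤ ‖gradient f (X.c i ω)‖ ^ 2 := by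
        refine le_trans ?_ h5
        gcongr
      have h9 := mul_le_mul_of_nonneg_left h8 (by positivity : 0 ≤ 5 / 8 * μ)
      have h10 : 0 ≤ c2 δ σ * μ ^ 2 := by positivity
      linarith
    · have h5 := mul_le_mul_of_nonneg_left h haθ
      have h6 := mul_le_mul_of_nonneg_right hC₃ (sq_nonneg μ)
      linarith
  rw [setIntegral_const_real, integral_add i2 i3, integral_const_mul, integral_const_mul] at h2
  linarith

end NoisyDescent

/-! ### Reaching a second-order stationary point -/

/-- A condition that is continuous in `μ` and strict at `μ = 0` holds for all small step-sizes. -/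
lemma eventually_le_of_continuous {g : ℝ → ℝ} (hg : Continuous g) {b : ℝ} (h : g 0 < b) :
    ∀ᶠ μ in nhdsWithin (0 : ℝ) (Set.Ioi 0), g μ ≤ b :=
  (((hg.tendsto 0).mono_left nhdsWithin_le_nhds).eventually (gt_mem_nhds h)).mono
    fun _ h => h.le

lemma measurableSet_smallGradient {M : ℕ} {f : E M → ℝ} {δ ρ : ℝ} (hf : RegularCost f δ ρ)
    (σ π μ : ℝ) : MeasurableSet (smallGradient f δ σ π μ) :=
  (isOpen_lt (hf.continuous_gradient.norm.pow 2) continuous_const).measurableSet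

lemma measurableSet_strictSaddle {M : ℕ} {f : E M → ℝ} {δ ρ : ℝ} (hf : RegularCost f δ ρ)
    (hM : 0 < M) (hρ : 0 ≤ ρ) (σ τ π μ : ℝ) : MeasurableSet (strictSaddle f δ σ τ π μ) :=
  (measurableSet_smallGradient hf σ π μ).inter (hf.isClosed_lambdaMin_le hM hρ (-τ)).measurableSet

lemma measurableSet_secondOrder {M : ℕ} {f : E M → ℝ} {δ ρ : ℝ} (hf : RegularCost f δ ρ)
    (hM : 0 < M) (hρ : 0 ≤ ρ) (σ τ π μ : ℝ) : MeasurableSet (secondOrder f δ σ τ π μ) := by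
  have h : secondOrder f δ σ τ π μ
      = smallGradient f δ σ π μ ∩ {x | lambdaMin (hessian f x) ≤ -τ}ᶜ := by
    ext x; simp [secondOrder]
  rw [h]
  exact (measurableSet_smallGradient hf σ π μ).inter
    (hf.isClosed_lambdaMin_le hM hρ (-τ)).measurableSet.compl

lemma norm_gradient_pow_four_le {M : ℕ} {f : E M → ℝ} {δ σ π μ : ℝ} (hμ : 0 < μ)
    (hc2 : 0 ≤ c2 δ σ) (hπ : 0 < π) (hμδ : μ * δ ≤ 1 / 8) {x : E M}
    (hx : x ∈ smallGradient f δ σ π μ) :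
    ‖gradient f x‖ ^ 4 ≤ (4 * c2 δ σ * (1 + 1 / π)) ^ 2 * μ ^ 2 := by
  have h1 : ‖gradient f x‖ ^ 2 < μ * (c2 δ σ / c1 δ μ) * (1 + 1 / π) := hx
  have hc1 : 1 / 4 ≤ c1 δ μ := by rw [c1]; linarith
  have h2 : c2 δ σ / c1 δ μ ≤ 4 * c2 δ σ := by
    rw [div_le_iff₀ (by linarith)]; nlinarith
  have h3 : ‖gradient f x‖ ^ 2 ≤ μ * (4 * c2 δ σ) * (1 + 1 / π) := by
    refine h1.le.trans ?_
    gcongr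
  calc ‖gradient f x‖ ^ 4 = (‖gradient f x‖ ^ 2) ^ 2 := by ring
    _ ≤ (μ * (4 * c2 δ σ) * (1 + 1 / π)) ^ 2 := pow_le_pow_left₀ (sq_nonneg _) h3 2
    _ = _ := by ring

namespace NoisyDescent

variable {M : ℕ} {Ω : Type*} [MeasurableSpace Ω] {P : Measure Ω}
  {f : E M → ℝ} {μ δ ρ σ θ D : ℝ}

/-- The noise has variance at least `3 σl² / 4` along every unit vector spanned by eigenvectors
with negative eigenvalue at a point `x` of `S`, up to an error controlled by the distance of the
process from `x` and by the disagreement. -/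
def Excites (X : NoisyDescent P f μ δ σ θ D) (S : Set (E M)) (σl Q : ℝ) : Prop :=
  ∀ x ∈ S, ∀ v ∈ negEigenspace (hessian f x), ‖v‖ = 1 → ∀ j B, MeasurableSet[X.ℱ j] B →
    3 / 4 * σl ^ 2 * P.real B
        - Q * (∫ ω in B, X.dis j ω ^ 4 ∂P + ∫ ω in B, ‖X.c j ω - x‖ ^ 4 ∂P)
      ≤ ∫ ω in B, ⟪X.s j ω, v⟫_ℝ ^ 2 ∂P

end NoisyDescent

open NoisyDescent in
/-- For small step-sizes, the probability of avoiding the second-order stationary points up to time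
`n` is `O(1 / (μ² n))`, uniformly over all noise processes. -/
theorem exists_avoid_prob_bound {M : ℕ} (hM : 0 < M) {f : E M → ℝ} {δ ρ σ θ D σl τ π Q m : ℝ}
    (hf : RegularCost f δ ρ) (hρ : 0 ≤ ρ) (hm : ∀ x, m ≤ f x) (hδ : 0 < δ) (hσ : 0 < σ)
    (hθ0 : 0 ≤ θ) (hθ1 : θ < 1) (hD : 0 ≤ D) (hσl : 0 < σl) (hτ : 0 < τ) (hπ : 0 < π)
    (hπ1 : π < 1) (hQ : 0 ≤ Q) :
    ∃ a κ : ℝ, 0 < a ∧ 0 < κ ∧ ∀ᶠ μ in nhdsWithin (0 : ℝ) (Set.Ioi 0),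
      ∀ (Ω : Type*) [MeasurableSpace Ω] (P : Measure Ω) [IsProbabilityMeasure P]
        (X : NoisyDescent P f μ δ σ θ D), X.Excites (strictSaddle f δ σ τ π μ) σl Q →
        ∀ n : ℕ, c2 δ σ * μ ^ 2 * (n - (κ / μ + 2))
            * P.real {ω | ∀ j ≤ n, X.c j ω ∉ secondOrder f δ σ τ π μ}
          ≤ ∫ ω, X.potential a 0 ω ∂P - m := by
  have hc2 : 0 < c2 δ σ := by rw [c2]; positivity
  have hθ : 0 < 1 - θ := sub_pos.2 hθ1
  set a : ℝ := c2 δ σ / (4 * (D + 1)) with ha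
  have ha0 : 0 < a := by positivity
  have haD : a * D ≤ c2 δ σ / 4 := by
    rw [ha, div_mul_eq_mul_div, div_le_div_iff₀ (by positivity) (by norm_num)]
    nlinarith
  set C₃ : ℝ := 9 * c2 δ σ / (2 * a * (1 - θ)) with hC₃
  have hC₃' : a * (1 - θ) / 2 * C₃ = 9 / 4 * c2 δ σ := by rw [hC₃]; field_simp; norm_num
  set C₄ : ℝ := C₃ ^ 2 + D / (1 - θ) with hC₄
  have hC₄0 : 0 ≤ C₄ := by positivity
  have hC₄' : D ≤ (1 - θ) * C₄ := by
    rw [hC₄, mul_add, mul_div_cancel₀ _ hθ.ne']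
    have : 0 ≤ (1 - θ) * C₃ ^ 2 := by positivity
    linarith
  set Cg : ℝ := (4 * c2 δ σ * (1 + 1 / π)) ^ 2 with hCg
  set κ : ℝ := 80 * c2 δ σ / (τ ^ 2 * σl ^ 2) with hκ
  have hκ0 : 0 < κ := by positivity
  have hκ' : 80 * c2 δ σ ≤ κ * (τ ^ 2 * σl ^ 2) := by rw [hκ]; field_simp; norm_num
  set C₅ : ℝ := Real.exp ((κ + 2) * (4 * δ + 4))
    * (1 + (128 * (Cg + δ ^ 4 * C₄) + 19 * σ ^ 4) * (κ + 2)) with hC₅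
  refine ⟨a, κ, ha0, hκ0, ?_⟩
  have e1 := eventually_le_of_continuous (g := fun μ => μ * (δ + 1)) (b := 1 / 8)
    (by fun_prop) (by norm_num)
  have e2 := eventually_le_of_continuous (g := fun μ => 2 * μ * δ ^ 2) (b := a * (1 - θ) / 2)
    (by fun_prop) (by simp only [mul_zero, zero_mul]; positivity)
  have e3 := eventually_le_of_continuous (g := fun μ => Q * (C₄ * μ ^ 4 + C₅ * μ ^ 2))
    (b := σl ^ 2 / 4) (by fun_prop) (by norm_num; positivity)
  have e4 := eventually_le_of_continuous
    (g := fun μ => 8 * (δ ^ 2 * ((C₄ + 1) / 2) + ρ ^ 2 * C₅) * μ)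
    (b := τ * σl ^ 2 / 4) (by fun_prop) (by norm_num; positivity)
  have e5 := eventually_le_of_continuous (g := fun μ => ρ ^ 2 * C₅ * μ) (b := c2 δ σ)
    (by fun_prop) (by norm_num; positivity)
  filter_upwards [e1, e2, e3, e4, e5, self_mem_nhdsWithin] with μ hμδ haμ hs1 hs2 hs3 hμ
  replace hμ : 0 < μ := hμ
  intro Ω _ P _ X hX n
  have hμδ0 : 0 < μ * δ := mul_pos hμ hδ
  have hμ1 : μ ≤ 1 := by linarith
  have hμδ' : μ * δ ≤ 1 / 8 := by linarith
  set K : ℕ := ⌈κ / μ⌉₊ + 1 with hK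
  have hKle : (K : ℝ) ≤ κ / μ + 2 := by
    have := (Nat.ceil_lt_add_one (by positivity : 0 ≤ κ / μ)).le
    rw [hK]; push_cast; linarith
  have hK1 : μ * K ≤ κ + 2 := by
    calc μ * K ≤ μ * (κ / μ + 2) := by gcongr
      _ = κ + 2 * μ := by field_simp
      _ ≤ κ + 2 := by linarith
  have hK2 : κ ≤ μ * ((K : ℝ) - 1) := by
    have := Nat.le_ceil (κ / μ)
    rw [div_le_iff₀ hμ] at this
    rw [hK]; push_cast; linarith
  have hblock : ∀ i B, MeasurableSet[X.ℱ i] B →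
      B ⊆ {ω | X.c i ω ∈ strictSaddle f δ σ τ π μ ∧ X.dis i ω ^ 2 ≤ C₃ * μ ^ 2} →
      ∫ ω in B, X.potential a (i + K) ω ∂P
        ≤ ∫ ω in B, X.potential a i ω ∂P - c2 δ σ * μ ^ 2 * K * P.real B := by
    intro i B hB hsub
    refine X.block_of_local hf hδ hμ (S := strictSaddle f δ σ τ π μ) ?_ hB
      (fun ω hω => (hsub hω).1) (fun ω hω => (hsub hω).2)
    intro x hx B' hB' hc hd
    obtain ⟨v, hv1, b, hb, hv⟩ := (hf.lambdaMin_le_iff hM x (-τ)).1 hx.2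
    have hvneg : v ∈ negEigenspace (hessian f x) :=
      Submodule.mem_iSup_of_mem b (Submodule.mem_iSup_of_mem (by linarith)
        (Module.End.mem_eigenspace_iff.2 hv))
    have hg : ‖gradient f x‖ ^ 4 ≤ Cg * μ ^ 2 :=
      norm_gradient_pow_four_le hμ hc2.le hπ hμδ' hx.1
    exact X.potential_block hf hρ hδ hσ hμ hμδ hθ0 hθ1.le ha0.le haμ haD hτ
      (lam := -b) (by linarith) hv1 (by rw [neg_neg]; exact hv) hQ (hX x hx v hvneg hv1) hg hC₄'
      (by rw [hC₄]; linarith [div_nonneg hD hθ.le]) hC₅.symm hs1 hs2 hs3 hκ' hK1 hK2 hB' hc hd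
  have hone : ∀ i B, MeasurableSet[X.ℱ i] B →
      B ⊆ {ω | X.c i ω ∉ smallGradient f δ σ π μ ∨ C₃ * μ ^ 2 ≤ X.dis i ω ^ 2} →
      ∫ ω in B, X.potential a (i + 1) ω ∂P
        ≤ ∫ ω in B, X.potential a i ω ∂P - c2 δ σ * μ ^ 2 * P.real B := fun i B hB hsub =>
    X.potential_step_of_large hf hδ hσ hμ hμδ hθ1.le ha0.le haμ haD hπ hπ1 hC₃'.ge i hB hsub
  have hVi := X.integrable_potential hf hδ.le a
  have hVsub : ∀ i (B : Set Ω), ∫ ω in B, (X.potential a i ω - m) ∂P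
      = ∫ ω in B, X.potential a i ω ∂P - m * P.real B := by
    intro i B
    rw [integral_sub (hVi i).integrableOn (integrable_const _), setIntegral_const_real]
  have hcm : ∀ i, Measurable[X.ℱ i] (X.c i) := fun i => (X.meas_c i).measurable
  have hdm : ∀ i, Measurable[X.ℱ i] (fun ω => X.dis i ω ^ 2) := fun i =>
    ((X.meas_dis i).pow 2).measurable
  have hmain := avoid_prob_le (P := P) (ℱ := X.ℱ) (V := fun i ω => X.potential a i ω - m)
    (G := fun i => {ω | X.c i ω ∉ smallGradient f δ σ π μ ∨ C₃ * μ ^ 2 ≤ X.dis i ω ^ 2})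
    (H := fun i => {ω | X.c i ω ∈ strictSaddle f δ σ τ π μ ∧ X.dis i ω ^ 2 ≤ C₃ * μ ^ 2})
    (S := fun i => {ω | X.c i ω ∈ secondOrder f δ σ τ π μ})
    (fun i => (hVi i).sub (integrable_const m))
    (fun i ω => by
      have h1 := hm (X.c i ω)
      have h2 : 0 ≤ a * X.dis i ω ^ 2 := by positivity
      simp only [potential]; linarith)
    (fun i => ((hcm i) (measurableSet_smallGradient hf σ π μ).compl).union
      ((hdm i) measurableSet_Ici))
    (fun i => ((hcm i) (measurableSet_strictSaddle hf hM hρ σ τ π μ)).inter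
      ((hdm i) measurableSet_Iic))
    (fun i => (hcm i) (measurableSet_secondOrder hf hM hρ σ τ π μ))
    (fun i ω => by
      by_cases h1 : X.c i ω ∈ smallGradient f δ σ π μ
      · rcases le_total (C₃ * μ ^ 2) (X.dis i ω ^ 2) with h2 | h2
        · exact Or.inl (Or.inr h2)
        · rcases le_or_gt (lambdaMin (hessian f (X.c i ω))) (-τ) with h3 | h3
          · exact Or.inr (Or.inl ⟨⟨h1, h3⟩, h2⟩)
          · exact Or.inr (Or.inr ⟨h1, h3⟩)
      · exact Or.inl (Or.inl h1))
    (q := c2 δ σ * μ ^ 2) (by positivity) (K := K) (by omega)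
    (fun i B hB hsub => by rw [hVsub, hVsub]; linarith [hone i B hB hsub])
    (fun i B hB hsub => by rw [hVsub, hVsub]; linarith [hblock i B hB hsub])
    n 0 (B := Set.univ) MeasurableSet.univ
  rw [hVsub] at hmain
  simp only [Set.univ_inter, zero_add, Measure.restrict_univ, probReal_univ, mul_one] at hmain
  refine le_trans (mul_le_mul_of_nonneg_right ?_ measureReal_nonneg) hmain
  gcongr

/-! ### The diffusion strategy as a perturbed gradient recursion -/

section Strategy

variable {N M : ℕ} {Ω : Type*} {mΩ : MeasurableSpace Ω} {P : Measure Ω}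
  {A : Matrix (Fin N) (Fin N) ℝ} {p : Fin N → ℝ} {J : Fin N → E M → ℝ} {δ G ρ μ σ : ℝ}
  {w0 : Fin N → E M} {g : ℕ → Fin N → E M → Ω → E M}

lemma iterate_succ_eq_mix (i : ℕ) (ω : Ω) :
    (fun k => iterate A μ w0 g (i + 1) k ω)
      = mix A (fun l => iterate A μ w0 g i l ω
          - μ • g (i + 1) l (iterate A μ w0 g i l ω) ω) := rfl

lemma gradient_add_noise (w : ℕ → Fin N → Ω → E M) (i : ℕ) (k : Fin N) (ω : Ω) :
    g (i + 1) k (w i k ω) ω = gradient (J k) (w i k ω) + noise J g w i k ω := by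
  simp [noise]

/-- The network centroid. -/
def networkCentroid (p : Fin N → ℝ) (w : ℕ → Fin N → Ω → E M) (i : ℕ) (ω : Ω) : E M :=
  centroid p (fun k => w i k ω)

/-- The aggregate noise `∑ p_k s_k`. -/
def networkNoise (p : Fin N → ℝ) (J : Fin N → E M → ℝ) (g : ℕ → Fin N → E M → Ω → E M)
    (w : ℕ → Fin N → Ω → E M) (i : ℕ) (ω : Ω) : E M :=
  ∑ k, p k • noise J g w i k ω

/-- The error made by evaluating the local gradients at the agents instead of the centroid. -/
def networkBias (p : Fin N → ℝ) (J : Fin N → E M → ℝ) (w : ℕ → Fin N → Ω → E M) (i : ℕ)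
    (ω : Ω) : E M :=
  ∑ k, p k • (gradient (J k) (w i k ω) - gradient (J k) (networkCentroid p w i ω))

lemma networkCentroid_step (hp : IsPerronVector A p) (hJ : ∀ k, Differentiable ℝ (J k))
    (i : ℕ) (ω : Ω) :
    networkCentroid p (iterate A μ w0 g) (i + 1) ω
      = networkCentroid p (iterate A μ w0 g) i ω
        - μ • (gradient (aggCost p J) (networkCentroid p (iterate A μ w0 g) i ω)
          + networkBias p J (iterate A μ w0 g) i ω
          + networkNoise p J g (iterate A μ w0 g) i ω) := by
  have h1 : networkCentroid p (iterate A μ w0 g) (i + 1) ω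
      = centroid p (fun l => iterate A μ w0 g i l ω
          - μ • g (i + 1) l (iterate A μ w0 g i l ω) ω) := by
    rw [networkCentroid, iterate_succ_eq_mix, centroid_mix hp]
  rw [h1, gradient_aggCost p hJ, networkBias, networkNoise, ← Finset.sum_add_distrib,
    ← Finset.sum_add_distrib]
  simp only [gradient_add_noise (J := J), centroid, networkCentroid, smul_sub,
    Finset.sum_sub_distrib, Finset.smul_sum, smul_add, Finset.sum_add_distrib]
  simp only [smul_comm μ]
  abel

lemma norm_networkBias_le (hp : IsPerronVector A p) (hJ : CostConditions J δ G ρ) (hδ : 0 ≤ δ)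
    (L : DisagreementGauge A p M) (w : ℕ → Fin N → Ω → E M) (i : ℕ) (ω : Ω) :
    ‖networkBias p J w i ω‖ ≤ δ * L.gauge (fun k => w i k ω) := by
  refine norm_sum_smul_le (fun k => (hp.pos k).le) hp.sum_one _ fun k => ?_
  refine (hJ.lipschitz_gradient k _ _).trans (mul_le_mul_of_nonneg_left ?_ hδ)
  exact L.norm_sub_centroid_le (fun k => w i k ω) k

/-- The disagreement contracts in each step, up to the step-size times the dispersion of the
stochastic gradients. -/
lemma gauge_step_le (hp : IsPerronVector A p) (hJ : CostConditions J δ G ρ) (hδ : 0 ≤ δ)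
    (hμ : 0 < μ) (L : DisagreementGauge A p M)
    (hμL : L.bound * μ * N * δ ≤ (1 - L.rate) / 2) (i : ℕ) (ω : Ω) :
    L.gauge (fun k => iterate A μ w0 g (i + 1) k ω)
      ≤ (1 + L.rate) / 2 * L.gauge (fun k => iterate A μ w0 g i k ω)
        + μ * L.bound * ∑ k, (G + ‖noise J g (iterate A μ w0 g) i k ω‖) := by
  have := hp.nonempty
  set w := iterate A μ w0 g with hw
  set x : Fin N → E M := fun k => w i k ω with hx
  set c := centroid p x with hc
  set y : Fin N → E M := fun l => -(μ • g (i + 1) l (x l) ω) with hy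
  have hL0 := L.nonneg x
  have h1 : L.gauge (fun k => w (i + 1) k ω) ≤ L.rate * L.gauge (x + y) := by
    have h : (fun k => w (i + 1) k ω) = mix A (x + y) := by
      rw [hw, iterate_succ_eq_mix, hx, hy]
      simp only [sub_eq_add_neg]
      rfl
    rw [h]
    exact L.mix_le _
  have h2 : ∀ k, ‖y k - -(μ • gradient (aggCost p J) c)‖
      ≤ μ * (δ * L.gauge x + (G + ‖noise J g w i k ω‖)) := by
    intro k
    have e1 : y k - -(μ • gradient (aggCost p J) c)
        = -(μ • ((gradient (J k) (x k) - gradient (J k) c)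
          + (gradient (J k) c - gradient (aggCost p J) c) + noise J g w i k ω)) := by
      have := gradient_add_noise (J := J) (g := g) w i k ω
      simp only [hy]
      rw [show g (i + 1) k (x k) ω = gradient (J k) (x k) + noise J g w i k ω from this]
      simp only [smul_add, smul_sub]
      abel
    rw [e1, norm_neg, norm_smul, Real.norm_of_nonneg hμ.le]
    refine mul_le_mul_of_nonneg_left ?_ hμ.le
    have e2 : ‖gradient (J k) (x k) - gradient (J k) c‖ ≤ δ * L.gauge x :=
      (hJ.lipschitz_gradient k _ _).trans
        (mul_le_mul_of_nonneg_left (L.norm_sub_centroid_le x k) hδ)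
    have e3 : ‖gradient (J k) c - gradient (aggCost p J) c‖ ≤ G := by
      have e4 : gradient (J k) c - gradient (aggCost p J) c
          = ∑ l, p l • (gradient (J k) c - gradient (J l) c) := by
        rw [gradient_aggCost p hJ.differentiable]
        simp [smul_sub, Finset.sum_sub_distrib, ← Finset.sum_smul, hp.sum_one]
      rw [e4]
      exact norm_sum_smul_le (fun k => (hp.pos k).le) hp.sum_one _
        fun l => hJ.bounded_disagreement k l c
    calc _ ≤ ‖gradient (J k) (x k) - gradient (J k) c‖
          + ‖gradient (J k) c - gradient (aggCost p J) c‖ + ‖noise J g w i k ω‖ := norm_add₃_le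
      _ ≤ _ := by linarith
  have h3 : L.gauge y ≤ L.bound * (μ * (N * (δ * L.gauge x)
      + ∑ k, (G + ‖noise J g w i k ω‖))) := by
    refine (L.le_sum y (-(μ • gradient (aggCost p J) c))).trans ?_
    refine mul_le_mul_of_nonneg_left ((Finset.sum_le_sum fun k _ => h2 k).trans (le_of_eq ?_))
      L.bound_pos.le
    rw [← Finset.mul_sum, Finset.sum_add_distrib]
    simp
  have hy0 : 0 ≤ L.gauge y := L.nonneg y
  have h4 : L.rate * L.gauge y ≤ L.gauge y := mul_le_of_le_one_left hy0 L.rate_lt_one.le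
  have h5 := mul_le_mul_of_nonneg_left (L.add_le x y) L.rate_pos.le
  have h6 := mul_le_mul_of_nonneg_right hμL hL0
  linarith

lemma measurable_noise {w : ℕ → Fin N → Ω → E M}
    (hJ : CostConditions J δ G ρ) (hg : ∀ i k, Measurable fun ω => g (i + 1) k (w i k ω) ω)
    (hw : ∀ i k, Measurable (w i k)) (i : ℕ) (k : Fin N) : Measurable (noise J g w i k) :=
  (hg i k).sub ((hJ.differentiable_gradient k).continuous.measurable.comp (hw i k))

lemma measurable_iterate
    (hg : ∀ i k, Measurable fun ω => g (i + 1) k (iterate A μ w0 g i k ω) ω) (i : ℕ)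
    (k : Fin N) : Measurable (iterate A μ w0 g i k) := by
  induction i generalizing k with
  | zero => exact measurable_const
  | succ i ih =>
    exact Finset.measurable_sum _ fun l _ =>
      ((ih l).sub ((hg i l).const_smul μ)).const_smul (A l k)

lemma NoiseConditions.memLp_noise (hN : NoiseConditions P J g (iterate A μ w0 g) σ)
    (hJ : CostConditions J δ G ρ) (i : ℕ) (k : Fin N) :
    MemLp (noise J g (iterate A μ w0 g) i k) 4 P := by
  rw [← integrable_norm_rpow_iff
    (measurable_noise hJ hN.measurable (measurable_iterate hN.measurable)
      i k).aestronglyMeasurable (by norm_num) (by norm_num)]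
  have h : (4 : ENNReal).toReal = ((4 : ℕ) : ℝ) := by norm_num
  rw [h]
  simpa only [Real.rpow_natCast] using hN.integrable i k

variable [IsProbabilityMeasure P]

lemma memLp_gradient_comp (hJ : CostConditions J δ G ρ) (k : Fin N) {u : Ω → E M}
    (hu : MemLp u 4 P) : MemLp (fun ω => gradient (J k) (u ω)) 4 P := by
  have h0 : MemLp (fun ω => δ * ‖u ω‖) 4 P := hu.norm.const_mul δ
  have h1 : MemLp ((fun _ => ‖gradient (J k) 0‖) + fun ω => δ * ‖u ω‖) 4 P :=
    (memLp_const ‖gradient (J k) 0‖).add h0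
  refine h1.mono' ((hJ.differentiable_gradient k).continuous.comp_aestronglyMeasurable hu.1)
    (Filter.Eventually.of_forall fun ω => ?_)
  have h2 := hJ.lipschitz_gradient k (u ω) 0
  have h3 := norm_sub_norm_le (gradient (J k) (u ω)) (gradient (J k) 0)
  rw [sub_zero] at h2
  simp only [Pi.add_apply]
  linarith

lemma NoiseConditions.memLp_iterate (hN : NoiseConditions P J g (iterate A μ w0 g) σ)
    (hJ : CostConditions J δ G ρ) (i : ℕ) (k : Fin N) :
    MemLp (iterate A μ w0 g i k) 4 P := by
  induction i generalizing k with
  | zero => exact memLp_const (w0 k)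
  | succ i ih =>
    refine memLp_finsetSum _ fun l _ => ?_
    have h1 : MemLp (fun ω => g (i + 1) l (iterate A μ w0 g i l ω) ω) 4 P := by
      simp only [gradient_add_noise (J := J)]
      exact (memLp_gradient_comp hJ l (ih l)).add (hN.memLp_noise hJ i l)
    exact ((ih l).sub (h1.const_smul μ)).const_smul (A l k)

lemma measurable_past (w : ℕ → Fin N → Ω → E M) {i j : ℕ} (hj : j ≤ i) (k : Fin N) :
    Measurable[past w i] (w j k) := by
  rw [measurable_iff_comap_le]
  exact le_iSup_of_le j (le_iSup_of_le hj (le_iSup_of_le k le_rfl))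

/-- The filtration generated by the iterates. -/
def pastFiltration (w : ℕ → Fin N → Ω → E M) (hw : ∀ i k, Measurable (w i k)) :
    Filtration ℕ mΩ where
  seq := past w
  mono' := fun _ _ hij => iSup_mono fun _ => iSup_mono' fun hk => ⟨hk.trans hij, le_rfl⟩
  le' := fun _ => iSup_le fun j => iSup_le fun _ => iSup_le fun k => (hw j k).comap_le

lemma past_le {w : ℕ → Fin N → Ω → E M} (hw : ∀ i k, Measurable (w i k)) (i : ℕ) :
    past w i ≤ mΩ := (pastFiltration w hw).le i

lemma NoiseConditions.setIntegral_noise_four_le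
    (hN : NoiseConditions P J g (iterate A μ w0 g) σ) (i : ℕ) (k : Fin N) {B : Set Ω}
    (hB : MeasurableSet[past (iterate A μ w0 g) i] B) :
    ∫ ω in B, ‖noise J g (iterate A μ w0 g) i k ω‖ ^ 4 ∂P ≤ σ ^ 4 * P.real B := by
  rw [← setIntegral_condExp (past_le (measurable_iterate hN.measurable) i) (hN.integrable i k) hB,
    ← setIntegral_const_real]
  exact integral_mono_ae integrable_condExp.integrableOn (integrable_const _)
    (ae_restrict_of_ae (hN.fourth_moment i k))

lemma NoiseConditions.networkNoise_four_le (hN : NoiseConditions P J g (iterate A μ w0 g) σ)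
    (hp : IsPerronVector A p) (hJ : CostConditions J δ G ρ) (i : ℕ) {B : Set Ω}
    (hB : MeasurableSet[past (iterate A μ w0 g) i] B) :
    ∫ ω in B, ‖networkNoise p J g (iterate A μ w0 g) i ω‖ ^ 4 ∂P ≤ σ ^ 4 * P.real B := by
  have hs : MemLp (networkNoise p J g (iterate A μ w0 g) i) 4 P :=
    memLp_finsetSum _ fun k _ => (hN.memLp_noise hJ i k).const_smul (p k)
  have i1 : ∀ k ∈ Finset.univ, Integrable
      (fun ω => p k * ‖noise J g (iterate A μ w0 g) i k ω‖ ^ 4) (P.restrict B) := fun k _ =>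
    ((hN.integrable i k).integrableOn (s := B)).const_mul (p k)
  calc ∫ ω in B, ‖networkNoise p J g (iterate A μ w0 g) i ω‖ ^ 4 ∂P
      ≤ ∫ ω in B, ∑ k, p k * ‖noise J g (iterate A μ w0 g) i k ω‖ ^ 4 ∂P := by
        refine integral_mono hs.integrable_norm_pow_four.integrableOn (integrable_finsetSum _ i1)
          fun ω => ?_
        refine le_trans ?_ (Real.pow_arith_mean_le_arith_mean_pow Finset.univ p
          (fun k => ‖noise J g (iterate A μ w0 g) i k ω‖) (fun k _ => (hp.pos k).le) hp.sum_one
          (fun k _ => norm_nonneg _) 4)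
        refine pow_le_pow_left₀ (norm_nonneg _) ((norm_sum_le _ _).trans
          (Finset.sum_le_sum fun k _ => ?_)) 4
        rw [norm_smul, Real.norm_of_nonneg (hp.pos k).le]
    _ = ∑ k, p k * ∫ ω in B, ‖noise J g (iterate A μ w0 g) i k ω‖ ^ 4 ∂P := by
        rw [integral_finsetSum _ i1]
        simp only [integral_const_mul]
    _ ≤ ∑ k, p k * (σ ^ 4 * P.real B) := Finset.sum_le_sum fun k _ =>
        mul_le_mul_of_nonneg_left (hN.setIntegral_noise_four_le i k hB) (hp.pos k).le
    _ = σ ^ 4 * P.real B := by rw [← Finset.sum_mul, hp.sum_one, one_mul]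

lemma NoiseConditions.networkNoise_mean (hN : NoiseConditions P J g (iterate A μ w0 g) σ)
    (hJ : CostConditions J δ G ρ) (i : ℕ) :
    P[networkNoise p J g (iterate A μ w0 g) i | past (iterate A μ w0 g) i] =ᵐ[P] 0 := by
  have h1 : networkNoise p J g (iterate A μ w0 g) i
      = ∑ k, p k • noise J g (iterate A μ w0 g) i k := by
    funext ω; simp [networkNoise]
  rw [h1]
  refine (condExp_finsetSum (fun k _ =>
    ((hN.memLp_noise hJ i k).integrable (by norm_num)).smul (p k)) _).trans ?_
  have h2 : ∀ k, P[p k • noise J g (iterate A μ w0 g) i k | past (iterate A μ w0 g) i]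
      =ᵐ[P] 0 := by
    intro k
    refine (condExp_smul (p k) _ _).trans ?_
    filter_upwards [hN.zero_mean i k] with ω hω
    simp [hω]
  filter_upwards [ae_all_iff.2 h2] with ω hω
  simp [hω]

/-- The mean fourth power of the dispersion of the stochastic gradients. -/
lemma NoiseConditions.dispersion_four_le [Nonempty (Fin N)]
    (hN : NoiseConditions P J g (iterate A μ w0 g) σ)
    (hJ : CostConditions J δ G ρ) (hG : 0 ≤ G) (i : ℕ) {B : Set Ω}
    (hB : MeasurableSet[past (iterate A μ w0 g) i] B) :
    ∫ ω in B, (∑ k, (G + ‖noise J g (iterate A μ w0 g) i k ω‖)) ^ 4 ∂P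
      ≤ 8 * (N : ℝ) ^ 4 * (G ^ 4 + σ ^ 4) * P.real B := by
  have i0 : ∀ k, IntegrableOn (fun ω => ‖noise J g (iterate A μ w0 g) i k ω‖ ^ 4) B P :=
    fun k => (hN.integrable i k).integrableOn
  have i1 : ∀ k ∈ Finset.univ, Integrable
      (fun ω => G ^ 4 + ‖noise J g (iterate A μ w0 g) i k ω‖ ^ 4) (P.restrict B) := fun k _ =>
    (integrable_const _).add (i0 k)
  have hpt : ∀ ω, (∑ k, (G + ‖noise J g (iterate A μ w0 g) i k ω‖)) ^ 4
      ≤ 8 * (N : ℝ) ^ 3 * ∑ k, (G ^ 4 + ‖noise J g (iterate A μ w0 g) i k ω‖ ^ 4) := by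
    intro ω
    have hn : ∀ k, 0 ≤ G + ‖noise J g (iterate A μ w0 g) i k ω‖ := fun k =>
      add_nonneg hG (norm_nonneg _)
    have h1 := pow_sum_div_card_le_sum_pow (s := Finset.univ) (fun k _ => hn k) 3
    have hN0 : (0 : ℝ) < (Finset.univ : Finset (Fin N)).card := by
      exact_mod_cast Finset.card_pos.2 Finset.univ_nonempty
    rw [div_le_iff₀ (by positivity), Finset.card_univ, Fintype.card_fin] at h1
    have h2 : ∀ k, (G + ‖noise J g (iterate A μ w0 g) i k ω‖) ^ (3 + 1)
        ≤ 8 * (G ^ 4 + ‖noise J g (iterate A μ w0 g) i k ω‖ ^ 4) := by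
      intro k
      have h := weighted_add_pow_four_le (a := 1) (b := 1) (x := G)
        (y := ‖noise J g (iterate A μ w0 g) i k ω‖) zero_le_one zero_le_one
      norm_num at h ⊢
      exact h
    calc _ ≤ _ := h1
      _ ≤ (∑ k, 8 * (G ^ 4 + ‖noise J g (iterate A μ w0 g) i k ω‖ ^ 4)) * (N : ℝ) ^ 3 := by
          gcongr with k
          exact h2 k
      _ = _ := by rw [← Finset.mul_sum]; ring
  have hint : IntegrableOn
      (fun ω => (∑ k, (G + ‖noise J g (iterate A μ w0 g) i k ω‖)) ^ 4) B P := by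
    have hm : Measurable
        (fun ω => (∑ k, (G + ‖noise J g (iterate A μ w0 g) i k ω‖)) ^ 4) :=
      (Finset.measurable_sum _ fun k _ => (measurable_noise hJ hN.measurable
        (measurable_iterate hN.measurable) i k).norm.const_add G).pow_const 4
    refine Integrable.mono' ((integrable_finsetSum _ i1).const_mul (8 * (N : ℝ) ^ 3))
      hm.aestronglyMeasurable (Filter.Eventually.of_forall fun ω => ?_)
    rw [Real.norm_of_nonneg (by positivity)]
    exact hpt ω
  calc _ ≤ ∫ ω in B, 8 * (N : ℝ) ^ 3
          * ∑ k, (G ^ 4 + ‖noise J g (iterate A μ w0 g) i k ω‖ ^ 4) ∂P :=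
        integral_mono hint ((integrable_finsetSum _ i1).const_mul _) hpt
    _ = 8 * (N : ℝ) ^ 3 * ∑ k, (G ^ 4 * P.real B
          + ∫ ω in B, ‖noise J g (iterate A μ w0 g) i k ω‖ ^ 4 ∂P) := by
        rw [integral_const_mul, integral_finsetSum _ i1]
        congr 1
        refine Finset.sum_congr rfl fun k _ => ?_
        rw [integral_add (integrable_const _) (i0 k), setIntegral_const_real]
    _ ≤ 8 * (N : ℝ) ^ 3 * ∑ _k : Fin N, (G ^ 4 * P.real B + σ ^ 4 * P.real B) := by
        gcongr with k
        exact hN.setIntegral_noise_four_le i k hB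
    _ = _ := by simp; ring

/-- The constant in the recursions for the moments of the disagreement. -/
def DisagreementGauge.moment (L : DisagreementGauge A p M) (G σ : ℝ) : ℝ :=
  2 * L.bound ^ 2 / (1 - L.rate) * (1 + 8 * (N : ℝ) ^ 4 * (G ^ 4 + σ ^ 4))
    + 8 * L.bound ^ 4 / (1 - L.rate) ^ 3 * (8 * (N : ℝ) ^ 4 * (G ^ 4 + σ ^ 4))

lemma DisagreementGauge.moment_nonneg (L : DisagreementGauge A p M) (G σ : ℝ) :
    0 ≤ L.moment G σ := by
  have h1 := sub_pos.2 L.rate_lt_one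
  have h2 := L.bound_pos
  have h3 : 0 ≤ G ^ 4 + σ ^ 4 := by positivity
  rw [DisagreementGauge.moment]
  positivity

lemma DisagreementGauge.memLp (L : DisagreementGauge A p M) {x : Fin N → Ω → E M}
    (hx : ∀ k, MemLp (x k) 4 P) : MemLp (fun ω => L.gauge (fun k => x k ω)) 4 P := by
  by_cases hN : Nonempty (Fin N)
  · have h1 : MemLp (fun ω => L.bound * ∑ k, ‖x k ω‖) 4 P :=
      (memLp_finsetSum Finset.univ fun k _ => (hx k).norm).const_mul L.bound
    refine h1.mono' (L.continuous.comp_aestronglyMeasurable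
      (aemeasurable_pi_lambda _ fun k => (hx k).1.aemeasurable).aestronglyMeasurable)
      (Filter.Eventually.of_forall fun ω => ?_)
    rw [Real.norm_of_nonneg (L.nonneg _)]
    simpa using L.le_sum (fun k => x k ω) 0
  · have : IsEmpty (Fin N) := not_nonempty_iff.1 hN
    have h : (fun ω => L.gauge (fun k => x k ω)) = fun _ => L.gauge (fun k => isEmptyElim k) := by
      funext ω; congr 1; funext k; exact isEmptyElim k
    rw [h]
    exact memLp_const _

lemma NoiseConditions.gauge_moments (hN : NoiseConditions P J g (iterate A μ w0 g) σ)
    (hp : IsPerronVector A p) (hJ : CostConditions J δ G ρ) (hδ : 0 ≤ δ) (hG : 0 ≤ G)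
    (hμ : 0 < μ) (L : DisagreementGauge A p M)
    (hμL : L.bound * μ * N * δ ≤ (1 - L.rate) / 2) (i : ℕ) {B : Set Ω}
    (hB : MeasurableSet[past (iterate A μ w0 g) i] B) :
    (∫ ω in B, L.gauge (fun k => iterate A μ w0 g (i + 1) k ω) ^ 2 ∂P
      ≤ (1 + L.rate) / 2 * ∫ ω in B, L.gauge (fun k => iterate A μ w0 g i k ω) ^ 2 ∂P
        + L.moment G σ * μ ^ 2 * P.real B) ∧
    ∫ ω in B, L.gauge (fun k => iterate A μ w0 g (i + 1) k ω) ^ 4 ∂P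
      ≤ (1 + L.rate) / 2 * ∫ ω in B, L.gauge (fun k => iterate A μ w0 g i k ω) ^ 4 ∂P
        + L.moment G σ * μ ^ 4 * P.real B := by
  have := hp.nonempty
  have hr := sub_pos.2 L.rate_lt_one
  have hr0 := L.rate_pos
  have hb0 := L.bound_pos
  set ℓ : ℕ → Ω → ℝ := fun i ω => L.gauge (fun k => iterate A μ w0 g i k ω) with hℓ
  set Z : Ω → ℝ := fun ω => ∑ k, (G + ‖noise J g (iterate A μ w0 g) i k ω‖) with hZ
  have hZ0 : ∀ ω, 0 ≤ Z ω := fun ω =>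
    Finset.sum_nonneg fun k _ => add_nonneg hG (norm_nonneg _)
  have hℓ0 : ∀ i ω, 0 ≤ ℓ i ω := fun i ω => L.nonneg _
  have hℓm : ∀ i, MemLp (ℓ i) 4 P := fun i => L.memLp fun k => hN.memLp_iterate hJ i k
  have hZm : MemLp Z 4 P := memLp_finsetSum _ fun k _ =>
    (memLp_const G).add (hN.memLp_noise hJ i k).norm
  have hZ4 : Integrable (fun ω => Z ω ^ 4) P := by
    refine hZm.integrable_norm_pow_four.congr (Filter.Eventually.of_forall fun ω => ?_)
    simp only [Real.norm_of_nonneg (hZ0 ω)]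
  have hℓ4 : ∀ i, Integrable (fun ω => ℓ i ω ^ 4) P := fun i => by
    refine (hℓm i).integrable_norm_pow_four.congr (Filter.Eventually.of_forall fun ω => ?_)
    simp only [Real.norm_of_nonneg (hℓ0 i ω)]
  have hℓ2 : ∀ i, Integrable (fun ω => ℓ i ω ^ 2) P := fun i => by
    simpa using (hℓm i).integrable_norm_sq_of_four
  set C : ℝ := 8 * (N : ℝ) ^ 4 * (G ^ 4 + σ ^ 4) with hC
  have hC0 : 0 ≤ C := by positivity
  have hP : 0 ≤ P.real B := measureReal_nonneg
  have hZi : ∫ ω in B, Z ω ^ 4 ∂P ≤ C * P.real B := hN.dispersion_four_le hJ hG i hB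
  set θ : ℝ := (1 + L.rate) / 2 with hθ
  have hθ0 : 0 < θ := by positivity
  have hθ1 : 0 < 1 - θ := by rw [hθ]; linarith
  have hθr : 1 - θ = (1 - L.rate) / 2 := by rw [hθ]; ring
  -- the new disagreement is a convex combination of the old one and of `b Z`
  set b : ℝ := μ * L.bound / (1 - θ) with hb
  have hbb : 0 ≤ b := by positivity
  have hbθ : (1 - θ) * b = μ * L.bound := mul_div_cancel₀ _ hθ1.ne'
  have hpt : ∀ ω, ℓ (i + 1) ω ≤ θ * ℓ i ω + (1 - θ) * (b * Z ω) := by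
    intro ω
    rw [← mul_assoc, hbθ]
    exact gauge_step_le hp hJ hδ hμ L hμL i ω
  have hpt4 : ∀ ω, ℓ (i + 1) ω ^ 4 ≤ θ * ℓ i ω ^ 4 + (1 - θ) * b ^ 4 * Z ω ^ 4 := by
    intro ω
    refine (pow_le_pow_left₀ (hℓ0 _ _) (hpt ω) 4).trans
      ((weighted_add_pow_four_le hθ0.le hθ1.le).trans (le_of_eq ?_))
    rw [add_sub_cancel, mul_pow]; ring
  have hpt2 : ∀ ω, ℓ (i + 1) ω ^ 2 ≤ θ * ℓ i ω ^ 2 + (1 - θ) * b ^ 2 * (1 + Z ω ^ 4) := by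
    intro ω
    have h1 := pow_le_pow_left₀ (hℓ0 _ _) (hpt ω) 2
    have h2 : (θ * ℓ i ω + (1 - θ) * (b * Z ω)) ^ 2
        = θ * ℓ i ω ^ 2 + (1 - θ) * (b * Z ω) ^ 2 - θ * (1 - θ) * (ℓ i ω - b * Z ω) ^ 2 := by
      ring
    have h3 : 0 ≤ θ * (1 - θ) * (ℓ i ω - b * Z ω) ^ 2 := by positivity
    have h4 : Z ω ^ 2 ≤ 1 + Z ω ^ 4 := by nlinarith [sq_nonneg (Z ω ^ 2 - 1), sq_nonneg (Z ω ^ 2)]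
    have h5 : (1 - θ) * b ^ 2 * Z ω ^ 2 ≤ (1 - θ) * b ^ 2 * (1 + Z ω ^ 4) := by gcongr
    rw [mul_pow] at h2
    linarith
  have e2 : (1 - θ) * b ^ 2 = 2 * L.bound ^ 2 / (1 - L.rate) * μ ^ 2 := by
    rw [hb, hθr]; field_simp
  have e4 : (1 - θ) * b ^ 4 = 8 * L.bound ^ 4 / (1 - L.rate) ^ 3 * μ ^ 4 := by
    rw [hb, hθr]; field_simp; norm_num
  have hmom : L.moment G σ = 2 * L.bound ^ 2 / (1 - L.rate) * (1 + C)
    + 8 * L.bound ^ 4 / (1 - L.rate) ^ 3 * C := rfl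
  have hone : IntegrableOn (fun _ : Ω => (1 : ℝ)) B P := integrable_const _
  constructor
  · have h := integral_mono (hℓ2 (i + 1)).integrableOn
      (((hℓ2 i).integrableOn (s := B)).const_mul θ |>.add
        ((hone.add hZ4.integrableOn).const_mul ((1 - θ) * b ^ 2))) hpt2
    rw [integral_add' (((hℓ2 i).integrableOn (s := B)).const_mul θ)
      ((hone.add hZ4.integrableOn).const_mul ((1 - θ) * b ^ 2)), integral_const_mul,
      integral_const_mul, integral_add' hone hZ4.integrableOn, setIntegral_const_real, e2] at h
    refine h.trans ?_
    rw [hmom]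
    have h1 : 2 * L.bound ^ 2 / (1 - L.rate) * μ ^ 2 * (1 * P.real B + ∫ ω in B, Z ω ^ 4 ∂P)
        ≤ 2 * L.bound ^ 2 / (1 - L.rate) * μ ^ 2 * (1 * P.real B + C * P.real B) := by gcongr
    have h2 : 0 ≤ 8 * L.bound ^ 4 / (1 - L.rate) ^ 3 * C * μ ^ 2 * P.real B := by positivity
    linarith
  · have h := integral_mono (hℓ4 (i + 1)).integrableOn
      (((hℓ4 i).integrableOn (s := B)).const_mul θ |>.add
        (hZ4.integrableOn.const_mul ((1 - θ) * b ^ 4))) hpt4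
    rw [integral_add' (((hℓ4 i).integrableOn (s := B)).const_mul θ)
      (hZ4.integrableOn.const_mul ((1 - θ) * b ^ 4)), integral_const_mul,
      integral_const_mul, e4] at h
    refine h.trans ?_
    rw [hmom]
    have h1 : 8 * L.bound ^ 4 / (1 - L.rate) ^ 3 * μ ^ 4 * ∫ ω in B, Z ω ^ 4 ∂P
        ≤ 8 * L.bound ^ 4 / (1 - L.rate) ^ 3 * μ ^ 4 * (C * P.real B) := by gcongr
    have h2 : 0 ≤ 2 * L.bound ^ 2 / (1 - L.rate) * (1 + C) * μ ^ 4 * P.real B := by positivity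
    linarith

/-- The centroid of the diffusion strategy follows a perturbed stochastic gradient recursion for the
aggregate cost, whose bias is controlled by the disagreement gauge. -/
def strategyDescent (hN : NoiseConditions P J g (iterate A μ w0 g) σ)
    (hp : IsPerronVector A p) (hJ : CostConditions J δ G ρ) (hδ : 0 ≤ δ) (hG : 0 ≤ G)
    (hμ : 0 < μ) (L : DisagreementGauge A p M)
    (hμL : L.bound * μ * N * δ ≤ (1 - L.rate) / 2) :
    NoisyDescent P (aggCost p J) μ δ σ ((1 + L.rate) / 2) (L.moment G σ) :=
  have hm : ∀ i k, StronglyMeasurable[past (iterate A μ w0 g) i] (iterate A μ w0 g i k) :=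
    fun _ k => (measurable_past _ le_rfl k).stronglyMeasurable
  have hmc : ∀ i, StronglyMeasurable[past (iterate A μ w0 g) i]
      (networkCentroid p (iterate A μ w0 g) i) := fun i =>
    Finset.stronglyMeasurable_fun_sum (f := fun k ω => p k • iterate A μ w0 g i k ω)
      Finset.univ fun k _ => (hm i k).const_smul (p k)
  have hc4 : ∀ i, MemLp (networkCentroid p (iterate A μ w0 g) i) 4 P := fun i =>
    memLp_finsetSum (f := fun k ω => p k • iterate A μ w0 g i k ω)
      Finset.univ fun k _ => (hN.memLp_iterate hJ i k).const_smul (p k)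
  { ℱ := pastFiltration (iterate A μ w0 g) (measurable_iterate hN.measurable)
    c := networkCentroid p (iterate A μ w0 g)
    d := networkBias p J (iterate A μ w0 g)
    s := networkNoise p J g (iterate A μ w0 g)
    dis := fun i ω => L.gauge (fun k => iterate A μ w0 g i k ω)
    meas_c := hmc
    meas_d := fun i => Finset.stronglyMeasurable_fun_sum _ fun k _ =>
      (((hJ.differentiable_gradient k).continuous.comp_stronglyMeasurable (hm i k)).sub
        ((hJ.differentiable_gradient k).continuous.comp_stronglyMeasurable
          (hmc i))).const_smul (p k)
    meas_dis := fun i => L.continuous.comp_stronglyMeasurable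
      (@measurable_pi_lambda Ω (Fin N) (fun _ => E M) (past (iterate A μ w0 g) i) _ _
        fun k => measurable_past (iterate A μ w0 g) le_rfl k).stronglyMeasurable
    memLp_c := hc4
    memLp_d := fun i => memLp_finsetSum _ fun k _ =>
      ((memLp_gradient_comp hJ k (hN.memLp_iterate hJ i k)).sub
        (memLp_gradient_comp hJ k (hc4 i))).const_smul (p k)
    memLp_s := fun i => memLp_finsetSum _ fun k _ =>
      (hN.memLp_noise hJ i k).const_smul (p k)
    memLp_dis := fun i => L.memLp fun k => hN.memLp_iterate hJ i k
    step := networkCentroid_step hp hJ.differentiable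
    norm_d_le := norm_networkBias_le hp hJ hδ L _
    dis_nonneg := fun _ _ => have := hp.nonempty; L.nonneg _
    dis_sq_le := fun i _ hB => (hN.gauge_moments hp hJ hδ hG hμ L hμL i hB).1
    dis_four_le := fun i _ hB => (hN.gauge_moments hp hJ hδ hG hμ L hμL i hB).2
    noise_mean := hN.networkNoise_mean hJ
    noise_four_le := fun i _ hB => hN.networkNoise_four_le hp hJ i hB }

/-- A Hölder modulus of exponent `γ ≤ 4` is dominated by an arbitrarily small constant plus a
multiple of the fourth power. -/
lemma exists_rpow_le_add_pow_four (β : ℝ) {γ ε : ℝ} (hγ : 0 < γ) (hγ4 : γ ≤ 4) (hε : 0 < ε) :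
    ∃ Q : ℝ, 0 ≤ Q ∧ ∀ t : ℝ, 0 ≤ t → β * t ^ γ ≤ ε + Q * t ^ 4 := by
  set h : ℝ := (ε / (|β| + 1)) ^ γ⁻¹ with hh
  have hb : 0 < |β| + 1 := by positivity
  have h0 : 0 < h := Real.rpow_pos_of_pos (by positivity) _
  have hhγ : h ^ γ = ε / (|β| + 1) := Real.rpow_inv_rpow (by positivity) hγ.ne'
  refine ⟨|β| * h ^ (γ - 4), by positivity, fun t ht => ?_⟩
  have hβt : β * t ^ γ ≤ |β| * t ^ γ :=
    mul_le_mul_of_nonneg_right (le_abs_self β) (Real.rpow_nonneg ht γ)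
  rcases le_total t h with hth | hth
  · have h1 : t ^ γ ≤ ε / (|β| + 1) := by
      rw [← hhγ]; exact Real.rpow_le_rpow ht hth hγ.le
    have h2 : |β| * t ^ γ ≤ ε := by
      calc |β| * t ^ γ ≤ (|β| + 1) * (ε / (|β| + 1)) := by gcongr; linarith
        _ = ε := by field_simp
    have h3 : 0 ≤ |β| * h ^ (γ - 4) * t ^ 4 := by positivity
    linarith
  · have ht0 : 0 < t := h0.trans_le hth
    have h1 : t ^ γ = t ^ (γ - 4) * t ^ 4 := by
      rw [← Real.rpow_natCast t 4, ← Real.rpow_add ht0]; norm_num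
    have h2 : t ^ (γ - 4) ≤ h ^ (γ - 4) := Real.rpow_le_rpow_of_nonpos h0 hth (by linarith)
    have h3 : |β| * t ^ γ ≤ |β| * h ^ (γ - 4) * t ^ 4 := by
      rw [h1, mul_assoc]; gcongr
    linarith

/-- Since the noises of different agents are uncorrelated, the variance of the aggregate noise along
`v` is the aggregate covariance at the agents' positions. -/
lemma setIntegral_networkNoise_sq (hN : NoiseConditions P J g (iterate A μ w0 g) σ)
    (hJ : CostConditions J δ G ρ) {R : Fin N → E M → E M →L[ℝ] E M}
    (hR : IsNoiseCovariance P J g (iterate A μ w0 g) R) (v : E M) (i : ℕ) {B : Set Ω}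
    (hB : MeasurableSet[past (iterate A μ w0 g) i] B) :
    ∫ ω in B, ⟪networkNoise p J g (iterate A μ w0 g) i ω, v⟫_ℝ ^ 2 ∂P
      = ∑ k, p k ^ 2 * ∫ ω in B, ⟪R k (iterate A μ w0 g i k ω) v, v⟫_ℝ ∂P := by
  set w := iterate A μ w0 g with hw
  have hle := past_le (measurable_iterate hN.measurable) i
  have hint : ∀ k l, Integrable
      (fun ω => ⟪noise J g w i k ω, v⟫_ℝ * ⟪noise J g w i l ω, v⟫_ℝ) P := by
    intro k l
    have h1 : MemLp (fun ω => ⟪noise J g w i k ω, v⟫_ℝ) 4 P :=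
      (hN.memLp_noise hJ i k).inner_const v
    have h2 : MemLp (fun ω => ⟪noise J g w i l ω, v⟫_ℝ) 4 P :=
      (hN.memLp_noise hJ i l).inner_const v
    refine (h1.integrable_norm_sq_of_four.add h2.integrable_norm_sq_of_four).mono'
      (h1.1.mul h2.1) (Filter.Eventually.of_forall fun ω => ?_)
    rw [norm_mul, Pi.add_apply]
    nlinarith [sq_nonneg (‖⟪noise J g w i k ω, v⟫_ℝ‖ - ‖⟪noise J g w i l ω, v⟫_ℝ‖),
      sq_nonneg ‖⟪noise J g w i k ω, v⟫_ℝ‖, sq_nonneg ‖⟪noise J g w i l ω, v⟫_ℝ‖]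
  have hexp : ∀ ω, ⟪networkNoise p J g w i ω, v⟫_ℝ ^ 2
      = ∑ k, ∑ l, p k * p l * (⟪noise J g w i k ω, v⟫_ℝ * ⟪noise J g w i l ω, v⟫_ℝ) := by
    intro ω
    rw [networkNoise, sum_inner, sq, Finset.sum_mul_sum]
    refine Finset.sum_congr rfl fun k _ => Finset.sum_congr rfl fun l _ => ?_
    rw [real_inner_smul_left, real_inner_smul_left]; ring
  have hoff : ∀ k l, k ≠ l →
      ∫ ω in B, ⟪noise J g w i k ω, v⟫_ℝ * ⟪noise J g w i l ω, v⟫_ℝ ∂P = 0 := by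
    intro k l hkl
    rw [← setIntegral_condExp hle (hint k l) hB,
      integral_congr_ae (ae_restrict_of_ae (hN.uncorrelated i k l hkl v v))]
    simp
  have hdiag : ∀ k, ∫ ω in B, ⟪noise J g w i k ω, v⟫_ℝ * ⟪noise J g w i k ω, v⟫_ℝ ∂P
      = ∫ ω in B, ⟪R k (w i k ω) v, v⟫_ℝ ∂P := by
    intro k
    rw [← setIntegral_condExp hle (hint k k) hB,
      integral_congr_ae (ae_restrict_of_ae (hR i k v v))]
  have hint' : ∀ k l, Integrable (fun ω => p k * p l
      * (⟪noise J g w i k ω, v⟫_ℝ * ⟪noise J g w i l ω, v⟫_ℝ)) (P.restrict B) := fun k l =>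
    ((hint k l).integrableOn (s := B)).const_mul (p k * p l)
  simp only [hexp]
  rw [integral_finsetSum _ fun k _ => integrable_finsetSum _ fun l _ => hint' k l]
  refine Finset.sum_congr rfl fun k _ => ?_
  rw [integral_finsetSum _ fun l _ => hint' k l, Finset.sum_eq_single k]
  · rw [integral_const_mul, hdiag]; ring
  · intro l _ hl
    rw [integral_const_mul, hoff k l (Ne.symm hl), mul_zero]
  · simp

/-- The noise excites the descent directions at strict saddle points. -/
lemma excites_strategyDescent (hN : NoiseConditions P J g (iterate A μ w0 g) σ)
    (hp : IsPerronVector A p) (hJ : CostConditions J δ G ρ) (hδ : 0 ≤ δ) (hG : 0 ≤ G)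
    (hμ : 0 < μ) (L : DisagreementGauge A p M)
    (hμL : L.bound * μ * N * δ ≤ (1 - L.rate) / 2) {R : Fin N → E M → E M →L[ℝ] E M}
    (hR : IsNoiseCovariance P J g (iterate A μ w0 g) R) {β γ σl Q : ℝ}
    (hRL : LipschitzCovariance R β γ) (hQ0 : 0 ≤ Q)
    (hQ : ∀ t : ℝ, 0 ≤ t → β * t ^ γ ≤ σl ^ 2 / 4 + Q * t ^ 4) {S : Set (E M)}
    (hS : NoiseInSaddles p R (aggCost p J) S σl) :
    (strategyDescent hN hp hJ hδ hG hμ L hμL).Excites S σl (8 * Q) := by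
  have := hp.nonempty
  intro x hx v hv hv1 i B hB
  change 3 / 4 * σl ^ 2 * P.real B
        - 8 * Q * (∫ ω in B, L.gauge (fun k => iterate A μ w0 g i k ω) ^ 4 ∂P
          + ∫ ω in B, ‖networkCentroid p (iterate A μ w0 g) i ω - x‖ ^ 4 ∂P)
      ≤ ∫ ω in B, ⟪networkNoise p J g (iterate A μ w0 g) i ω, v⟫_ℝ ^ 2 ∂P
  rw [setIntegral_networkNoise_sq hN hJ hR v i hB]
  set w := iterate A μ w0 g with hw
  have hP : 0 ≤ P.real B := measureReal_nonneg
  have i1 : IntegrableOn (fun ω => L.gauge (fun k => w i k ω) ^ 4) B P :=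
    ((strategyDescent hN hp hJ hδ hG hμ L hμL).integrable_dis_four i).integrableOn
  have i2 : IntegrableOn (fun ω => ‖networkCentroid p w i ω - x‖ ^ 4) B P :=
    ((strategyDescent hN hp hJ hδ hG hμ L hμL).integrable_disp_four i x).integrableOn
  set I : ℝ := ∫ ω in B, L.gauge (fun k => w i k ω) ^ 4 ∂P
    + ∫ ω in B, ‖networkCentroid p w i ω - x‖ ^ 4 ∂P with hI
  have hI0 : 0 ≤ I := add_nonneg
    (integral_nonneg fun ω => by positivity) (integral_nonneg fun ω => by positivity)
  have hk : ∀ k, (⟪R k x v, v⟫_ℝ - σl ^ 2 / 4) * P.real B - 8 * Q * I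
      ≤ ∫ ω in B, ⟪R k (w i k ω) v, v⟫_ℝ ∂P := by
    intro k
    have i3 : IntegrableOn (fun ω => ⟪R k (w i k ω) v, v⟫_ℝ) B P :=
      (integrable_condExp.congr (hR i k v v)).integrableOn
    have i12 := (i1.add i2).const_mul (8 * Q)
    have i4 : IntegrableOn (fun _ => ⟪R k x v, v⟫_ℝ - σl ^ 2 / 4) B P := integrable_const _
    have h := integral_mono (i4.sub i12) i3 fun ω => ?_
    · rwa [integral_sub' i4 i12, integral_const_mul, integral_add' i1 i2,
        setIntegral_const_real] at h
    · change ⟪R k x v, v⟫_ℝ - σl ^ 2 / 4 - 8 * Q * (L.gauge (fun k => w i k ω) ^ 4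
        + ‖networkCentroid p w i ω - x‖ ^ 4) ≤ ⟪R k (w i k ω) v, v⟫_ℝ
      set z := ‖w i k ω - x‖ with hz
      have h1 : ⟪R k x v, v⟫_ℝ - ⟪R k (w i k ω) v, v⟫_ℝ ≤ β * z ^ γ := by
        rw [← inner_sub_left, ← sub_apply]
        refine (real_inner_le_norm _ _).trans ?_
        rw [hv1, mul_one]
        refine ((R k x - R k (w i k ω)).le_opNorm v).trans ?_
        rw [hv1, mul_one, hz, ← norm_neg (w i k ω - x), neg_sub]
        exact hRL k x (w i k ω)
      have h2 := hQ z (norm_nonneg _)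
      have h3 : z ≤ L.gauge (fun k => w i k ω) + ‖networkCentroid p w i ω - x‖ := by
        have h4 := L.norm_sub_centroid_le (fun k => w i k ω) k
        have h5 : w i k ω - x = (w i k ω - centroid p (fun k => w i k ω))
            + (networkCentroid p w i ω - x) := by
          simp [networkCentroid]
        rw [hz, h5]
        exact (norm_add_le _ _).trans (add_le_add h4 le_rfl)
      have h6 : z ^ 4 ≤ 8 * (L.gauge (fun k => w i k ω) ^ 4
          + ‖networkCentroid p w i ω - x‖ ^ 4) := by
        refine (pow_le_pow_left₀ (norm_nonneg _) h3 4).trans ?_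
        have h := weighted_add_pow_four_le (a := 1) (b := 1) (x := L.gauge (fun k => w i k ω))
          (y := ‖networkCentroid p w i ω - x‖) zero_le_one zero_le_one
        norm_num at h
        exact h
      have h7 := mul_le_mul_of_nonneg_left h6 hQ0
      linarith
  have hcov : σl ^ 2 ≤ ∑ k, p k ^ 2 * ⟪R k x v, v⟫_ℝ := by
    have h := hS x hx v hv
    rw [hv1, one_pow, mul_one, aggCovariance] at h
    simpa [sum_inner, real_inner_smul_left] using h
  have hp2 : ∑ k, p k ^ 2 ≤ 1 := by
    rw [← hp.sum_one]
    exact Finset.sum_le_sum fun k _ => by nlinarith [hp.pos k, hp.le_one k]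
  have hsum : ∑ k, p k ^ 2 * ((⟪R k x v, v⟫_ℝ - σl ^ 2 / 4) * P.real B - 8 * Q * I)
      = (∑ k, p k ^ 2 * ⟪R k x v, v⟫_ℝ) * P.real B
        - (∑ k, p k ^ 2) * (σl ^ 2 / 4 * P.real B + 8 * Q * I) := by
    rw [Finset.sum_mul, Finset.sum_mul, ← Finset.sum_sub_distrib]
    exact Finset.sum_congr rfl fun k _ => by ring
  refine le_trans ?_ (Finset.sum_le_sum fun k _ =>
    mul_le_mul_of_nonneg_left (hk k) (sq_nonneg (p k)))
  rw [hsum]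
  have h1 := mul_le_mul_of_nonneg_right hcov hP
  have h2 := mul_le_mul_of_nonneg_right hp2
    (add_nonneg (mul_nonneg (by positivity) hP) (mul_nonneg (by positivity) hI0) :
      0 ≤ σl ^ 2 / 4 * P.real B + 8 * Q * I)
  linarith only [h1, h2]

end Strategy

/-! ### The time bound -/

lemma escapeTime_numerator_pos {M : ℕ} (hM : 0 < M) {σ σl : ℝ} (hσ : 0 < σ) (hσl : 0 < σl) :
    0 < Real.log (2 * (M : ℝ) * (σ ^ 2 / σl ^ 2) + 1) := by
  have hM' : (0 : ℝ) < M := by exact_mod_cast hM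
  exact Real.log_pos (by linarith [(by positivity : 0 < 2 * (M : ℝ) * (σ ^ 2 / σl ^ 2))])

lemma escapeTime_le {M : ℕ} (hM : 0 < M) {σ σl τ μ : ℝ} (hσ : 0 < σ) (hσl : 0 < σl) (hτ : 0 < τ)
    (hμ : 0 < μ) (hμτ : 2 * μ * τ ≤ 1) :
    escapeTime M σ σl τ μ ≤ Real.log (2 * (M : ℝ) * (σ ^ 2 / σl ^ 2) + 1) / (μ * τ) := by
  have h0 : 0 < μ * τ := by positivity
  refine div_le_div_of_nonneg_left (escapeTime_numerator_pos hM hσ hσl).le h0 ?_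
  have hpos : 0 < 1 + 2 * μ * τ := by linarith
  refine le_trans ?_ (Real.one_sub_inv_le_log_of_pos hpos)
  have h1 : 1 - (1 + 2 * μ * τ)⁻¹ = 2 * μ * τ / (1 + 2 * μ * τ) := by field_simp; ring
  rw [h1, le_div_iff₀ hpos]
  nlinarith

lemma le_escapeTime {M : ℕ} (hM : 0 < M) {σ σl τ μ : ℝ} (hσ : 0 < σ) (hσl : 0 < σl) (hτ : 0 < τ)
    (hμ : 0 < μ) :
    Real.log (2 * (M : ℝ) * (σ ^ 2 / σl ^ 2) + 1) / (2 * μ * τ) ≤ escapeTime M σ σl τ μ := by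
  have h0 : 0 < 2 * μ * τ := by positivity
  refine div_le_div_of_nonneg_left (escapeTime_numerator_pos hM hσ hσl).le
    (Real.log_pos (by linarith)) ?_
  have := Real.log_le_sub_one_of_pos (by linarith : 0 < 1 + 2 * μ * τ)
  linarith

lemma mem_secondOrder_of_isMin {M : ℕ} {f : E M → ℝ} {δ ρ σ τ π μ : ℝ} (hf : RegularCost f δ ρ)
    (hM : 0 < M) (hρ : 0 ≤ ρ) (hδ : 0 < δ) (hσ : 0 < σ) (hτ : 0 < τ) (hπ : 0 < π) (hμ : 0 < μ)
    (hμδ : μ * δ ≤ 1 / 4) {x : E M} (hx : ∀ y, f x ≤ f y) : x ∈ secondOrder f δ σ τ π μ := by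
  refine ⟨?_, hf.lambdaMin_nonneg_of_isMin hM hρ hx (by linarith)⟩
  have h1 : IsLocalMin f x := Filter.Eventually.of_forall hx
  have h2 : gradient f x = 0 := by simp [gradient, h1.fderiv_eq_zero]
  have hc1 : 0 < c1 δ μ := by rw [c1]; linarith
  have hc2 : 0 < c2 δ σ := by rw [c2]; positivity
  change ‖gradient f x‖ ^ 2 < _
  rw [h2, norm_zero, zero_pow two_ne_zero]
  positivity

/-- If avoiding a target up to time `n` has probability `O(1 / (μ² n))`, then the target is reached
by time `T` with probability at least `1 - π`, as soon as `T` is large. -/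
lemma prob_reach_ge {Ω : Type*} [MeasurableSpace Ω] {P : Measure Ω} [IsProbabilityMeasure P]
    {S : ℕ → Set Ω} {q b W T π : ℝ} (hq : 0 < q) (hW : 0 < W) (hπ : 0 < π) (hT : 0 ≤ T)
    (havoid : ∀ n : ℕ, q * (n - b) * P.real {ω | ∀ j ≤ n, ω ∉ S j} ≤ W)
    (hTW : W ≤ π * (q * (T - 1 - b))) :
    ENNReal.ofReal (1 - π) ≤ P {ω | ∃ i : ℕ, (i : ℝ) ≤ T ∧ ω ∈ S i} := by
  set n := ⌊T⌋₊ with hn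
  set U : Set Ω := {ω | ∀ j ≤ n, ω ∉ S j} with hU
  have hnT : T - 1 ≤ n := by linarith [Nat.lt_floor_add_one T]
  have hPU : P.real U ≤ π := by
    by_contra! h
    have h1 : W ≤ π * (q * (n - b)) := by
      refine hTW.trans ?_
      gcongr
    have h2 : 0 < q * (n - b) := pos_of_mul_pos_right (hW.trans_le h1) hπ.le
    have h3 := havoid n
    have h4 := mul_lt_mul_of_pos_left h h2
    linarith
  have hsub : Uᶜ ⊆ {ω | ∃ i : ℕ, (i : ℝ) ≤ T ∧ ω ∈ S i} := by
    intro ω hω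
    simp only [hU, Set.mem_compl_iff, Set.mem_ofPred_eq, not_forall, not_not] at hω
    obtain ⟨j, hj, hjS⟩ := hω
    exact ⟨j, (Nat.le_floor_iff hT).1 hj, hjS⟩
  refine le_trans ?_ (measure_mono hsub)
  rw [ENNReal.ofReal_sub _ hπ.le, ENNReal.ofReal_one, tsub_le_iff_right]
  have h5 : P U ≤ ENNReal.ofReal π := by
    rw [← ofReal_measureReal (measure_ne_top P U)]
    exact ENNReal.ofReal_le_ofReal hPU
  calc (1 : ENNReal) = P (Uᶜ ∪ U) := by rw [Set.compl_union_self, measure_univ]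
    _ ≤ P Uᶜ + P U := measure_union_le _ _
    _ ≤ P Uᶜ + ENNReal.ofReal π := by gcongr

end Diffusion

end

theorem theorem2 {N M : ℕ} (hM : 0 < M)
    (A : Matrix (Fin N) (Fin N) ℝ) (hA : Diffusion.IsCombinationMatrix A)
    (p : Fin N → ℝ) (hp : Diffusion.IsPerronVector A p)
    (J : Fin N → Diffusion.E M → ℝ) (δ G ρ : ℝ) (hδ : 0 < δ)
    (hJ : Diffusion.CostConditions J δ G ρ)
    (hbdd : BddBelow (Set.range (Diffusion.aggCost p J)))
    (w0 : Fin N → Diffusion.E M)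
    (σ σl β γ : ℝ) (hσ : 0 < σ) (hσl : 0 < σl) (hγ : 0 < γ) (hγ4 : γ ≤ 4) :
    ∃ Cs : ℝ, 0 < Cs ∧ ∀ π : ℝ, 0 < π → π < 1 → ∃ Cg : ℝ, 0 < Cg ∧
      ∀ τ : ℝ, 0 < τ → ∃ μ₀ : ℝ, 0 < μ₀ ∧ ∀ μ : ℝ, 0 < μ → μ < μ₀ →
        Diffusion.escapeTime M σ σl τ μ ≤ Cs / (μ * τ) ∧
        (∀ x ∈ Diffusion.secondOrder (Diffusion.aggCost p J) δ σ τ π μ,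
          ‖gradient (Diffusion.aggCost p J) x‖ ^ 2 ≤ Cg * μ ∧
          -τ ≤ Diffusion.lambdaMin (Diffusion.hessian (Diffusion.aggCost p J) x)) ∧
        ∀ (Ω : Type*) [MeasurableSpace Ω] (P : Measure Ω) [IsProbabilityMeasure P]
          (g : ℕ → Fin N → Diffusion.E M → Ω → Diffusion.E M)
          (R : Fin N → Diffusion.E M → Diffusion.E M →L[ℝ] Diffusion.E M),
          Diffusion.NoiseConditions P J g (Diffusion.iterate A μ w0 g) σ →
          Diffusion.IsNoiseCovariance P J g (Diffusion.iterate A μ w0 g) R →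
          Diffusion.LipschitzCovariance R β γ →
          Diffusion.NoiseInSaddles p R (Diffusion.aggCost p J)
            (Diffusion.strictSaddle (Diffusion.aggCost p J) δ σ τ π μ) σl →
          ENNReal.ofReal (1 - π) ≤
            P {ω | ∃ i : ℕ,
              (i : ℝ) ≤ (Diffusion.aggCost p J (Diffusion.centroid p w0)
                    - ⨅ x, Diffusion.aggCost p J x) / (μ ^ 2 * Diffusion.c2 δ σ * π)
                  * Diffusion.escapeTime M σ σl τ μ ∧
              Diffusion.centroid p (fun k => Diffusion.iterate A μ w0 g i k ω) ∈
                Diffusion.secondOrder (Diffusion.aggCost p J) δ σ τ π μ} := by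
  have hNe := hp.nonempty
  have hG : 0 ≤ G :=
    (norm_nonneg _).trans (hJ.bounded_disagreement hNe.some hNe.some 0)
  have hρ : 0 ≤ ρ := hJ.hessian_const_nonneg hM hNe.some
  have hf := hJ.regularCost (p := p) (fun k => (hp.pos k).le) hp.sum_one
  obtain ⟨L⟩ := Diffusion.nonempty_disagreementGauge (M := M) hA hp
  obtain ⟨Q, hQ0, hQ⟩ := Diffusion.exists_rpow_le_add_pow_four β hγ hγ4
    (by positivity : 0 < σl ^ 2 / 4)
  set f := Diffusion.aggCost p J with hfdef
  set m : ℝ := ⨅ x, f x with hm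
  have hmf : ∀ x, m ≤ f x := ciInf_le hbdd
  have hc2 : 0 < Diffusion.c2 δ σ := by rw [Diffusion.c2]; positivity
  have hr := sub_pos.2 L.rate_lt_one
  have hr0 := L.rate_pos
  set ℓ : ℝ := Real.log (2 * (M : ℝ) * (σ ^ 2 / σl ^ 2) + 1) with hℓ
  have hℓ0 : 0 < ℓ := Diffusion.escapeTime_numerator_pos hM hσ hσl
  refine ⟨ℓ, hℓ0, fun π hπ hπ1 => ⟨4 * Diffusion.c2 δ σ * (1 + 1 / π), by positivity,
    fun τ hτ => ?_⟩⟩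
  obtain ⟨a, κ, ha, hκ, hmain⟩ := Diffusion.exists_avoid_prob_bound hM hf hρ hmf hδ hσ
    (by linarith : 0 ≤ (1 + L.rate) / 2) (by linarith : (1 + L.rate) / 2 < 1)
    (L.moment_nonneg G σ) hσl hτ hπ hπ1 (by linarith : 0 ≤ 8 * Q)
  set W : ℝ := f (Diffusion.centroid p w0) + a * L.gauge w0 ^ 2 - m with hW
  set g₀ : ℝ := f (Diffusion.centroid p w0) - m with hg₀
  have hg₀0 : 0 ≤ g₀ := sub_nonneg.2 (hmf _)
  have e1 := Diffusion.eventually_le_of_continuous (g := fun μ => 2 * μ * τ) (b := 1)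
    (by fun_prop) (by norm_num)
  have e2 := Diffusion.eventually_le_of_continuous (g := fun μ => μ * δ) (b := 1 / 4)
    (by fun_prop) (by norm_num)
  have e3 := Diffusion.eventually_le_of_continuous (g := fun μ => L.bound * μ * N * δ)
    (b := (1 - L.rate) / 2) (by fun_prop) (by simp only [mul_zero, zero_mul]; positivity)
  -- the bound on `i^o` is of order `μ⁻³`, while the potential forces order `μ⁻²`; if the initial
  -- cost is already minimal, the initial point itself is the one sought
  have e4 : ∀ᶠ μ in nhdsWithin (0 : ℝ) (Set.Ioi 0), 0 < g₀ →
      2 * τ * (μ * W + π * Diffusion.c2 δ σ * μ ^ 2 * (κ + 3 * μ)) ≤ g₀ * ℓ := by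
    by_cases h : 0 < g₀
    · exact (Diffusion.eventually_le_of_continuous
        (g := fun μ => 2 * τ * (μ * W + π * Diffusion.c2 δ σ * μ ^ 2 * (κ + 3 * μ)))
        (by fun_prop) (by norm_num; positivity)).mono fun _ h _ => h
    · exact Filter.Eventually.of_forall fun _ h' => absurd h' h
  obtain ⟨μ₀, hμ₀, hall⟩ := (nhdsGT_basis (0 : ℝ)).eventually_iff.1
    (((hmain.and e1).and (e2.and e3)).and e4)
  refine ⟨μ₀, hμ₀, fun μ hμ hμμ₀ => ?_⟩
  obtain ⟨⟨⟨hmain, h1⟩, h2, h3⟩, h4⟩ := hall ⟨hμ, hμμ₀⟩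
  refine ⟨Diffusion.escapeTime_le hM hσ hσl hτ hμ h1, fun x hx => ⟨?_, hx.2.le⟩, ?_⟩
  · have hx1 : ‖gradient f x‖ ^ 2
        < μ * (Diffusion.c2 δ σ / Diffusion.c1 δ μ) * (1 + 1 / π) := hx.1
    have hc1 : 1 / 4 ≤ Diffusion.c1 δ μ := by rw [Diffusion.c1]; linarith
    have h5 : Diffusion.c2 δ σ / Diffusion.c1 δ μ ≤ 4 * Diffusion.c2 δ σ := by
      rw [div_le_iff₀ (by linarith)]
      nlinarith only [hc1, hc2]
    calc ‖gradient f x‖ ^ 2 ≤ μ * (4 * Diffusion.c2 δ σ) * (1 + 1 / π) := by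
          refine hx1.le.trans ?_
          gcongr
      _ = 4 * Diffusion.c2 δ σ * (1 + 1 / π) * μ := by ring
  intro Ω _ P _ g R hN hR hRL hS
  have hes := Diffusion.le_escapeTime hM hσ hσl hτ hμ
  set es := Diffusion.escapeTime M σ σl τ μ with hesdef
  have hes0 : 0 ≤ es := le_trans (by positivity) hes
  have hT0 : 0 ≤ g₀ / (μ ^ 2 * Diffusion.c2 δ σ * π) * es := by positivity
  rcases hg₀0.eq_or_lt with hg | hg
  · have hmin : ∀ y, f (Diffusion.centroid p w0) ≤ f y := fun y => by
      linarith [hmf y, sub_eq_zero.1 (hg₀.symm.trans hg.symm)]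
    have huniv : {ω | ∃ i : ℕ, (i : ℝ) ≤ g₀ / (μ ^ 2 * Diffusion.c2 δ σ * π) * es ∧
        Diffusion.centroid p (fun k => Diffusion.iterate A μ w0 g i k ω)
          ∈ Diffusion.secondOrder f δ σ τ π μ} = Set.univ :=
      Set.eq_univ_of_forall fun ω => ⟨0, by simpa using hT0,
        Diffusion.mem_secondOrder_of_isMin hf hM hρ hδ hσ hτ hπ hμ h2 hmin⟩
    rw [huniv, measure_univ]
    exact ENNReal.ofReal_le_one.2 (by linarith)
  · have hX := Diffusion.excites_strategyDescent hN hp hJ hδ.le hG hμ L h3 hR hRL hQ0 hQ hS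
    have havoid := hmain Ω P _ hX
    have hV0 : ∫ ω, (Diffusion.strategyDescent hN hp hJ hδ.le hG hμ L h3).potential a 0 ω ∂P
        = f (Diffusion.centroid p w0) + a * L.gauge w0 ^ 2 := by
      change ∫ _, (f (Diffusion.centroid p w0) + a * L.gauge w0 ^ 2) ∂P = _
      simp
    rw [hV0] at havoid
    have hW0 : 0 < W := by
      have h5 : 0 ≤ a * L.gauge w0 ^ 2 := by positivity
      have h6 : W = g₀ + a * L.gauge w0 ^ 2 := by rw [hW, hg₀]; ring
      rw [h6]; linarith only [hg, h5]
    refine Diffusion.prob_reach_ge (q := Diffusion.c2 δ σ * μ ^ 2) (b := κ / μ + 2) (W := W)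
      (by positivity) hW0 hπ hT0 havoid ?_
    have h5 : π * (Diffusion.c2 δ σ * μ ^ 2
        * (g₀ / (μ ^ 2 * Diffusion.c2 δ σ * π) * es - 1 - (κ / μ + 2)))
        = g₀ * es - π * Diffusion.c2 δ σ * μ * (κ + 3 * μ) := by
      field_simp
      ring
    have h6 : g₀ * (ℓ / (2 * μ * τ)) ≤ g₀ * es := by gcongr
    have h7 : W + π * Diffusion.c2 δ σ * μ * (κ + 3 * μ) ≤ g₀ * (ℓ / (2 * μ * τ)) := by
      rw [← mul_div_assoc, le_div_iff₀ (by positivity)]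
      refine le_trans (le_of_eq ?_) (h4 hg)
      ring
    rw [h5]
    linarith only [h6, h7]
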